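/- Let $k$ be a commutative ring and $A$ an associative unital $k$-algebra. A (right) $A^e$-contraaction on $A$ is a $k$-linear map $\gamma:\mathrm{Hom}_k(A,A)\to A$ such that $$\gamma\big(f(a\,-)\big)=\gamma(f)\,a,\qquad \gamma\big(x\mapsto\gamma(y\mapsto g(x\otimes y))\big)=\gamma\big(x\mapsto g(x\otimes 1)\big),\qquad \gamma(x\mapsto mx)=m$$ for all $f\in\mathrm{Hom}_k(A,A)$, $g\in\mathrm{Hom}_k(A\otimes_k A,A)$, $a,m\in A$. It is called stable if $\gamma(x\mapsto xa)=a$ for all $a\in A$. Let $C^n(A,A)=\mathrm{Hom}_k(A^{\otimes n},A)$ be the Hochschild cochains, with the partial compositions ($1\le i\le p$, slots numbered from the right) $$(f\circ_i g)(a_1,\dots,a_{p+q-1})=f\big(a_1,\dots,a_{p-i},g(a_{p-i+1},\dots,a_{p-i+q}),a_{p-i+q+1},\dots,a_{p+q-1}\big),$$ the identity $\mathrm{id}_A\in C^1$, the multiplication $\mu\in C^2$ of $A$ and the unit $1_A\in C^0$. Suppose that $\gamma$ is an $A^e$-contraaction on $A$, and put $$(\tau f)(a_1,\dots,a_n)=\gamma\big(a_1f(a_2,\dots,a_n,-)\big),$$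 which for $n=0$ is read as $\tau f=\gamma(x\mapsto xf)$. Then: 1. With $\tau$, the above data form a para-cyclic (non-$\Sigma$) operad with multiplication: they form an operad with multiplication, and $\tau(\varphi\circ_1\psi)=\tau\psi\circ_q\tau\varphi$ for $p,q\ge1$, $\tau(\varphi\circ_i\psi)=\tau\varphi\circ_{i-1}\psi$ for $2\le i\le p$, $\tau\,\mathrm{id}_A=\mathrm{id}_A$ and $\tau\mu=\mu$ (for $\varphi\in C^p$, $\psi\in C^q$). If $\gamma$ is stable, this operad is cyclic, i.e. moreover $\tau^{n+1}=\mathrm{id}$ on $C^n(A,A)$. 2. With the Hochschild cofaces $\delta_0f=f(a_1,\dots,a_n)a_{n+1}$, $\delta_if=f(\dots,a_{n-i+1}a_{n-i+2},\dots)$ for $1\le i\le n$, $\delta_{n+1}f=a_1f(a_2,\dots,a_{n+1})$ and the codegeneracies $\sigma_jf=f(a_1,\dots,a_{n-j-1},1,a_{n-j},\dots,a_{n-1})$ for $f\in C^n(A,A)$, $0\le j\le n-1$, the operator $\tau$ makes $C^\bullet(A,A)$ a para-cocyclic $k$-module, which is cocyclic if $\gamma$ is stable. 3. If $\gamma$ is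 stable, then the Hochschild cohomology $H^\bullet(A,A)$ is a Batalin–Vilkovisky algebra: the cup product $(f\smile g)(a_1,\dots,a_{p+q})=f(a_1,\dots,a_p)\,g(a_{p+1},\dots,a_{p+q})$ and the Gerstenhaber bracket $\{f,g\}=f\,\bar\circ\,g-(-1)^{(p-1)(q-1)}g\,\bar\circ\,f$, where $f\,\bar\circ\,g=\sum_{i=1}^p(-1)^{(q-1)(i-1)}f\circ_ig$, induce on $H^\bullet(A,A)$ the structure of a Gerstenhaber algebra, Connes' operator $$Bf=(-1)^{n}\sum_{j=0}^{n}(-1)^{nj}\,\tau^j\,s\big(f-(-1)^{n+1}\tau f\big)\quad(f\in C^{n+1}(A,A)),\qquad (sf)(a_1,\dots,a_n)=\gamma\big(f(a_1,\dots,a_n,-)\big),$$ induces a differential $B:H^{n+1}(A,A)\to H^n(A,A)$ (with $B=0$ on $H^0$), and $$\{\alpha,\beta\}=(-1)^p\big(B(\alpha\smile\beta)-B(\alpha)\smile\beta-(-1)^p\alpha\smile B(\beta)\big)$$ for $\alpha\in H^p(A,A)$, $\beta\in H^q(A,A)$. 4. If $\gamma$ is stable and $A$ is projective as a $k$-module,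 then $\mathrm{Ext}^\bullet_{A^e}(A,A)$, where $A^e=A\otimes_kA^{\mathrm{op}}$ acts on $A$ by $(a\otimes b)c=acb$, with its Yoneda product is a Batalin–Vilkovisky algebra, isomorphic as such to $H^\bullet(A,A)$. -/

import Mathlib

open scoped TensorProduct

universe u v

section GradedStructures

variable (k : Type u) [CommRing k] (O : ℕ → Type v) [∀ n, AddCommGroup (O n)] [∀ n, Module k (O n)]

/-- A non-symmetric operad with multiplication in the category of `k`-modules.
The partial composition `φ ∘ᵢ ψ ∈ O(p + q - 1)`, for `φ ∈ O(p)`, `ψ ∈ O(q)`, is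
`comp p q (p + q - 1) i φ ψ`, with `1 ≤ i ≤ p`; for all other indices `comp` is zero. -/
structure OperadWithMultiplication where
  comp : ∀ p q r : ℕ, ℕ → O p →ₗ[k] O q →ₗ[k] O r
  one : O 1
  mul : O 2
  unit : O 0
  comp_eq_zero : ∀ p q r i, ¬ (p + q = r + 1 ∧ 1 ≤ i ∧ i ≤ p) → comp p q r i = 0
  assoc_left : ∀ (p q r n i j : ℕ) (φ : O p) (ψ : O q) (χ : O r), p + q + r = n + 2 →
    1 ≤ i → i ≤ p → 1 ≤ j → j < i →
    comp (p + q - 1) r n j (comp p q (p + q - 1) i φ ψ) χ =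
      comp (p + r - 1) q n (i + r - 1) (comp p r (p + r - 1) j φ χ) ψ
  assoc_middle : ∀ (p q r n i j : ℕ) (φ : O p) (ψ : O q) (χ : O r), p + q + r = n + 2 →
    1 ≤ i → i ≤ p → i ≤ j → j < q + i →
    comp (p + q - 1) r n j (comp p q (p + q - 1) i φ ψ) χ =
      comp p (q + r - 1) n i φ (comp q r (q + r - 1) (j - i + 1) ψ χ)
  assoc_right : ∀ (p q r n i j : ℕ) (φ : O p) (ψ : O q) (χ : O r), p + q + r = n + 2 →
    1 ≤ i → i ≤ p → q + i ≤ j → j ≤ p + q - 1 →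
    comp (p + q - 1) r n j (comp p q (p + q - 1) i φ ψ) χ =
      comp (p + r - 1) q n i (comp p r (p + r - 1) (j - q + 1) φ χ) ψ
  comp_one : ∀ (p i : ℕ) (φ : O p), 1 ≤ i → i ≤ p → comp p 1 p i φ one = φ
  one_comp : ∀ (p : ℕ) (φ : O p), comp 1 p p 1 one φ = φ
  mul_assoc : comp 2 2 3 1 mul mul = comp 2 2 3 2 mul mul
  mul_unit_left : comp 2 0 1 1 mul unit = one
  mul_unit_right : comp 2 0 1 2 mul unit = one

/-- A para-cyclic operad with multiplication. -/
structure ParaCyclicOperadWithMultiplication extends OperadWithMultiplication k O where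
  tau : ∀ n : ℕ, O n →ₗ[k] O n
  tau_comp_one : ∀ (p q r : ℕ) (φ : O p) (ψ : O q), p + q = r + 1 → 1 ≤ p → 1 ≤ q →
    tau r (comp p q r 1 φ ψ) = comp q p r q (tau q ψ) (tau p φ)
  tau_comp : ∀ (p q r i : ℕ) (φ : O p) (ψ : O q), p + q = r + 1 → 2 ≤ i → i ≤ p →
    tau r (comp p q r i φ ψ) = comp p q r (i - 1) (tau p φ) ψ
  tau_one : tau 1 one = one
  tau_mul : tau 2 mul = mul

variable {k O} in
/-- A para-cyclic operad is cyclic if `τ ^ (n + 1) = id` in every degree `n`. -/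
def ParaCyclicOperadWithMultiplication.IsCyclic
    (P : ParaCyclicOperadWithMultiplication k O) : Prop :=
  ∀ (n : ℕ) (φ : O n), (P.tau n)^[n + 1] φ = φ

/-- A para-cocyclic `k`-module: a cosimplicial `k`-module with cofaces `δᵢ : O(n) → O(n + 1)`,
`0 ≤ i ≤ n + 1`, codegeneracies `σⱼ : O(n + 1) → O(n)`, `0 ≤ j ≤ n`, and a compatible `τ`. -/
structure ParaCocyclicModule where
  delta : ∀ n : ℕ, Fin (n + 2) → O n →ₗ[k] O (n + 1)
  sigma : ∀ n : ℕ, Fin (n + 1) → O (n + 1) →ₗ[k] O n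
  tau : ∀ n : ℕ, O n →ₗ[k] O n
  delta_delta : ∀ (n : ℕ) (i j : Fin (n + 2)) (x : O n), i ≤ j →
    delta (n + 1) j.succ (delta n i x) = delta (n + 1) i.castSucc (delta n j x)
  sigma_sigma : ∀ (n : ℕ) (i j : Fin (n + 1)) (x : O (n + 2)), i ≤ j →
    sigma n j (sigma (n + 1) i.castSucc x) = sigma n i (sigma (n + 1) j.succ x)
  sigma_delta_of_lt : ∀ (n : ℕ) (i : Fin (n + 2)) (j : Fin (n + 1)) (x : O (n + 1)),
    i ≤ j.castSucc →
    sigma (n + 1) j.succ (delta (n + 1) i.castSucc x) = delta n i (sigma n j x)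
  sigma_delta_self : ∀ (n : ℕ) (j : Fin (n + 1)) (x : O n), sigma n j (delta n j.castSucc x) = x
  sigma_delta_succ : ∀ (n : ℕ) (j : Fin (n + 1)) (x : O n), sigma n j (delta n j.succ x) = x
  sigma_delta_of_gt : ∀ (n : ℕ) (i : Fin (n + 2)) (j : Fin (n + 1)) (x : O (n + 1)),
    j.castSucc < i →
    sigma (n + 1) j.castSucc (delta (n + 1) i.succ x) = delta n i (sigma n j x)
  tau_delta_zero : ∀ (n : ℕ) (x : O n), tau (n + 1) (delta n 0 x) = delta n (Fin.last _) x
  tau_delta_succ : ∀ (n : ℕ) (i : Fin (n + 1)) (x : O n),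
    tau (n + 1) (delta n i.succ x) = delta n i.castSucc (tau n x)
  tau_sigma_zero : ∀ (n : ℕ) (x : O (n + 1)),
    tau n (sigma n 0 x) = sigma n (Fin.last _) (tau (n + 1) (tau (n + 1) x))
  tau_sigma_succ : ∀ (n : ℕ) (i : Fin n) (x : O (n + 1)),
    tau n (sigma n i.succ x) = sigma n i.castSucc (tau (n + 1) x)

variable {k O} in
/-- A para-cocyclic module is cocyclic if `τ ^ (n + 1) = id` in every degree `n`. -/
def ParaCocyclicModule.IsCocyclic (P : ParaCocyclicModule k O) : Prop :=
  ∀ (n : ℕ) (x : O n), (P.tau n)^[n + 1] x = x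

/-- A Gerstenhaber algebra, graded by `ℕ`. The product of `a ∈ V^p` and `b ∈ V^q` is
`cup p q (p + q) a b`, the bracket is `bracket p q (p + q - 1) a b`; for all other indices (in
particular for `p = q = 0` in the case of the bracket) the operations are zero. -/
structure GerstenhaberAlgebra where
  cup : ∀ p q n : ℕ, O p →ₗ[k] O q →ₗ[k] O n
  one : O 0
  bracket : ∀ p q n : ℕ, O p →ₗ[k] O q →ₗ[k] O n
  cup_eq_zero : ∀ p q n, p + q ≠ n → cup p q n = 0
  bracket_eq_zero : ∀ p q n, p + q ≠ n + 1 → bracket p q n = 0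
  cup_assoc : ∀ (p q r n : ℕ) (a : O p) (b : O q) (c : O r), p + q + r = n →
    cup (p + q) r n (cup p q (p + q) a b) c = cup p (q + r) n a (cup q r (q + r) b c)
  one_cup : ∀ (p : ℕ) (a : O p), cup 0 p p one a = a
  cup_one : ∀ (p : ℕ) (a : O p), cup p 0 p a one = a
  cup_comm : ∀ (p q n : ℕ) (a : O p) (b : O q),
    cup p q n a b = (-1 : k) ^ (p * q) • cup q p n b a
  bracket_antisymm : ∀ (p q n : ℕ) (a : O p) (b : O q),
    bracket p q n a b = -((-1 : k) ^ ((p + 1) * (q + 1)) • bracket q p n b a)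
  jacobi : ∀ (p q r n : ℕ) (a : O p) (b : O q) (c : O r), p + q + r = n + 2 →
    bracket p (q + r - 1) n a (bracket q r (q + r - 1) b c) =
      bracket (p + q - 1) r n (bracket p q (p + q - 1) a b) c +
        (-1 : k) ^ ((p + 1) * (q + 1)) •
          bracket q (p + r - 1) n b (bracket p r (p + r - 1) a c)
  leibniz : ∀ (p q r n : ℕ) (c : O p) (a : O q) (b : O r), p + q + r = n + 1 →
    bracket p (q + r) n c (cup q r (q + r) a b) =
      cup (p + q - 1) r n (bracket p q (p + q - 1) c a) b +
        (-1 : k) ^ ((p + 1) * q) • cup q (p + r - 1) n a (bracket p r (p + r - 1) c b)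

/-- A Batalin-Vilkovisky algebra: a Gerstenhaber algebra with a differential `B` of degree `-1`
(`B p n : V^p → V^n` is zero unless `p = n + 1`) that generates the bracket. In
`bracket_eq` the truncated index `p - 1` for `p = 0` is harmless, since `B 0 0 = 0`. -/
structure BatalinVilkoviskyAlgebra extends GerstenhaberAlgebra k O where
  B : ∀ p n : ℕ, O p →ₗ[k] O n
  B_eq_zero : ∀ p n, p ≠ n + 1 → B p n = 0
  B_B : ∀ (n : ℕ) (a : O (n + 2)), B (n + 1) n (B (n + 2) (n + 1) a) = 0
  bracket_eq : ∀ (p q n : ℕ) (a : O p) (b : O q), p + q = n + 1 →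
    bracket p q n a b = (-1 : k) ^ p •
      (B (p + q) n (cup p q (p + q) a b) - cup (p - 1) q n (B p (p - 1) a) b
        - (-1 : k) ^ p • cup p (q - 1) n a (B q (q - 1) b))

end GradedStructures

section Hochschild

variable (k : Type u) (A : Type v) [CommRing k] [Ring A] [Algebra k A]

/-- Hochschild cochains `C^n(A, A) = Hom_k(A^{⊗ n}, A)`, as `k`-multilinear maps. -/
abbrev HochschildCochain (n : ℕ) : Type v := MultilinearMap k (fun _ : Fin n => A) A

namespace HochschildCochain

variable {k A}

/-- The arguments `(a₁, …, a_m, g(a_{m+1}, …, a_{m+q}), a_{m+q+1}, …, a_{p+q-1})`. -/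
def insertArg {p q r : ℕ} (h : p + q = r + 1) (m : Fin p) (g : HochschildCochain k A q)
    (a : Fin r → A) (t : Fin p) : A :=
  if h₁ : t < m then a ⟨t, by omega⟩
  else if h₂ : t = m then g (fun s => a ⟨m + s, by omega⟩)
  else a ⟨t + q - 1, by omega⟩

theorem insertArg_update {p q r : ℕ} (h : p + q = r + 1) (m : Fin p)
    (g : HochschildCochain k A q) (a : Fin r → A) (j : Fin r) :
    (∃ t : Fin p, ∀ x, insertArg h m g (Function.update a j x) =
      Function.update (insertArg h m g a) t x) ∨
    (∃ s : Fin q, ∀ x, insertArg h m g (Function.update a j x) =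
      Function.update (insertArg h m g a) m
        (g (Function.update (fun s : Fin q => a ⟨m + s, by omega⟩) s x))) := by
  by_cases h₁ : (j : ℕ) < m
  · refine Or.inl ⟨⟨j, by omega⟩, fun x => ?_⟩
    funext t
    simp only [insertArg, Function.update_apply, Fin.ext_iff]
    split_ifs <;> first | rfl | omega | skip
    congr 1
    funext s
    rw [if_neg (by omega)]
  · by_cases h₂ : (j : ℕ) < m + q
    · refine Or.inr ⟨⟨j - m, by omega⟩, fun x => ?_⟩
      funext t
      simp only [insertArg, Function.update_apply, Fin.ext_iff]
      split_ifs <;> first | rfl | omega | skip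
      congr 1
      funext s
      simp only [Function.update_apply, Fin.ext_iff]
      by_cases h₃ : (m : ℕ) + s = j
      · rw [if_pos h₃, if_pos (by omega)]
      · rw [if_neg h₃, if_neg (by omega)]
    · refine Or.inl ⟨⟨j + 1 - q, by omega⟩, fun x => ?_⟩
      funext t
      simp only [insertArg, Function.update_apply, Fin.ext_iff]
      split_ifs <;> first | rfl | omega | skip
      congr 1
      funext s
      rw [if_neg (by omega)]

/-- The operadic composition `f ∘_{i+1} g` (the index `i` is zero-based):
`(f ∘ᵢ g)(a₁, …, a_{p+q-1}) = f(a₁, …, a_{p-i}, g(a_{p-i+1}, …, a_{p-i+q}), …, a_{p+q-1})` for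
`1 ≤ i ≤ p`, so that slots are numbered from the right. -/
def comp {p q r : ℕ} (h : p + q = r + 1) (i : Fin p) (f : HochschildCochain k A p)
    (g : HochschildCochain k A q) : HochschildCochain k A r where
  toFun a := f (insertArg h i.rev g a)
  map_update_add' := by
    intro inst a j x y
    obtain rfl := Subsingleton.elim inst (instDecidableEqFin r)
    obtain ⟨t, ht⟩ | ⟨s, hs⟩ := insertArg_update h i.rev g a j
    · simp only [ht, f.map_update_add]
    · simp only [hs, f.map_update_add, g.map_update_add]
  map_update_smul' := by
    intro inst a j c x
    obtain rfl := Subsingleton.elim inst (instDecidableEqFin r)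
    obtain ⟨t, ht⟩ | ⟨s, hs⟩ := insertArg_update h i.rev g a j
    · simp only [ht, f.map_update_smul]
    · simp only [hs, f.map_update_smul, g.map_update_smul]

theorem comp_apply {p q r : ℕ} (h : p + q = r + 1) (i : Fin p) (f : HochschildCochain k A p)
    (g : HochschildCochain k A q) (a : Fin r → A) :
    comp h i f g a = f (insertArg h i.rev g a) := rfl

/-- The cup product `(f ⌣ g)(a₁, …, a_{p+q}) = f(a₁, …, a_p) g(a_{p+1}, …, a_{p+q})`. -/
noncomputable def cup {p q n : ℕ} (h : p + q = n) (f : HochschildCochain k A p)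
    (g : HochschildCochain k A q) : HochschildCochain k A n :=
  ((LinearMap.mul' k A).compMultilinearMap (f.domCoprod g)).domDomCongr
    (finSumFinEquiv.trans (finCongr h))

theorem cup_apply {p q n : ℕ} (h : p + q = n) (f : HochschildCochain k A p)
    (g : HochschildCochain k A q) (a : Fin n → A) :
    cup h f g a = f (fun i => a ⟨i, by omega⟩) * g (fun i => a ⟨p + i, by omega⟩) := by
  subst h
  rfl

variable (k A) in
/-- The identity map of `A`, the unit of the operad. -/
def one : HochschildCochain k A 1 := MultilinearMap.ofSubsingleton k A A 0 LinearMap.id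

theorem one_apply (a : Fin 1 → A) : one k A a = a 0 := rfl

variable (k A) in
/-- The multiplication of `A`. -/
noncomputable def mul : HochschildCochain k A 2 := cup rfl (one k A) (one k A)

variable (k A) in
/-- The unit element of `A`. -/
def unit : HochschildCochain k A 0 := MultilinearMap.constOfIsEmpty k (fun _ : Fin 0 => A) 1

/-- The cofaces `δᵢ : C^n(A, A) → C^{n+1}(A, A)`, `0 ≤ i ≤ n + 1`, numbered from the right:
`δ₀ f = f(a₁, …, a_n) a_{n+1}`, `δᵢ f = f(a₁, …, a_{n-i+1} a_{n-i+2}, …, a_{n+1})` and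
`δ_{n+1} f = a₁ f(a₂, …, a_{n+1})`. -/
noncomputable def coface {n : ℕ} (i : Fin (n + 2)) (f : HochschildCochain k A n) :
    HochschildCochain k A (n + 1) :=
  if h₀ : (i : ℕ) = 0 then cup rfl f (one k A)
  else if h₁ : (i : ℕ) ≤ n then comp (by omega) ⟨i - 1, by omega⟩ f (mul k A)
  else cup (Nat.add_comm 1 n) (one k A) f

/-- The codegeneracies `(σⱼ f)(a₁, …, a_n) = f(a₁, …, a_{n-j}, 1, a_{n-j+1}, …, a_n)`. -/
def codegeneracy {n : ℕ} (j : Fin (n + 1)) (f : HochschildCochain k A (n + 1)) :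
    HochschildCochain k A n :=
  comp (by omega) j f (unit k A)

/-- The Hochschild coboundary
`(d f)(a₁, …, a_{n+1}) = a₁ f(a₂, …, a_{n+1}) + ∑_{1 ≤ i ≤ n} (-1)^i f(…, aᵢ a_{i+1}, …)
  + (-1)^{n+1} f(a₁, …, a_n) a_{n+1}`. -/
noncomputable def coboundary (n : ℕ) : HochschildCochain k A n →ₗ[k] HochschildCochain k A (n + 1) where
  toFun f := cup (Nat.add_comm 1 n) (one k A) f
    + ∑ i : Fin n, (-1 : k) ^ ((i : ℕ) + 1) • comp (by omega) i.rev f (mul k A)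
    + (-1 : k) ^ (n + 1) • cup rfl f (one k A)
  map_add' f g := by
    ext a
    simp only [add_apply, sum_apply, smul_apply,
      cup_apply, comp_apply, mul_add, add_mul, smul_add, Finset.sum_add_distrib]
    abel
  map_smul' c f := by
    ext a
    simp only [add_apply, sum_apply, smul_apply,
      cup_apply, comp_apply, mul_smul_comm, smul_mul_assoc, smul_add, Finset.smul_sum,
      RingHom.id_apply, smul_comm c]

theorem coboundary_apply (n : ℕ) (f : HochschildCochain k A n) (a : Fin (n + 1) → A) :
    coboundary n f a = a 0 * f (fun j => a j.succ)
      + ∑ i : Fin n, (-1 : k) ^ ((i : ℕ) + 1) • f (Fin.contractNth i.castSucc (· * ·) a)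
      + (-1 : k) ^ (n + 1) • (f (fun j => a j.castSucc) * a (Fin.last n)) := by
  simp only [coboundary, LinearMap.coe_mk, AddHom.coe_mk, add_apply,
    sum_apply, smul_apply, cup_apply, comp_apply, one_apply]
  congr 1
  · congr 1
    · congr 2
      funext j
      congr 1
      ext
      simp [Nat.add_comm]
    · refine Finset.sum_congr rfl fun i _ => ?_
      congr 1
      refine congrArg f (funext fun t => ?_)
      simp only [insertArg, Fin.rev_rev, Fin.contractNth, Fin.ext_iff, Fin.val_castSucc]
      split_ifs <;> first | rfl | omega | skip
      rename_i h₂ h₃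
      rw [mul, cup_apply]
      simp only [one_apply]
      congr 2 <;> ext <;> simp [h₂]

/-- The pre-Lie product `∑ᵢ (-1)^{(q-1)(i-1)} f ∘ᵢ g` of a `p`-cochain and a `q`-cochain. -/
def circ {p q n : ℕ} (h : p + q = n + 1) (f : HochschildCochain k A p)
    (g : HochschildCochain k A q) : HochschildCochain k A n :=
  ∑ i : Fin p, (-1 : k) ^ ((q + 1) * (i : ℕ)) • comp h i f g

/-- The Gerstenhaber bracket. -/
def gerstenhaberBracket {p q n : ℕ} (h : p + q = n + 1) (f : HochschildCochain k A p)
    (g : HochschildCochain k A q) : HochschildCochain k A n :=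
  circ h f g - (-1 : k) ^ ((p + 1) * (q + 1)) • circ (by omega) g f

end HochschildCochain

/-- Hochschild cocycles. -/
noncomputable abbrev hochschildCocycles (n : ℕ) : Submodule k (HochschildCochain k A n) :=
  LinearMap.ker (HochschildCochain.coboundary n)

/-- Hochschild coboundaries. -/
noncomputable def hochschildCoboundaries : (n : ℕ) → Submodule k (HochschildCochain k A n)
  | 0 => ⊥
  | n + 1 => LinearMap.range (HochschildCochain.coboundary n)

/-- Hochschild cohomology `H^n(A, A)`: cocycles modulo coboundaries, realised as the image of the
cocycles in the quotient of all cochains by the coboundaries. -/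
def HochschildCohomology (n : ℕ) : Type v :=
  (hochschildCocycles k A n).map (hochschildCoboundaries k A n).mkQ

noncomputable instance (n : ℕ) : AddCommGroup (HochschildCohomology k A n) :=
  Submodule.addCommGroup _

noncomputable instance (n : ℕ) : Module k (HochschildCohomology k A n) :=
  Submodule.module _

variable {k A} in
/-- `f` is a cocycle whose cohomology class is `x`. -/
def IsRepresentedBy {n : ℕ} (x : HochschildCohomology k A n) (f : HochschildCochain k A n) : Prop :=
  f ∈ hochschildCocycles k A n ∧ (hochschildCoboundaries k A n).mkQ f = x.val

/-- A right contraaction of the enveloping algebra `A ⊗ Aᵒᵖ` on `A`. With `M = A` regarded as a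
right `A`-module by multiplication, this is a map `γ : Hom_k(A, M) → M` such that
`γ(f(a -)) = γ(f) a`, `γ(x ↦ γ(y ↦ g(x ⊗ y))) = γ(x ↦ g(x ⊗ 1))` and `γ(x ↦ m x) = m`. -/
structure Contraaction where
  toLinearMap : (A →ₗ[k] A) →ₗ[k] A
  map_comp_mulLeft : ∀ (f : A →ₗ[k] A) (a : A),
    toLinearMap (f ∘ₗ LinearMap.mulLeft k a) = toLinearMap f * a
  contraassoc : ∀ g : A ⊗[k] A →ₗ[k] A,
    toLinearMap (toLinearMap ∘ₗ TensorProduct.curry g) =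
      toLinearMap ((TensorProduct.curry g).flip 1)
  counit : ∀ m : A, toLinearMap (LinearMap.mulLeft k m) = m

namespace Contraaction

variable {k A}
variable (γ : Contraaction k A)

/-- A contraaction is stable if `γ(x ↦ x a) = a` for all `a`. -/
def IsStable : Prop := ∀ a : A, γ.toLinearMap (LinearMap.mulRight k a) = a

/-- `(τ f)(a₁, …, a_n) = γ(a₁ f(a₂, …, a_n, -))`; for `n = 0` this reads `τ f = γ((-) f)`. -/
noncomputable def tau {n : ℕ} (f : HochschildCochain k A n) : HochschildCochain k A n :=
  γ.toLinearMap.compMultilinearMap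
    (HochschildCochain.cup (Nat.add_comm 1 n) (HochschildCochain.one k A) f).curryRight

theorem tau_apply {n : ℕ} (f : HochschildCochain k A (n + 1)) (a : Fin (n + 1) → A) :
    γ.tau f a = γ.toLinearMap (LinearMap.mulLeft k (a 0) ∘ₗ f.curryRight (Fin.tail a)) := by
  simp only [tau, LinearMap.compMultilinearMap_apply]
  congr 1
  ext x
  simp only [MultilinearMap.curryRight_apply, HochschildCochain.cup_apply,
    HochschildCochain.one_apply, LinearMap.comp_apply, LinearMap.mulLeft_apply]
  congr 1
  refine congrArg f (funext fun t => ?_)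
  induction t using Fin.lastCases with
  | last => simp [Fin.snoc, Nat.add_comm]
  | cast t => simp [Fin.snoc, Fin.tail, Nat.add_comm, Fin.succ]

theorem tau_apply_zero (f : HochschildCochain k A 0) (a : Fin 0 → A) :
    γ.tau f a = γ.toLinearMap (LinearMap.mulRight k (f a)) := by
  simp only [tau, LinearMap.compMultilinearMap_apply]
  congr 1
  ext x
  simp only [MultilinearMap.curryRight_apply, HochschildCochain.cup_apply,
    HochschildCochain.one_apply, LinearMap.mulRight_apply]
  congr 1
  exact congrArg f (Subsingleton.elim _ _)

/-- The extra codegeneracy `(s f)(a₁, …, a_n) = γ(f(a₁, …, a_n, -))`. -/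
def extraDegeneracy {n : ℕ} (f : HochschildCochain k A (n + 1)) : HochschildCochain k A n :=
  γ.toLinearMap.compMultilinearMap f.curryRight

/-- Connes' coboundary `B = ± N s (1 - λ) : C^{n+1}(A, A) → C^n(A, A)`, where `λ = (-1)^m τ` in
degree `m`, `N = ∑_{0 ≤ j ≤ n} λ^j` is the norm, and the sign is `(-1)^n`. -/
noncomputable def connesB {n : ℕ} (f : HochschildCochain k A (n + 1)) : HochschildCochain k A n :=
  ∑ j ∈ Finset.range (n + 1), (-1 : k) ^ (n * (j + 1)) •
    (γ.tau (n := n))^[j] (γ.extraDegeneracy (f - (-1 : k) ^ (n + 1) • γ.tau f))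

end Contraaction

/-- The `k`-linear structure on the category of modules over a `k`-algebra `R`. -/
@[reducible]
noncomputable def moduleCatLinear (R : Type v) [Ring R] [Algebra k R] :
    CategoryTheory.Linear k (ModuleCat.{v} R) :=
  letI (M : ModuleCat.{v} R) : Module k M := Module.restrictScalars k R M
  letI (M : ModuleCat.{v} R) : IsScalarTower k R M := IsScalarTower.restrictScalars k R M
  { homModule := fun _ _ => inferInstance }

/-- `A` as a left module over its enveloping algebra, `(a ⊗ b) c = a c b`. -/
noncomputable def envelopingModule : ModuleCat.{v} (A ⊗[k] Aᵐᵒᵖ) :=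
  letI : Module (A ⊗[k] Aᵐᵒᵖ) A := TensorProduct.Algebra.module
  ModuleCat.of (A ⊗[k] Aᵐᵒᵖ) A

/-- `Ext^n(A, A)` over the enveloping algebra of `A`. -/
abbrev EnvelopingExt (n : ℕ) : Type v :=
  CategoryTheory.Abelian.Ext.{v} (envelopingModule k A) (envelopingModule k A) n

noncomputable instance (n : ℕ) : Module k (EnvelopingExt k A n) :=
  letI := moduleCatLinear k (A ⊗[k] Aᵐᵒᵖ)
  inferInstance

end Hochschild

-- Cochains are the endomorphism operad of `A`, and each axiom of `γ` becomes an axiom of `τ`.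
-- Contraassociativity, applied to `(x, y) ↦ Φ(Ψ(x) y)`, together with right linearity gives `τ(φ ∘₁
-- ψ)`; the counit axiom gives `τ id = id` and `τ μ = μ`. Since `tau_comp_one` needs positive
-- arities, two relations with nullary arguments are recorded separately as `IsUnital`; they
-- complete the para-cocyclic identities. Stability says that `τ = id` in degree `0`. Cyclicity then
-- follows by induction on the degree: freezing the first argument of a cochain lowers its degree,
-- and `tau_pow_comp_zero` tells how `τ` acts on the result.
--
-- The Batalin–Vilkovisky structure is proved for any unital cyclic operad with multiplication. The
-- differential `diff` is the alternating sum of the faces. The failure of `diff` to be a derivation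
-- of the pre-Lie product is the commutator of the cup product (`diff_circ`), which gives graded
-- commutativity and a well-defined bracket. The Jacobi identity is the pre-Lie identity
-- `circ_circ`. The Leibniz rule uses the brace `x{f, g}` as a homotopy. Its coboundary is a sum
-- over a triangle of slots; for cocycles the sum over the enlarged triangle vanishes, and its three
-- edges are the three terms of the rule (`sum_triangle_shift`).
--
-- Connes' operator is `B = ± N s (1 - λ)`, and the usual relations between `N`, `s`, `λ` and the
-- truncated differential give `B² = 0` and the anticommutation with `diff`. Every class has a
-- cocycle killed by the codegeneracy `σ₀`, and on these `B` inserts the unit into all rotations.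
-- Applied to `f ⌣ g` this gives `rot f g` and `rot g f` (`rot_cup`). The triangle argument again,
-- with the unit as second insertion, shows that `rot f g` is cohomologous to `f ∘ g` up to a term
-- `g ⌣ B f` (`circ_rot_mem_boundaries`). Antisymmetrizing yields the bracket formula.
--
-- For `Ext`, the bar resolution is built by iterating `M ↦ A ⊗ M`; its terms are projective over
-- the enveloping algebra because `A` is projective over `k`. Cutting it into short exact sequences
-- and shifting dimensions identifies `Ext^n` with bimodule maps on the `n`-th boundaries modulo
-- those that extend to the ambient term, that is, with cocycles modulo coboundaries. Lifting
-- cocycles to chain maps shows that this identification reverses products. Graded commutativity and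
-- the rescaling by `(-1)^(n choose 2)` make it multiplicative, and the remaining structure is
-- transported.

universe w

/-! ### Faces of an operad with multiplication and their behaviour under composition. -/

section AbstractOperad

theorem sgn_congr {k : Type*} [Ring k] {a b : ℕ} (c : ℕ) (h : a + b = 2 * c) :
    (-1 : k) ^ a = (-1) ^ b := by
  have hab : Even (a + b) := ⟨c, by omega⟩
  rcases Nat.even_or_odd a with ha | ha
  · rw [ha.neg_one_pow, ((Nat.even_add.1 hab).1 ha).neg_one_pow]
  · rw [ha.neg_one_pow, Odd.neg_one_pow]
    rw [← Nat.not_even_iff_odd] at ha ⊢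
    rwa [Nat.even_add.1 hab] at ha

variable {k : Type u} [CommRing k] {O : ℕ → Type v} [∀ n, AddCommGroup (O n)] [∀ n, Module k (O n)]

namespace OperadWithMultiplication

variable (P : OperadWithMultiplication k O)

/-- All arities are free variables tied by equations that `omega` discharges, so associativity
applies without truncated subtraction or casts. -/
theorem comp_comp_middle {p q r s t n i j l : ℕ} (φ : O p) (ψ : O q) (χ : O r)
    (hs : p + q = s + 1 := by omega) (ht : q + r = t + 1 := by omega) (hn : s + r = n + 1 := by omega) (hi : 1 ≤ i := by omega) (hip : i ≤ p := by omega)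
    (hl : 1 ≤ l := by omega) (hlq : l ≤ q := by omega) (hj : j + 1 = i + l := by omega) :
    P.comp s r n j (P.comp p q s i φ ψ) χ = P.comp p t n i φ (P.comp q r t l ψ χ) := by
  obtain rfl : s = p + q - 1 := by omega
  obtain rfl : t = q + r - 1 := by omega
  obtain rfl : l = j - i + 1 := by omega
  exact P.assoc_middle p q r n i j φ ψ χ (by omega) hi hip (by omega) (by omega)

theorem comp_comp_disjoint {p q r s t n i j l : ℕ} (φ : O p) (ψ : O q) (χ : O r)
    (hs : p + q = s + 1 := by omega) (ht : p + r = t + 1 := by omega) (hn : s + r = n + 1 := by omega) (hi : 1 ≤ i := by omega) (hil : i < l := by omega)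
    (hl : l ≤ p := by omega) (hj : j + 1 = l + q := by omega) :
    P.comp s r n j (P.comp p q s i φ ψ) χ = P.comp t q n i (P.comp p r t l φ χ) ψ := by
  obtain rfl : s = p + q - 1 := by omega
  obtain rfl : t = p + r - 1 := by omega
  obtain rfl : l = j - q + 1 := by omega
  exact P.assoc_right p q r n i j φ ψ χ (by omega) hi (by omega) (by omega) (by omega)

theorem comp_eq_zero_apply {p q r i : ℕ} (h : ¬ (p + q = r + 1 ∧ 1 ≤ i ∧ i ≤ p)) (φ : O p)
    (ψ : O q) : P.comp p q r i φ ψ = 0 := by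
  rw [P.comp_eq_zero _ _ _ _ h]; rfl

/-- The `t`-th coface `O n → O (n + 1)`; it is zero unless `n' = n + 1` and `t ≤ n + 1`. -/
def face (n n' t : ℕ) : O n →ₗ[k] O n' :=
  if t = 0 then P.comp 2 n n' 2 P.mul
  else if t = n + 1 then P.comp 2 n n' 1 P.mul
  else (P.comp n 2 n' t).flip P.mul

theorem face_zero (n n' : ℕ) (x : O n) : P.face n n' 0 x = P.comp 2 n n' 2 P.mul x := by
  simp [face]

theorem face_last (n n' : ℕ) (x : O n) : P.face n n' (n + 1) x = P.comp 2 n n' 1 P.mul x := by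
  simp [face]

theorem face_of_pos {n n' t : ℕ} (x : O n) (h₀ : t ≠ 0) (h₁ : t ≠ n + 1) :
    P.face n n' t x = P.comp n 2 n' t x P.mul := by
  simp [face, h₀, h₁]

/-- Every case is operadic associativity. Where the two copies of `mul` meet, `mul_assoc` exchanges
`mul ∘₁ mul` and `mul ∘₂ mul`. -/
theorem face_face {n n' n'' i j : ℕ} (x : O n) (hij : i ≤ j) (hj : j ≤ n + 1) (hn' : n' = n + 1)
    (hn'' : n'' = n' + 1) :
    P.face n' n'' (j + 1) (P.face n n' i x) = P.face n' n'' i (P.face n n' j x) := by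
  subst hn' hn''
  rcases Nat.eq_zero_or_pos i with rfl | hi
  · rw [P.face_zero, P.face_zero]
    rcases Nat.eq_zero_or_pos j with rfl | hj0
    · rw [P.face_of_pos _ (by omega) (by omega), P.face_zero]
      refine (P.comp_comp_disjoint (s := 3) (i := 1) (l := 2) (j := 3) _ _ _).symm.trans ?_
      rw [P.mul_assoc]
      exact P.comp_comp_middle _ _ _
    · rcases Nat.lt_or_ge n j with h | h
      · obtain rfl : j = n + 1 := by omega
        rw [P.face_last, P.face_last]
        refine (P.comp_comp_middle (s := 3) (l := 2) (j := 2) _ _ _).symm.trans ?_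
        rw [P.mul_assoc]
        exact P.comp_comp_middle _ _ _
      · rw [P.face_of_pos _ (by omega) (by omega), P.face_of_pos _ (by omega) (by omega)]
        exact P.comp_comp_middle _ _ _
  · rcases Nat.lt_or_ge n j with h | h
    · obtain rfl : j = n + 1 := by omega
      rw [P.face_last, P.face_last]
      rcases Nat.lt_or_ge n i with h' | h'
      · obtain rfl : i = n + 1 := by omega
        rw [P.face_last, P.face_of_pos (t := n + 1) _ (by omega) (by omega)]
        refine (P.comp_comp_middle (s := 3) (l := 1) (j := 1) _ _ _).symm.trans ?_
        rw [P.mul_assoc]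
        exact (P.comp_comp_disjoint _ _ _).symm
      · rw [P.face_of_pos _ (by omega) (by omega), P.face_of_pos _ (by omega) (by omega)]
        exact (P.comp_comp_middle _ _ _).symm
    · rw [P.face_of_pos _ (by omega) (by omega), P.face_of_pos (t := i) _ (by omega) (by omega),
        P.face_of_pos (t := j) _ (by omega) (by omega), P.face_of_pos _ (by omega) (by omega)]
      rcases hij.eq_or_lt with rfl | hlt
      · refine (P.comp_comp_middle (t := 3) (l := 2) _ _ _).trans ?_
        rw [← P.mul_assoc]
        exact (P.comp_comp_middle _ _ _).symm
      · exact P.comp_comp_disjoint _ _ _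

section FaceComp

variable {p q r p' q' r' : ℕ} (x : O p) (u : O q)

/-- The faces of `x ∘ⱼ u` fall into three ranges: those below slot `j` come from `x`, the next `q`
are the inner faces of `u`, and the remaining ones come from `x` again, with shifted index. This
lemma and the next two treat the ranges in turn. -/
theorem face_comp_of_lt {j t : ℕ} (hr : p + q = r + 1) (hp' : p' = p + 1) (hr' : r' = r + 1)
    (hj : j ≤ p) (ht : t < j) :
    P.face r r' t (P.comp p q r j x u) = P.comp p' q r' (j + 1) (P.face p p' t x) u := by
  subst hp' hr'
  rcases Nat.eq_zero_or_pos t with rfl | h₀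
  · rw [P.face_zero, P.face_zero]
    exact (P.comp_comp_middle _ _ _).symm
  · rw [P.face_of_pos _ (by omega) (by omega), P.face_of_pos _ (by omega) (by omega)]
    exact (P.comp_comp_disjoint _ _ _).symm

theorem face_comp_of_ge {j t : ℕ} (hr : p + q = r + 1) (hp' : p' = p + 1) (hr' : r' = r + 1)
    (hj : 1 ≤ j) (ht : j < t) (htp : t ≤ p + 1) :
    P.face r r' (t + q - 1) (P.comp p q r j x u) = P.comp p' q r' j (P.face p p' t x) u := by
  subst hp' hr'
  rcases Nat.lt_or_ge p t with h | h
  · obtain rfl : t = p + 1 := by omega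
    obtain rfl : r = p + q - 1 := by omega
    have : p + 1 + q - 1 = p + q - 1 + 1 := by omega
    rw [this, P.face_last, P.face_last]
    exact (P.comp_comp_middle _ _ _).symm
  · rw [P.face_of_pos _ (by omega) (by omega), P.face_of_pos _ (by omega) (by omega)]
    exact P.comp_comp_disjoint _ _ _

theorem face_comp_middle {j t : ℕ} (hr : p + q = r + 1) (hq' : q' = q + 1) (hr' : r' = r + 1)
    (hj : 1 ≤ j) (hjp : j ≤ p) (ht : 1 ≤ t) (htq : t ≤ q) :
    P.face r r' (t + j - 1) (P.comp p q r j x u) = P.comp p q' r' j x (P.face q q' t u) := by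
  subst hq' hr'
  rw [P.face_of_pos _ (by omega) (by omega), P.face_of_pos _ (by omega) (by omega)]
  exact P.comp_comp_middle _ _ _

/-- The outer faces of `u` are invisible as faces of `x ∘ⱼ u`: they multiply `u` by a neighbouring
argument, which amounts to splitting slot `j` of `x` by its `j`-th face and putting `u` in one half.
-/
theorem comp_face_zero {j : ℕ} (hp' : p' = p + 1) (hq' : q' = q + 1) (hr' : p' + q = r' + 1)
    (hj : 1 ≤ j) (hjp : j ≤ p) :
    P.comp p q' r' j x (P.face q q' 0 u) = P.comp p' q r' (j + 1) (P.face p p' j x) u := by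
  subst hp' hq'
  rw [P.face_zero, P.face_of_pos _ (by omega) (by omega)]
  exact (P.comp_comp_middle _ _ _).symm

theorem comp_face_last {j : ℕ} (hp' : p' = p + 1) (hq' : q' = q + 1) (hr' : p' + q = r' + 1)
    (hj : 1 ≤ j) (hjp : j ≤ p) :
    P.comp p q' r' j x (P.face q q' (q + 1) u) = P.comp p' q r' j (P.face p p' j x) u := by
  subst hp' hq'
  rw [P.face_last, P.face_of_pos _ (by omega) (by omega)]
  exact (P.comp_comp_middle _ _ _).symm

end FaceComp

/-- The alternating sum of the faces with index in `[a, b)`. -/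
def faceSum (n n' a b : ℕ) : O n →ₗ[k] O n' :=
  ∑ t ∈ Finset.Ico a b, (-1 : k) ^ t • P.face n n' t

theorem faceSum_apply (n n' a b : ℕ) (x : O n) :
    P.faceSum n n' a b x = ∑ t ∈ Finset.Ico a b, (-1 : k) ^ t • P.face n n' t x := by
  simp [faceSum, LinearMap.sum_apply]

theorem faceSum_add {n n' a b c : ℕ} (hab : a ≤ b) (hbc : b ≤ c) (x : O n) :
    P.faceSum n n' a b x + P.faceSum n n' b c x = P.faceSum n n' a c x := by
  simp only [faceSum_apply]
  exact Finset.sum_Ico_consecutive _ hab hbc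

theorem faceSum_succ (n n' a : ℕ) (x : O n) :
    P.faceSum n n' a (a + 1) x = (-1 : k) ^ a • P.face n n' a x := by
  simp [faceSum_apply]

/-- The alternating sum of all faces; this is the Hochschild coboundary up to sign. -/
def diff (n n' : ℕ) : O n →ₗ[k] O n' := P.faceSum n n' 0 (n + 2)

theorem faceSum_comp_of_le {p q r p' r' j b : ℕ} (x : O p) (u : O q) (hr : p + q = r + 1)
    (hp' : p' = p + 1) (hr' : r' = r + 1) (hj : j ≤ p) (hb : b ≤ j) :
    P.faceSum r r' 0 b (P.comp p q r j x u) = P.comp p' q r' (j + 1) (P.faceSum p p' 0 b x) u := by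
  simp only [faceSum_apply, map_sum, map_smul, LinearMap.sum_apply, LinearMap.smul_apply]
  refine Finset.sum_congr rfl fun t ht => ?_
  rw [Finset.mem_Ico] at ht
  rw [P.face_comp_of_lt x u hr hp' hr' hj (by omega)]

/-- Face `j` of `x` occurs in both partial sums on the right. These two surplus terms cancel the
outer faces of `u` contained in `P.diff q q' u`. The free lower end `a` allows the formula to be
iterated for two insertions. -/
theorem faceSum_comp {p q r p' q' r' j a : ℕ} (x : O p) (u : O q) (hr : p + q = r + 1)
    (hp' : p' = p + 1) (hq' : q' = q + 1) (hr' : r' = r + 1) (hj : 1 ≤ j) (hjp : j ≤ p)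
    (ha : a ≤ j) :
    P.faceSum r r' a (r + 2) (P.comp p q r j x u) =
      P.comp p' q r' (j + 1) (P.faceSum p p' a (j + 1) x) u
        - (-1 : k) ^ q • P.comp p' q r' j (P.faceSum p p' j (p + 2) x) u
        - (-1 : k) ^ j • P.comp p q' r' j x (P.diff q q' u) := by
  rw [← P.faceSum_add (b := j) ha (by omega), ← P.faceSum_add (a := j) (b := j + q) (by omega) (by omega)]
  have h₁ : P.faceSum r r' a j (P.comp p q r j x u) =
      P.comp p' q r' (j + 1) (P.faceSum p p' a j x) u := by
    simp only [faceSum_apply, map_sum, map_smul, LinearMap.sum_apply, LinearMap.smul_apply]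
    refine Finset.sum_congr rfl fun t ht => ?_
    rw [Finset.mem_Ico] at ht
    rw [P.face_comp_of_lt x u hr hp' hr' hjp (by omega)]
  have h₂ : P.faceSum r r' j (j + q) (P.comp p q r j x u) =
      - (-1 : k) ^ j • P.comp p q' r' j x (P.faceSum q q' 1 (q + 1) u) := by
    simp only [faceSum_apply, map_sum, map_smul, Finset.smul_sum]
    rw [Finset.sum_Ico_eq_sum_range, Finset.sum_Ico_eq_sum_range]
    refine Finset.sum_congr (by congr 1; omega) fun t ht => ?_
    rw [Finset.mem_range] at ht
    rw [← P.face_comp_middle x u hr hq' hr' hj hjp (t := 1 + t) (by omega) (by omega), smul_smul,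
      show 1 + t + j - 1 = j + t by omega]
    congr 1
    ring
  have h₃ : P.faceSum r r' (j + q) (r + 2) (P.comp p q r j x u) =
      - (-1 : k) ^ q • P.comp p' q r' j (P.faceSum p p' (j + 1) (p + 2) x) u := by
    simp only [faceSum_apply, map_sum, map_smul, Finset.smul_sum, LinearMap.sum_apply,
      LinearMap.smul_apply]
    rw [Finset.sum_Ico_eq_sum_range, Finset.sum_Ico_eq_sum_range]
    refine Finset.sum_congr (by congr 1; omega) fun t ht => ?_
    rw [Finset.mem_range] at ht
    rw [← P.face_comp_of_ge x u hr hp' hr' hj (t := j + 1 + t) (by omega) (by omega), smul_smul,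
      show j + 1 + t + q - 1 = j + q + t by omega]
    congr 1
    ring
  have h₄ : P.diff q q' u = P.face q q' 0 u + P.faceSum q q' 1 (q + 1) u
      + (-1 : k) ^ (q + 1) • P.face q q' (q + 1) u := by
    rw [← P.faceSum_succ, show P.diff q q' u = P.faceSum q q' 0 (q + 2) u from rfl, ← P.faceSum_add (b := q + 1) (by omega) (by omega),
      ← P.faceSum_add (a := 0) (b := 1) (by omega) (by omega), P.faceSum_succ q q' 0]
    simp
  rw [h₁, h₂, h₃, h₄, map_add, map_add, map_smul,
    P.comp_face_zero x u hp' hq' (by omega) hj hjp, P.comp_face_last x u hp' hq' (by omega) hj hjp,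
    ← P.faceSum_add (a := a) (b := j) (c := j + 1) ha (by omega), P.faceSum_succ,
    ← P.faceSum_add (a := j) (b := j + 1) (c := p + 2) (by omega) (by omega), P.faceSum_succ]
  simp only [map_add, map_smul, LinearMap.add_apply, LinearMap.smul_apply]
  module

end OperadWithMultiplication
end AbstractOperad

/-! ### Coboundaries of cup products and of the pre-Lie product. -/

section AbstractOperad

theorem neg_one_pow_mul_two {k : Type*} [CommRing k] (n : ℕ) : (-1 : k) ^ (n * 2) = 1 := by
  rw [pow_mul', neg_one_sq, one_pow]

theorem neg_one_pow_mul_three {k : Type*} [CommRing k] (n : ℕ) : (-1 : k) ^ (n * 3) = (-1) ^ n := by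
  rw [pow_mul', show (-1 : k) ^ 3 = -1 by norm_num]

variable {k : Type u} [CommRing k] {O : ℕ → Type v} [∀ n, AddCommGroup (O n)] [∀ n, Module k (O n)]

namespace OperadWithMultiplication

variable (P : OperadWithMultiplication k O)

/-- The cup product; it is zero unless `n = p + q`. -/
def cup (p q n : ℕ) : O p →ₗ[k] O q →ₗ[k] O n :=
  P.comp (p + 1) q n 1 ∘ₗ P.face p (p + 1) 0

theorem cup_apply (p q n : ℕ) (f : O p) (g : O q) :
    P.cup p q n f g = P.comp (p + 1) q n 1 (P.face p (p + 1) 0 f) g := rfl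

theorem cup_eq_zero {p q n : ℕ} (h : p + q ≠ n) : P.cup p q n = 0 := by
  rw [cup, P.comp_eq_zero _ _ _ _ (by omega), LinearMap.zero_comp]

theorem cup_eq_comp_last {p q n : ℕ} (h : p + q = n) (f : O p) (g : O q) :
    P.cup p q n f g = P.comp (q + 1) p n (q + 1) (P.face q (q + 1) (q + 1) g) f := by
  rw [cup_apply, P.face_zero, P.face_last]
  exact (P.comp_comp_disjoint _ _ _).symm

/-- The pre-Lie product; it is zero unless `p + q = n + 1`. -/
def circ (p q n : ℕ) : O p →ₗ[k] O q →ₗ[k] O n :=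
  ∑ i ∈ Finset.range p, (-1 : k) ^ ((q + 1) * i) • P.comp p q n (i + 1)

theorem circ_apply (p q n : ℕ) (f : O p) (g : O q) :
    P.circ p q n f g = ∑ i ∈ Finset.range p, (-1 : k) ^ ((q + 1) * i) • P.comp p q n (i + 1) f g := by
  simp [circ, LinearMap.sum_apply]

theorem circ_eq_zero {p q n : ℕ} (h : p + q ≠ n + 1) : P.circ p q n = 0 := by
  rw [circ]
  exact Finset.sum_eq_zero fun i _ => by rw [P.comp_eq_zero _ _ _ _ (by omega), smul_zero]

theorem diff_face_zero {n n' n'' : ℕ} (x : O n) (hn' : n' = n + 1) (hn'' : n'' = n' + 1) :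
    P.faceSum n' n'' 1 (n' + 2) (P.face n n' 0 x) = - P.face n' n'' 0 (P.diff n n' x) := by
  rw [show P.diff n n' x = P.faceSum n n' 0 (n + 2) x from rfl, faceSum_apply, faceSum_apply,
    map_sum, ← Finset.sum_neg_distrib, Finset.sum_Ico_eq_sum_range, Finset.sum_Ico_eq_sum_range]
  refine Finset.sum_congr (by congr 1; omega) fun t ht => ?_
  rw [Finset.mem_range] at ht
  rw [map_smul, add_comm 1 t, P.face_face x (Nat.zero_le t) (by omega) hn' hn'', zero_add, pow_succ]
  module

theorem diff_cup {p q n p' q' n' : ℕ} (f : O p) (g : O q) (hn : p + q = n) (hp' : p' = p + 1)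
    (hq' : q' = q + 1) (hn' : n' = n + 1) :
    P.diff n n' (P.cup p q n f g) =
      (-1 : k) ^ q • P.cup p' q n' (P.diff p p' f) g + P.cup p q' n' f (P.diff q q' g) := by
  subst hp' hq' hn'
  rw [cup_apply, show P.diff n (n + 1) = P.faceSum n (n + 1) 0 (n + 2) from rfl,
    P.faceSum_comp (q' := q + 1) (p' := p + 2) _ _ (by omega) rfl rfl rfl le_rfl (by omega) (by omega),
    P.diff_face_zero f rfl rfl, ← P.faceSum_add (b := 1) (by omega) (by omega), P.faceSum_succ,
    P.faceSum_succ, ← P.face_face f le_rfl (by omega) rfl rfl, cup_apply, cup_apply]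
  simp only [map_neg, LinearMap.neg_apply, pow_zero, pow_one, zero_add, one_smul, neg_smul,
    map_add, LinearMap.add_apply]
  module

/-- Summing `faceSum_comp` over the slots reassembles the two partial face sums of `x` at each slot
into `diff x`. The two exceptions are face `0` with `u` in slot `1` and the last face with `u` in
slot `p + 1`; these are the two cup products. -/
theorem diff_circ {p q n p' q' n' : ℕ} (x : O p) (u : O q) (hn : p + q = n + 1) (hp' : p' = p + 1)
    (hq' : q' = q + 1) (hn' : n' = n + 1) :
    P.diff n n' (P.circ p q n x u) =
      (-1 : k) ^ (q + 1) • P.circ p' q n' (P.diff p p' x) u + P.circ p q' n' x (P.diff q q' u)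
        + (-1 : k) ^ q • P.cup p q n' x u - (-1 : k) ^ (q * (p + 1)) • P.cup q p n' u x := by
  subst hp' hq' hn'
  have h₁ : ∀ i ∈ Finset.range (p + 1),
      (-1 : k) ^ ((q + 1) * i) • P.comp (p + 1) q (n + 1) (i + 1) (P.diff p (p + 1) x) u =
      (-1 : k) ^ ((q + 1) * i) • P.comp (p + 1) q (n + 1) (i + 1) (P.faceSum p (p + 1) 0 (i + 1) x) u +
      (-1 : k) ^ ((q + 1) * i) •
        P.comp (p + 1) q (n + 1) (i + 1) (P.faceSum p (p + 1) (i + 1) (p + 2) x) u := by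
    intro i hi
    rw [Finset.mem_range] at hi
    rw [← smul_add, ← LinearMap.add_apply, ← map_add, P.faceSum_add (by omega) (by omega)]
    rfl
  rw [circ_apply, map_sum, circ_apply, circ_apply, Finset.sum_congr rfl h₁, Finset.sum_add_distrib,
    Finset.sum_range_succ', Finset.sum_range_succ (n := p), zero_add, P.faceSum_succ,
    P.faceSum_succ, P.cup_apply, P.cup_eq_comp_last (by omega)]
  have h₂ : ∀ i ∈ Finset.range p, P.diff n (n + 1) ((-1 : k) ^ ((q + 1) * i) • P.comp p q n (i + 1) x u) =
      (-1 : k) ^ (q + 1) • (-1 : k) ^ ((q + 1) * (i + 1)) •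
        P.comp (p + 1) q (n + 1) (i + 1 + 1) (P.faceSum p (p + 1) 0 (i + 1 + 1) x) u
      + (-1 : k) ^ (q + 1) • (-1 : k) ^ ((q + 1) * i) •
        P.comp (p + 1) q (n + 1) (i + 1) (P.faceSum p (p + 1) (i + 1) (p + 2) x) u
      + (-1 : k) ^ ((q + 1 + 1) * i) • P.comp p (q + 1) (n + 1) (i + 1) x (P.diff q (q + 1) u) := by
    intro i hi
    rw [Finset.mem_range] at hi
    rw [map_smul, show P.diff n (n + 1) = P.faceSum n (n + 1) 0 (n + 2) from rfl,
      P.faceSum_comp (q' := q + 1) (p' := p + 1) _ _ (by omega) rfl rfl rfl (by omega) (by omega)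
      (by omega)]
    (match_scalars <;> ring_nf) <;> simp only [neg_one_pow_mul_two] <;> ring
  rw [Finset.sum_congr rfl h₂]
  simp only [Finset.sum_add_distrib, ← Finset.smul_sum, map_smul, LinearMap.smul_apply]
  (match_scalars <;> ring_nf) <;> simp only [neg_one_pow_mul_two] <;> ring

end OperadWithMultiplication
end AbstractOperad

/-! ### The pre-Lie identity and the Jacobi identity. -/

section AbstractOperad

variable {k : Type u} [CommRing k] {O : ℕ → Type v} [∀ n, AddCommGroup (O n)] [∀ n, Module k (O n)]

/-- This is the combinatorial core of both homotopies below. The coboundary of a double insertion at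
slots `j < i` produces terms at `(i + 1, j + 1)`, `(i + 1, j)` and `(i, j)`. Reindexing completes
each family to the larger triangle, at the cost of one edge: `j = 0`, the diagonal next to `i = j`,
and `i = p`. -/
theorem sum_triangle_shift {M : Type*} [AddCommGroup M] (p : ℕ) (F₁ F₂ F₃ : ℕ → ℕ → M) :
    ∑ i ∈ Finset.range p, ∑ j ∈ Finset.range i, (F₁ (i + 1) (j + 1) + F₂ (i + 1) j + F₃ i j) =
      ∑ i ∈ Finset.range (p + 1), ∑ j ∈ Finset.range i, (F₁ i j + F₂ i j + F₃ i j)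
        - ∑ i ∈ Finset.range p, F₁ (i + 1) 0 - ∑ i ∈ Finset.range p, F₂ (i + 1) i
        - ∑ j ∈ Finset.range p, F₃ p j := by
  simp only [Finset.sum_add_distrib]
  rw [Finset.sum_range_succ' (fun i => ∑ j ∈ Finset.range i, F₁ i j),
    Finset.sum_range_succ' (fun i => ∑ j ∈ Finset.range i, F₂ i j),
    Finset.sum_range_succ (fun i => ∑ j ∈ Finset.range i, F₃ i j)]
  simp only [Finset.range_zero, Finset.sum_empty, add_zero]
  simp only [Finset.sum_range_succ' (fun j => F₁ _ j), Finset.sum_range_succ (fun j => F₂ _ j),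
    Finset.sum_add_distrib]
  abel

theorem sum_triangle_swap {M : Type*} [AddCommMonoid M] (p : ℕ) (F : ℕ → ℕ → M) :
    ∑ i ∈ Finset.range p, ∑ m ∈ Finset.range (p - 1 - i), F (i + m + 1) i =
      ∑ i ∈ Finset.range p, ∑ j ∈ Finset.range i, F i j := by
  rw [← Finset.sum_comm' (s := Finset.range p) (t := fun i => Finset.Ico (i + 1) p)
    (f := fun i j => F j i) (by simp only [Finset.mem_range, Finset.mem_Ico]; omega)]
  refine Finset.sum_congr rfl fun i _ => ?_
  rw [Finset.sum_Ico_eq_sum_range]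
  refine Finset.sum_congr (by congr 1; omega) fun m _ => ?_
  congr 1
  omega

namespace OperadWithMultiplication

variable (P : OperadWithMultiplication k O)

theorem unit_cup (p : ℕ) (f : O p) : P.cup 0 p p P.unit f = f := by
  rw [cup_apply, face_zero, P.mul_unit_right, P.one_comp]

theorem cup_unit (p : ℕ) (f : O p) : P.cup p 0 p f P.unit = f := by
  rw [cup_apply, face_zero]
  refine (P.comp_comp_disjoint (s := 1) (l := 2) (j := 1) _ _ _).symm.trans ?_
  rw [P.mul_unit_left, P.one_comp]

theorem cup_assoc {p q r s t n : ℕ} (f : O p) (g : O q) (h : O r) (hs : p + q = s)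
    (ht : q + r = t) (hn : s + r = n) :
    P.cup s r n (P.cup p q s f g) h = P.cup p t n f (P.cup q r t g h) := by
  rw [P.cup_apply s, P.cup_apply p q,
    P.face_comp_of_lt (p' := p + 2) _ _ (by omega) rfl rfl (by omega) zero_lt_one,
    ← P.face_face f le_rfl (by omega) rfl rfl, zero_add,
    ← P.comp_face_zero (q' := q + 1) _ _ rfl rfl (by omega) le_rfl (by omega), P.cup_apply p,
    P.cup_apply q]
  exact P.comp_comp_middle _ _ _

/-- Inserting into the second factor of a cup product. -/
theorem comp_cup_right {p q r s t n j : ℕ} (f : O p) (g : O q) (h : O r) (hs : p + q = s)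
    (ht : q + r = t + 1) (hn : s + r = n + 1) (hj : 1 ≤ j) (hjq : j ≤ q) :
    P.comp s r n j (P.cup p q s f g) h = P.cup p t n f (P.comp q r t j g h) := by
  rw [P.cup_apply, P.cup_apply]
  exact P.comp_comp_middle _ _ _

/-- Inserting into the first factor of a cup product. -/
theorem comp_cup_left {p q r s t n j : ℕ} (f : O p) (g : O q) (h : O r) (hs : p + q = s)
    (ht : p + r = t + 1) (hn : s + r = n + 1) (hj : 1 ≤ j) (hjp : j ≤ p) :
    P.comp s r n (j + q) (P.cup p q s f g) h = P.cup t q n (P.comp p r t j f h) g := by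
  rw [P.cup_apply, P.cup_apply, P.face_comp_of_lt (p' := p + 1) _ _ ht rfl rfl hjp hj]
  exact P.comp_comp_disjoint _ _ _

/-- Insertion into a cup product is a derivation already on cochains, since each slot belongs to
exactly one factor. The disjunctions leave `t` or `v` arbitrary when the corresponding sum has no
slots. -/
theorem circ_cup_left {p q r s t n v : ℕ} (f : O p) (g : O q) (h : O r) (hs : p + q = s)
    (ht : q = 0 ∨ q + r = t + 1) (hv : p = 0 ∨ p + r = v + 1) (hn : s + r = n + 1) :
    P.circ s r n (P.cup p q s f g) h =
      P.cup p t n f (P.circ q r t g h) + (-1 : k) ^ ((r + 1) * q) • P.cup v q n (P.circ p r v f h) g := by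
  subst hs
  rw [P.circ_apply (p + q), P.circ_apply q, P.circ_apply p, map_sum, map_sum, add_comm p q,
    Finset.sum_range_add, LinearMap.sum_apply, Finset.smul_sum]
  congr 1
  · refine Finset.sum_congr rfl fun i hi => ?_
    rw [Finset.mem_range] at hi
    rw [map_smul, add_comm q p, P.comp_cup_right f g h rfl (t := t) (by omega) hn (by omega) (by omega)]
  · refine Finset.sum_congr rfl fun i hi => ?_
    rw [Finset.mem_range] at hi
    rw [map_smul, LinearMap.smul_apply, smul_smul, ← pow_add,
      ← P.comp_cup_left f g h (s := p + q) rfl (t := v) (by omega) hn (by omega) (by omega), add_comm p q,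
      show q + i + 1 = i + 1 + q by omega]
    congr 2
    ring

/-- The brace `f{g, h}`: the signed sum of all ways to insert `g` to the left of `h` into `f`. -/
def brace {p q r : ℕ} (n : ℕ) (f : O p) (g : O q) (h : O r) : O n :=
  ∑ i ∈ Finset.range p, ∑ j ∈ Finset.range i, (-1 : k) ^ ((q + 1) * i + (r + 1) * j) •
    P.comp (p + q - 1) r n (j + 1) (P.comp p q (p + q - 1) (i + 1) f g) h

/-- Once `g` sits in `f`, the cochain `h` goes to the right of `g`, into `g`, or to the left of `g`.
The associator is thus a sum of braces that is graded symmetric in `g` and `h`. -/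
theorem circ_circ {p q r n s t : ℕ} (f : O p) (g : O q) (h : O r) (hn : p + q + r = n + 2)
    (hs : s = p + q - 1) (ht : t = q + r - 1) :
    P.circ s r n (P.circ p q s f g) h = P.brace n f g h + P.circ p t n f (P.circ q r t g h)
        + (-1 : k) ^ ((q + 1) * (r + 1)) • P.brace n f h g := by
  subst hs ht
  rw [P.circ_apply p q, map_sum, LinearMap.sum_apply, brace, brace, P.circ_apply p,
    ← sum_triangle_swap p (fun i j => (-1 : k) ^ ((r + 1) * i + (q + 1) * j) •
    P.comp (p + r - 1) q n (j + 1) (P.comp p r (p + r - 1) (i + 1) f h) g), Finset.smul_sum,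
    ← Finset.sum_add_distrib, ← Finset.sum_add_distrib]
  refine Finset.sum_congr rfl fun i hi => ?_
  rw [Finset.mem_range] at hi
  have hsum : ∀ F : ℕ → O n, ∑ j ∈ Finset.range (p + q - 1), F j = ∑ j ∈ Finset.range i, F j +
      ∑ j ∈ Finset.range q, F (i + j) + ∑ j ∈ Finset.range (p - 1 - i), F (i + (q + j)) := by
    intro F
    rw [show p + q - 1 = i + (q + (p - 1 - i)) by omega, Finset.sum_range_add,
      Finset.sum_range_add, ← add_assoc]
  rw [P.circ_apply _ r, hsum]
  congr 1
  · congr 1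
    · refine Finset.sum_congr rfl fun j hj => ?_
      rw [map_smul, LinearMap.smul_apply, smul_smul, ← pow_add, add_comm ((r + 1) * j)]
    · rw [P.circ_apply q, map_sum, Finset.smul_sum]
      refine Finset.sum_congr rfl fun j hj => ?_
      rw [Finset.mem_range] at hj
      rw [map_smul, map_smul, LinearMap.smul_apply, smul_smul, smul_smul, ← pow_add, ← pow_add,
        P.comp_comp_middle (t := q + r - 1) (l := j + 1) f g h]
      congr 1
      apply sgn_congr ((q + 1) * i + (r + 1) * j + (r + 1 - 1 + 0) * i)
      obtain ⟨m, hm⟩ : ∃ m, q + r = m + 1 := ⟨q + r - 1, by omega⟩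
      rw [hm, Nat.add_sub_cancel, ← hm]
      simp only [Nat.add_sub_cancel, add_zero]
      ring
  · rw [Finset.smul_sum]
    refine Finset.sum_congr rfl fun j hj => ?_
    rw [Finset.mem_range] at hj
    rw [map_smul, LinearMap.smul_apply, smul_smul, smul_smul, ← pow_add, ← pow_add,
      P.comp_comp_disjoint (t := p + r - 1) (l := i + j + 1 + 1) f g h]
    congr 1
    apply sgn_congr ((r + 1) * (i + q + j + 1) + (q + 1) * i)
    ring

/-- The Gerstenhaber bracket; it is zero unless `p + q = n + 1`. -/
def bracket (p q n : ℕ) : O p →ₗ[k] O q →ₗ[k] O n :=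
  P.circ p q n - (-1 : k) ^ ((p + 1) * (q + 1)) • (P.circ q p n).flip

theorem bracket_apply (p q n : ℕ) (f : O p) (g : O q) :
    P.bracket p q n f g = P.circ p q n f g - (-1 : k) ^ ((p + 1) * (q + 1)) • P.circ q p n g f := rfl

theorem bracket_antisymm (p q n : ℕ) (f : O p) (g : O q) :
    P.bracket p q n f g = -((-1 : k) ^ ((p + 1) * (q + 1)) • P.bracket q p n g f) := by
  rw [bracket_apply, bracket_apply, mul_comm (q + 1)]
  rcases neg_one_pow_eq_or k ((p + 1) * (q + 1)) with h | h <;> rw [h] <;> module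

theorem bracket_eq_zero {p q n : ℕ} (h : p + q ≠ n + 1) : P.bracket p q n = 0 := by
  rw [bracket, P.circ_eq_zero h, P.circ_eq_zero (by omega)]
  ext
  simp

/-- Expanding all six double compositions by `circ_circ` makes the braces cancel. The signs only
depend on the parities of `p`, `q`, `r`, which are checked case by case. -/
theorem jacobi {p q r n : ℕ} (f : O p) (g : O q) (h : O r) (hn : p + q + r = n + 2) :
    P.bracket p (q + r - 1) n f (P.bracket q r (q + r - 1) g h) =
      P.bracket (p + q - 1) r n (P.bracket p q (p + q - 1) f g) h +
        (-1 : k) ^ ((p + 1) * (q + 1)) •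
          P.bracket q (p + r - 1) n g (P.bracket p r (p + r - 1) f h) := by
  have key : ∀ (a b c : ℕ) (x : O a) (y : O b) (z : O c), a + b + c = n + 2 →
      P.bracket a (b + c - 1) n x (P.bracket b c (b + c - 1) y z) =
      P.circ a (b + c - 1) n x (P.bracket b c (b + c - 1) y z) -
        (-1 : k) ^ ((a + 1) * (b + c)) • P.circ (b + c - 1) a n (P.bracket b c (b + c - 1) y z) x := by
    intro a b c x y z habc
    -- For `b + c = 0` the index `b + c - 1` is truncated, and the inner bracket is zero.
    rcases Nat.eq_zero_or_pos (b + c) with h0 | h0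
    · rw [P.bracket_eq_zero (p := b) (by omega)]
      simp
    · rw [P.bracket_apply a, show b + c - 1 + 1 = b + c by omega]
  have key₂ := key r p q h f g (by omega)
  have hs : (-1 : k) ^ ((p + q - 1 + 1) * (r + 1)) • P.bracket r (p + q - 1) n h (P.bracket p q (p + q - 1) f g)
      = (-1 : k) ^ ((p + q) * (r + 1)) • P.bracket r (p + q - 1) n h (P.bracket p q (p + q - 1) f g) := by
    rcases Nat.eq_zero_or_pos (p + q) with h0 | h0
    · rw [P.bracket_eq_zero (p := p) (by omega)]
      simp
    · rw [show p + q - 1 + 1 = p + q by omega]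
  rw [P.bracket_antisymm (p + q - 1), hs, key₂, key p q r f g h hn, key q p r g f h (by omega)]
  simp only [bracket_apply, map_sub, map_smul, LinearMap.sub_apply, LinearMap.smul_apply]
  have e₁ := P.circ_circ (n := n) (s := p + q - 1) (t := q + r - 1) f g h (by omega) (by omega) (by omega)
  have e₂ := P.circ_circ (n := n) (s := p + r - 1) (t := q + r - 1) f h g (by omega) (by omega) (by omega)
  have e₃ := P.circ_circ (n := n) (s := p + q - 1) (t := p + r - 1) g f h (by omega) (by omega) (by omega)
  have e₄ := P.circ_circ (n := n) (s := q + r - 1) (t := p + r - 1) g h f (by omega) (by omega) (by omega)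
  have e₅ := P.circ_circ (n := n) (s := p + r - 1) (t := p + q - 1) h f g (by omega) (by omega) (by omega)
  have e₆ := P.circ_circ (n := n) (s := q + r - 1) (t := p + q - 1) h g f (by omega) (by omega) (by omega)
  rw [e₁, e₂, e₃, e₄, e₅, e₆]
  rcases neg_one_pow_eq_or k p with hp | hp <;> rcases neg_one_pow_eq_or k q with hq | hq <;>
    rcases neg_one_pow_eq_or k r with hr | hr <;>
    simp only [pow_add, pow_mul, hp, hq, hr, one_pow, pow_one, neg_neg, mul_one,
      mul_neg] <;> module

end OperadWithMultiplication
end AbstractOperad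

/-! ### Coboundaries and the Leibniz rule up to homotopy. -/

section AbstractOperad

variable {k : Type u} [CommRing k] {O : ℕ → Type v} [∀ n, AddCommGroup (O n)] [∀ n, Module k (O n)]

namespace OperadWithMultiplication

variable (P : OperadWithMultiplication k O)

theorem diff_diff {n n' n'' : ℕ} (x : O n) (hn' : n' = n + 1) (hn'' : n'' = n' + 1) :
    P.diff n' n'' (P.diff n n' x) = 0 := by
  subst hn'
  change P.faceSum _ _ _ _ (P.faceSum _ _ _ _ x) = 0
  simp only [faceSum_apply, map_sum, map_smul, Finset.smul_sum, ← Finset.range_eq_Ico]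
  have h : ∀ i ∈ Finset.range (n + 2), ∀ F : ℕ → O n'', ∑ j ∈ Finset.range (n + 2), F j =
      ∑ j ∈ Finset.range i, F j + ∑ j ∈ Finset.range (n + 2 - i), F (i + j) := by
    intro i hi F
    rw [Finset.mem_range] at hi
    rw [← Finset.sum_range_add, Nat.add_sub_cancel' hi.le]
  let F : ℕ → ℕ → O n'' := fun s t =>
    (-1 : k) ^ t • (-1 : k) ^ s • P.face (n + 1) n'' s (P.face n (n + 1) t x)
  have hF : ∀ i m, i + m < n + 2 → F (i + m + 1) i = - F i (i + m) := by
    intro i m him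
    simp only [F]
    rw [P.face_face x (Nat.le_add_right i m) (by omega) rfl hn'']
    match_scalars
    ring
  rw [Finset.sum_comm]
  change ∑ s ∈ Finset.range (n + 1 + 2), ∑ t ∈ Finset.range (n + 2), F s t = 0
  have h₁ : ∑ s ∈ Finset.range (n + 1 + 2), ∑ t ∈ Finset.range (n + 2), F s t =
      ∑ s ∈ Finset.range (n + 3), ∑ t ∈ Finset.range s, F s t +
      ∑ s ∈ Finset.range (n + 2), ∑ m ∈ Finset.range (n + 2 - s), F s (s + m) := by
    rw [Finset.sum_range_succ, Finset.sum_range_succ (n := n + 2), Finset.sum_congr rfl fun i hi =>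
      h i hi _, Finset.sum_add_distrib]
    abel
  rw [h₁, ← sum_triangle_swap, Finset.sum_range_succ]
  simp only [show n + 3 - 1 - (n + 2) = 0 by omega, Finset.range_zero, Finset.sum_empty, add_zero]
  rw [← Finset.sum_add_distrib]
  refine Finset.sum_eq_zero fun i hi => ?_
  rw [show n + 3 - 1 - i = n + 2 - i by omega, ← Finset.sum_add_distrib]
  refine Finset.sum_eq_zero fun m hm => ?_
  rw [Finset.mem_range] at hi hm
  rw [hF i m (by omega), neg_add_cancel]

/-- The submodule of coboundaries. -/
def boundaries : (n : ℕ) → Submodule k (O n)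
  | 0 => ⊥
  | n + 1 => LinearMap.range (P.diff n (n + 1))

theorem diff_mem_boundaries {n n' : ℕ} (hn : n' = n + 1) (x : O n) :
    P.diff n n' x ∈ P.boundaries n' := by
  subst hn
  exact ⟨x, rfl⟩

theorem diff_eq_zero_of_mem_boundaries {n n' : ℕ} (hn : n' = n + 1) {x : O n}
    (hx : x ∈ P.boundaries n) : P.diff n n' x = 0 := by
  cases n with
  | zero => rw [(Submodule.mem_bot k).1 hx, map_zero]
  | succ n =>
    obtain ⟨y, rfl⟩ := hx
    exact P.diff_diff y rfl hn

/-- Two applications of `faceSum_comp` cut the faces of `x` into three overlapping intervals. The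
slots attached to them are exactly the three shifts in `sum_triangle_shift`. -/
theorem diff_comp_comp {p q r m n p' q' r' m' n' i j : ℕ} (x : O p) (f : O q) (g : O r)
    (hm : p + q = m + 1) (hn : m + r = n + 1) (hp' : p' = p + 1) (hq' : q' = q + 1)
    (hr' : r' = r + 1) (hm' : m' = m + 1) (hn' : n' = n + 1) (hj : 1 ≤ j) (hji : j < i)
    (hip : i ≤ p) :
    P.diff n n' (P.comp m r n j (P.comp p q m i x f) g) =
      P.comp m' r n' (j + 1) (P.comp p' q m' (i + 1) (P.faceSum p p' 0 (j + 1) x) f) g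
      - (-1 : k) ^ r • P.comp m' r n' j (P.comp p' q m' (i + 1) (P.faceSum p p' j (i + 1) x) f) g
      + (-1 : k) ^ (q + r) • P.comp m' r n' j (P.comp p' q m' i (P.faceSum p p' i (p + 2) x) f) g
      + (-1 : k) ^ (i + r) • P.comp m' r n' j (P.comp p q' m' i x (P.diff q q' f)) g
      - (-1 : k) ^ j • P.comp m r' n' j (P.comp p q m i x f) (P.diff r r' g) := by
  rw [show P.diff n n' = P.faceSum n n' 0 (n + 2) from rfl,
    P.faceSum_comp _ _ hn hm' hr' hn' hj (by omega) (by omega),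
    P.faceSum_comp_of_le _ _ hm hp' hm' hip (by omega),
    P.faceSum_comp _ _ hm hp' hq' hm' (by omega) hip hji.le]
  simp only [map_sub, map_smul, LinearMap.sub_apply, LinearMap.smul_apply]
  module

/-- The homotopy for the Leibniz rule of the Gerstenhaber bracket. -/
theorem circ_cup_mem_boundaries {p q r s t v n : ℕ} (x : O p) (f : O q) (g : O r)
    (hx : P.diff p (p + 1) x = 0) (hf : P.diff q (q + 1) f = 0) (hg : P.diff r (r + 1) g = 0)
    (hn : p + q + r = n + 1) (hs : q + r = s) (ht : t = p + q - 1) (hv : v = p + r - 1) :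
    P.circ p s n x (P.cup q r s f g) - P.cup t r n (P.circ p q t x f) g
      - (-1 : k) ^ (q * (p + 1)) • P.cup q v n f (P.circ p r v x g) ∈ P.boundaries n := by
  -- `F a b i j` inserts `f` and `g` into the faces of `x` with index in `[a, b)`. At a fixed
  -- position the three intervals used below tile `[0, p + 2)`, so their sum is a double insertion
  -- into `diff x = 0`. On each edge a single face survives.
  let F : ℕ → ℕ → ℕ → ℕ → O n := fun a b i j => (-1 : k) ^ ((q + 1) * i + (r + 1) * j) •
    P.comp (p + q) r n (j + 1) (P.comp (p + 1) q (p + q) (i + 1) (P.faceSum p (p + 1) a b x) f) g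
  have key := sum_triangle_shift p (fun i j => F 0 (j + 1) i j) (fun i j => F (j + 1) (i + 1) i j)
    (fun i j => F (i + 1) (p + 2) i j)
  have hfull : ∑ i ∈ Finset.range (p + 1), ∑ j ∈ Finset.range i,
      (F 0 (j + 1) i j + F (j + 1) (i + 1) i j + F (i + 1) (p + 2) i j) = 0 := by
    refine Finset.sum_eq_zero fun i hi => Finset.sum_eq_zero fun j hj => ?_
    rw [Finset.mem_range] at hi hj
    simp only [F]
    rw [← smul_add, ← smul_add, ← LinearMap.add_apply, ← LinearMap.add_apply, ← map_add, ← map_add,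
      ← LinearMap.add_apply, ← LinearMap.add_apply, ← map_add, ← map_add,
      P.faceSum_add (by omega) (by omega), P.faceSum_add (by omega) (by omega),
      show P.faceSum p (p + 1) 0 (p + 2) x = P.diff p (p + 1) x from rfl, hx]
    simp
  have h₁ : ∑ i ∈ Finset.range p, F 0 (0 + 1) (i + 1) 0 =
      (-1 : k) ^ (q + 1) • P.cup t r n (P.circ p q t x f) g := by
    rw [P.circ_apply, map_sum, LinearMap.sum_apply, Finset.smul_sum]
    refine Finset.sum_congr rfl fun i hi => ?_
    rw [Finset.mem_range] at hi
    simp only [F, faceSum_succ, pow_zero, one_smul, map_smul, LinearMap.smul_apply]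
    rw [P.cup_apply, P.face_comp_of_lt x f (p' := p + 1) (by omega) rfl rfl (by omega)
      (by omega), show t + 1 = p + q by omega]
    match_scalars
    ring
  have h₂ : ∑ i ∈ Finset.range p, F (i + 1) (i + 1 + 1) (i + 1) i =
      (-1 : k) ^ q • P.circ p s n x (P.cup q r s f g) := by
    rw [P.circ_apply, Finset.smul_sum]
    refine Finset.sum_congr rfl fun i hi => ?_
    rw [Finset.mem_range] at hi
    simp only [F, faceSum_succ, map_smul, LinearMap.smul_apply]
    rw [P.cup_apply, ← P.comp_comp_middle (s := p + q) (j := i + 1) x (P.face q (q + 1) 0 f) g,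
      P.comp_face_zero (p' := p + 1) x f rfl rfl (by omega) (by omega) (by omega), ← hs]
    match_scalars
    ring_nf
    simp only [neg_one_pow_mul_three]
  have h₃ : ∑ j ∈ Finset.range p, F (p + 1) (p + 2) p j =
      - (-1 : k) ^ q • (-1 : k) ^ (q * (p + 1)) • P.cup q v n f (P.circ p r v x g) := by
    rw [P.circ_apply, map_sum, Finset.smul_sum, Finset.smul_sum]
    refine Finset.sum_congr rfl fun i hi => ?_
    rw [Finset.mem_range] at hi
    simp only [F, faceSum_succ, map_smul, LinearMap.smul_apply]
    rw [← P.cup_eq_comp_last (by omega), P.comp_cup_right (t := v) f x g (by omega) (by omega)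
      (by omega) (by omega) (by omega)]
    match_scalars
    ring_nf
    simp only [neg_one_pow_mul_two]
    ring
  rw [hfull, h₁, h₂, h₃] at key
  have hmem : ∑ i ∈ Finset.range p, ∑ j ∈ Finset.range i,
      (F 0 (j + 1 + 1) (i + 1) (j + 1) + F (j + 1) (i + 1 + 1) (i + 1) j + F (i + 1) (p + 2) i j) ∈
        P.boundaries n := by
    refine Submodule.sum_mem _ fun i hi => Submodule.sum_mem _ fun j hj => ?_
    rw [Finset.mem_range] at hi hj
    obtain ⟨n, rfl⟩ : ∃ m, n = m + 1 := ⟨n - 1, by omega⟩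
    convert Submodule.smul_mem _ ((-1 : k) ^ ((q + 1) * i + (r + 1) * j + q + r))
      (P.diff_mem_boundaries rfl
        (P.comp (p + q - 1) r n (j + 1) (P.comp p q (p + q - 1) (i + 1) x f) g)) using 1
    rw [P.diff_comp_comp (m' := p + q) x f g (by omega) (by omega) rfl rfl rfl (by omega) rfl (by omega)
      (by omega) (by omega), hf, hg]
    simp only [F, map_zero, LinearMap.zero_apply, smul_zero, add_zero, sub_zero]
    match_scalars <;> ring_nf <;> simp only [neg_one_pow_mul_two] <;> ring
  rw [key] at hmem
  convert Submodule.smul_mem _ (-(-1 : k) ^ q) hmem using 1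
  match_scalars <;> ring_nf
  all_goals simp only [neg_one_pow_mul_two, neg_one_pow_mul_three]

end OperadWithMultiplication
end AbstractOperad

/-! ### Commutativity of the cup product, and rotations of faces and of nullary insertions. -/

section AbstractOperad

variable {k : Type u} [CommRing k] {O : ℕ → Type v} [∀ n, AddCommGroup (O n)] [∀ n, Module k (O n)]

namespace OperadWithMultiplication

variable (P : OperadWithMultiplication k O)

theorem diff_unit : P.diff 0 1 P.unit = 0 := by
  rw [show P.diff 0 1 P.unit = P.faceSum 0 1 0 (0 + 2) P.unit from rfl, faceSum_apply,
    Nat.Ico_zero_eq_range, Finset.sum_range_succ, Finset.sum_range_one, P.face_zero,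
    show (1 : ℕ) = 0 + 1 from rfl, P.face_last, P.mul_unit_left, P.mul_unit_right]
  simp

theorem cup_comm_mem_boundaries {p q n : ℕ} (f : O p) (g : O q) (hf : P.diff p (p + 1) f = 0)
    (hg : P.diff q (q + 1) g = 0) :
    P.cup p q n f g - (-1 : k) ^ (p * q) • P.cup q p n g f ∈ P.boundaries n := by
  by_cases hn : p + q = n
  -- In degree `0` there is no pre-Lie product to serve as a homotopy; instead the cocycle condition
  -- says that the two faces of `f` agree.
  · cases n with
    | zero =>
      obtain rfl : p = 0 := by omega
      obtain rfl : q = 0 := by omega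
      have h : P.face 0 1 0 f = P.face 0 1 1 f := by
        have : P.faceSum 0 1 0 (0 + 2) f = 0 := hf
        rw [← P.faceSum_add (b := 1) (by omega) (by omega), P.faceSum_succ 0 1 0,
            P.faceSum_succ 0 1 1] at this
        simpa [← sub_eq_add_neg, sub_eq_zero] using this
      have : P.cup 0 0 0 f g = P.cup 0 0 0 g f := by
        rw [P.cup_apply, P.cup_eq_comp_last rfl, zero_add, h]
      rw [this]
      simp
    | succ n =>
      have key := P.diff_mem_boundaries (n' := n + 1) rfl (P.circ p q n f g)
      rw [P.diff_circ f g hn rfl rfl rfl, hf, hg] at key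
      convert Submodule.smul_mem _ ((-1 : k) ^ q) key using 1
      simp only [map_zero, LinearMap.zero_apply, smul_zero]
      match_scalars <;> ring_nf <;> simp only [neg_one_pow_mul_two]
      ring
  · rw [P.cup_eq_zero hn, P.cup_eq_zero (by omega)]
    simp

end OperadWithMultiplication

namespace ParaCyclicOperadWithMultiplication

variable (P : ParaCyclicOperadWithMultiplication k O)

/-- Compatibility of the cyclic operator with the unit. -/
structure IsUnital : Prop where
  tau_comp_unit : ∀ (n : ℕ) (x : O (n + 1)), P.tau n (P.comp (n + 1) 0 n 1 x P.unit) =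
    P.comp (n + 1) 0 n (n + 1) (P.tau (n + 1) (P.tau (n + 1) x)) P.unit
  tau_mul_comp : ∀ x : O 0, P.tau 1 (P.comp 2 0 1 1 P.mul x) = P.comp 2 0 1 2 P.mul (P.tau 0 x)

theorem tau_face_zero {n n' : ℕ} (hn : n' = n + 1) (x : O n) :
    P.tau n' (P.face n n' 0 x) = P.face n n' (n + 1) x := by
  rw [P.face_zero, P.face_last, P.tau_comp _ _ _ _ _ _ (by omega) le_rfl le_rfl, P.tau_mul]

variable {P}

namespace IsUnital

variable (hP : P.IsUnital)
include hP

/-- Rotating a multiplication into the next slot is an operad axiom, except for the last face of a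
nullary element, which `tau_comp_one` does not cover and `tau_mul_comp` supplies. -/
theorem tau_face_succ {n n' t : ℕ} (hn : n' = n + 1) (ht : t ≤ n) (x : O n) :
    P.tau n' (P.face n n' (t + 1) x) = P.face n n' t (P.tau n x) := by
  subst hn
  rcases ht.eq_or_lt with rfl | hlt
  · rw [P.face_last]
    rcases Nat.eq_zero_or_pos t with rfl | h0
    · rw [P.face_zero]
      exact hP.tau_mul_comp x
    · rw [P.tau_comp_one _ _ _ _ _ (by omega) (by omega) h0, P.tau_mul,
        P.face_of_pos _ (by omega) (by omega)]
  · rw [P.face_of_pos _ (by omega) (by omega)]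
    rcases Nat.eq_zero_or_pos t with rfl | h0
    · rw [P.face_zero, P.tau_comp_one _ _ _ _ _ (by omega) (by omega) (by omega), P.tau_mul]
    · rw [P.face_of_pos _ (by omega) (by omega), P.tau_comp _ _ _ _ _ _ (by omega) (by omega) (by omega)]
      rfl

/-- The cyclic operator moves a `0`-ary element from the last slot to the first one. -/
theorem tau_comp_zero (h₀ : ∀ x, P.tau 0 x = x) {n : ℕ} (f : O (n + 1)) (a : O 0) :
    P.tau n (P.comp (n + 1) 0 n 1 f a) =
      P.comp (n + 1) 0 n (n + 1) (P.tau (n + 1) (P.tau (n + 1) f)) a := by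
  -- A nullary element is the unit inserted into left multiplication by `a`. This unary operation is
  -- within reach of `tau_comp_one`, so the relation for the unit implies the one for `a`.
  have ha : P.comp 1 0 0 1 (P.comp 2 0 1 2 P.mul a) P.unit = a := by
    have := P.cup_unit 0 a
    rwa [P.cup_apply, P.face_zero] at this
  conv_lhs => rw [← ha]
  conv_rhs => rw [← ha]
  rw [← P.comp_comp_middle (s := n + 1) (j := 1) f (P.comp 2 0 1 2 P.mul a) P.unit,
    hP.tau_comp_unit, P.tau_comp_one _ _ _ _ _ (by omega) (by omega) le_rfl,
    P.tau_comp _ _ _ _ _ _ (by omega) le_rfl le_rfl, P.tau_mul,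
    P.tau_comp_one _ _ _ _ _ (by omega) (by omega) (by omega), hP.tau_mul_comp, h₀]
  exact P.comp_comp_middle _ _ _

/-- In `n` rotations `a` travels from slot `n + 1` to slot `1`; the last rotation takes it back and
costs two powers of `τ` on `f`. This turns cyclicity in degree `n` into cyclicity in degree `n + 1`.
-/
theorem tau_pow_comp_zero (h₀ : ∀ x, P.tau 0 x = x) {n : ℕ} (f : O (n + 1)) (a : O 0) :
    (P.tau n)^[n + 1] (P.comp (n + 1) 0 n (n + 1) f a) =
      P.comp (n + 1) 0 n (n + 1) ((P.tau (n + 1))^[n + 1 + 1] f) a := by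
  have h : ∀ j ≤ n, (P.tau n)^[j] (P.comp (n + 1) 0 n (n + 1) f a) =
      P.comp (n + 1) 0 n (n + 1 - j) ((P.tau (n + 1))^[j] f) a := by
    intro j hj
    induction j with
    | zero => rfl
    | succ j ih =>
      rw [Function.iterate_succ_apply', ih (by omega), Function.iterate_succ_apply',
        P.tau_comp _ _ _ _ _ _ (by omega) (by omega) (by omega)]
      rfl
  rw [Function.iterate_succ_apply', h n le_rfl, Nat.add_sub_cancel_left, hP.tau_comp_zero h₀,
    Function.iterate_succ_apply', Function.iterate_succ_apply']

theorem tau_pow_face_of_le {n n' a t : ℕ} (hn : n' = n + 1) (hat : a ≤ t) (ht : t ≤ n + 1) (x : O n) :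
    (P.tau n')^[a] (P.face n n' t x) = P.face n n' (t - a) ((P.tau n)^[a] x) := by
  induction a with
  | zero => rfl
  | succ a ih =>
    rw [Function.iterate_succ_apply', ih (by omega), show t - a = t - (a + 1) + 1 by omega,
      hP.tau_face_succ hn (by omega), Function.iterate_succ_apply']

/-- After `t` rotations the face has index `0`. The next one turns it into the last face without
rotating `x`, hence one power of `τ` fewer on the right. -/
theorem tau_pow_face_of_ge {n n' a t : ℕ} (hn : n' = n + 1) (hta : t ≤ a) (ht : t ≤ n + 1)
    (ha : a ≤ n + 1 + t) (x : O n) :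
    (P.tau n')^[a + 1] (P.face n n' t x) = P.face n n' (n + 1 + t - a) ((P.tau n)^[a] x) := by
  obtain ⟨b, rfl⟩ := Nat.exists_eq_add_of_le hta
  clear hta
  induction b with
  | zero =>
    rw [add_zero, Function.iterate_succ_apply', hP.tau_pow_face_of_le hn le_rfl ht, Nat.sub_self,
      P.tau_face_zero hn, Nat.add_sub_cancel]
  | succ b ih =>
    rw [show t + (b + 1) + 1 = (t + b + 1) + 1 by omega, Function.iterate_succ_apply', ih (by omega),
      show n + 1 + t - (t + b) = n + 1 + t - (t + (b + 1)) + 1 by omega, hP.tau_face_succ hn (by omega),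
      ← Function.iterate_succ_apply' (P.tau n)]
    rfl

/-- The rotations of a cocycle are related by partial sums of cofaces. -/
theorem faceSum_tau_pow {p j : ℕ} (hj : j ≤ p) (h : O p) (hh : P.diff p (p + 1) h = 0) :
    P.faceSum p (p + 1) (j + 1) (p + 2) ((P.tau p)^[p - j] h) =
      -((-1 : k) ^ p • P.faceSum p (p + 1) 0 (j + 1) ((P.tau p)^[p + 1 - j] h)) := by
  -- Apply `τ^(p + 1 - j)` to `diff h = 0`. The faces with index below `p + 1 - j` wrap around and
  -- carry `τ^(p - j) h`; the others only move down and carry `τ^(p + 1 - j) h`.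
  have h₀ : (P.tau (p + 1))^[p + 1 - j] (P.diff p (p + 1) h) = 0 := by
    rw [hh, ← Module.End.pow_apply, map_zero]
  rw [show P.diff p (p + 1) h = P.faceSum p (p + 1) 0 (p + 2) h from rfl, P.faceSum_apply,
    ← Module.End.pow_apply, map_sum, ← Finset.sum_Ico_consecutive _ (Nat.zero_le (p + 1 - j)) (by omega),
    Finset.sum_Ico_eq_sum_range, Finset.sum_Ico_eq_sum_range] at h₀
  have h₁ : ∑ t ∈ Finset.range (p + 1 - j - 0), ((P.tau (p + 1)) ^ (p + 1 - j))
      ((-1 : k) ^ (0 + t) • P.face p (p + 1) (0 + t) h) =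
      (-1 : k) ^ (j + 1) • P.faceSum p (p + 1) (j + 1) (p + 2) ((P.tau p)^[p - j] h) := by
    rw [P.faceSum_apply, Finset.sum_Ico_eq_sum_range, Finset.smul_sum]
    refine Finset.sum_congr (by congr 1; omega) fun t ht => ?_
    rw [Finset.mem_range] at ht
    rw [map_smul, Module.End.pow_apply, show p + 1 - j = p - j + 1 by omega,
      hP.tau_pow_face_of_ge rfl (by omega) (by omega) (by omega),
      show p + 1 + (0 + t) - (p - j) = j + 1 + t by omega, smul_smul, ← pow_add]
    congr 1
    exact sgn_congr (j + 1 + t) (by ring)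
  have h₂ : ∑ t ∈ Finset.range (p + 2 - (p + 1 - j)), ((P.tau (p + 1)) ^ (p + 1 - j))
      ((-1 : k) ^ (p + 1 - j + t) • P.face p (p + 1) (p + 1 - j + t) h) =
      (-1 : k) ^ (p + 1 - j) • P.faceSum p (p + 1) 0 (j + 1) ((P.tau p)^[p + 1 - j] h) := by
    rw [P.faceSum_apply, Finset.sum_Ico_eq_sum_range, Finset.smul_sum]
    refine Finset.sum_congr (by congr 1; omega) fun t ht => ?_
    rw [Finset.mem_range] at ht
    rw [map_smul, Module.End.pow_apply, hP.tau_pow_face_of_le rfl (by omega) (by omega),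
      Nat.add_sub_cancel_left, zero_add, smul_smul, pow_add]
  rw [h₁, h₂] at h₀
  have h₃ := congrArg (fun x => (-1 : k) ^ (j + 1) • x) h₀
  simp only [smul_add, smul_smul, ← pow_add, smul_zero] at h₃
  rw [sgn_congr (b := 0) (j + 1) (by omega), pow_zero, one_smul,
    sgn_congr (b := p) (p + 1) (by omega)] at h₃
  exact eq_neg_of_add_eq_zero_left h₃

end IsUnital

end ParaCyclicOperadWithMultiplication
end AbstractOperad

/-! ### The para-cocyclic module and Connes' operator. -/

section AbstractOperad

variable {k : Type u} [CommRing k] {O : ℕ → Type v} [∀ n, AddCommGroup (O n)] [∀ n, Module k (O n)]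

namespace OperadWithMultiplication

variable (P : OperadWithMultiplication k O)

theorem comp_face_unit {n n' j : ℕ} (hn : n' = n + 1) (hj : j ≤ n) (x : O n) :
    P.comp n' 0 n (j + 1) (P.face n n' j x) P.unit = x := by
  subst hn
  rcases Nat.eq_zero_or_pos j with rfl | h0
  · exact P.cup_unit n x
  · rw [P.face_of_pos _ (by omega) (by omega)]
    refine (P.comp_comp_middle (t := 1) (l := 2) _ _ _).trans ?_
    rw [P.mul_unit_right, P.comp_one _ _ _ h0 hj]

theorem comp_face_succ_unit {n n' j : ℕ} (hn : n' = n + 1) (hj : j ≤ n) (x : O n) :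
    P.comp n' 0 n (j + 1) (P.face n n' (j + 1) x) P.unit = x := by
  subst hn
  rcases hj.eq_or_lt with rfl | h
  · rw [← P.cup_eq_comp_last (zero_add j), P.unit_cup]
  · rw [P.face_of_pos _ (by omega) (by omega)]
    refine (P.comp_comp_middle (t := 1) (l := 1) _ _ _).trans ?_
    rw [P.mul_unit_left, P.comp_one _ _ _ (by omega) h]

end OperadWithMultiplication

namespace ParaCyclicOperadWithMultiplication

variable {P : ParaCyclicOperadWithMultiplication k O} (hP : P.IsUnital)

/-- The para-cocyclic module of a unital para-cyclic operad with multiplication. -/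
def IsUnital.toParaCocyclicModule : ParaCocyclicModule k O where
  delta n i := P.face n (n + 1) i
  sigma n j := (P.comp (n + 1) 0 n (j + 1)).flip P.unit
  tau := P.tau
  delta_delta n i j x hij := by
    simpa using P.face_face x (Fin.le_def.1 hij) (by omega) rfl rfl
  sigma_sigma n i j x hij := by
    have := Fin.le_def.1 hij
    exact P.comp_comp_disjoint _ _ _ (hl := by simp; omega) (hil := by simp; omega) (hj := by simp)
  sigma_delta_of_lt n i j x hij := by
    have : (i : ℕ) ≤ j := hij
    exact (P.face_comp_of_lt x P.unit (j := j + 1) (t := i) (by omega) rfl rfl (by omega)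
      (by omega)).symm
  sigma_delta_self n j x := P.comp_face_unit rfl (by omega) x
  sigma_delta_succ n j x := P.comp_face_succ_unit rfl (by omega) x
  sigma_delta_of_gt n i j x hij := by
    have : (j : ℕ) < i := hij
    exact (P.face_comp_of_ge x P.unit (j := j + 1) (t := i + 1) (by omega) rfl rfl (by omega)
      (by omega) (by omega)).symm
  tau_delta_zero n x := P.tau_face_zero rfl x
  tau_delta_succ n i x := hP.tau_face_succ rfl (by omega) x
  tau_sigma_zero n x := hP.tau_comp_unit n x
  tau_sigma_succ n i x := P.tau_comp _ _ _ _ _ _ (by omega) (by simp) (by simp)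

variable (P) in
/-- The signed cyclic operator. -/
def lam (n : ℕ) : Module.End k (O n) := (-1 : k) ^ n • P.tau n

variable (P) in
/-- The norm operator. -/
def norm (n : ℕ) : Module.End k (O n) := ∑ j ∈ Finset.range (n + 1), P.lam n ^ j

variable (P) in
/-- The extra codegeneracy. -/
def extra (n : ℕ) : O (n + 1) →ₗ[k] O n :=
  (P.comp (n + 1) 0 n (n + 1)).flip P.unit ∘ₗ P.tau (n + 1)

variable (P) in
/-- Connes' operator up to sign. -/
def connes (n : ℕ) : O (n + 1) →ₗ[k] O n :=
  P.norm n ∘ₗ P.extra n ∘ₗ (LinearMap.id - P.lam (n + 1))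

theorem lam_apply (n : ℕ) (x : O n) : P.lam n x = (-1 : k) ^ n • P.tau n x := rfl

theorem lam_pow_apply (n j : ℕ) (x : O n) :
    (P.lam n ^ j) x = (-1 : k) ^ (n * j) • (P.tau n)^[j] x := by
  rw [lam, smul_pow, LinearMap.smul_apply, Module.End.pow_apply, pow_mul]

theorem norm_apply (n : ℕ) (x : O n) :
    P.norm n x = ∑ j ∈ Finset.range (n + 1), (P.lam n ^ j) x := by
  simp [norm, LinearMap.sum_apply]

theorem extra_apply (n : ℕ) (x : O (n + 1)) :
    P.extra n x = P.comp (n + 1) 0 n (n + 1) (P.tau (n + 1) x) P.unit := rfl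

theorem connes_apply (n : ℕ) (x : O (n + 1)) :
    P.connes n x = P.norm n (P.extra n (x - P.lam (n + 1) x)) := rfl

section Cyclic

variable (hc : P.IsCyclic)
include hc

theorem IsCyclic.lam_pow (n : ℕ) : P.lam n ^ (n + 1) = 1 := by
  ext x
  rw [lam_pow_apply, hc, sgn_congr (b := 0) ((n * (n + 1)) / 2), pow_zero, one_smul, Module.End.one_apply]
  have := Nat.even_mul_succ_self n
  rw [add_zero, Nat.mul_div_cancel' this.two_dvd]

theorem IsCyclic.norm_sub (n : ℕ) (x : O n) : P.norm n (x - P.lam n x) = 0 := by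
  have : P.norm n * (1 - P.lam n) = 0 := by
    rw [norm, geom_sum_mul_neg, hc.lam_pow, sub_self]
  exact LinearMap.congr_fun this x

theorem IsCyclic.norm_lam (n : ℕ) (x : O n) : P.norm n (P.lam n x) = P.norm n x := by
  have := hc.norm_sub n x
  rw [map_sub, sub_eq_zero] at this
  exact this.symm

theorem IsCyclic.sub_norm (n : ℕ) (x : O n) : P.norm n x - P.lam n (P.norm n x) = 0 := by
  have : (1 - P.lam n) * P.norm n = 0 := by
    rw [norm, mul_neg_geom_sum, hc.lam_pow, sub_self]
  exact LinearMap.congr_fun this x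

theorem IsCyclic.connes_connes (n : ℕ) (x : O (n + 2)) : P.connes n (P.connes (n + 1) x) = 0 := by
  rw [connes_apply, connes_apply, hc.sub_norm, map_zero, map_zero]

end Cyclic

namespace IsUnital

include hP

theorem lam_face_succ {n t : ℕ} (ht : t ≤ n) (x : O n) :
    (-1 : k) ^ (t + 1) • P.lam (n + 1) (P.face n (n + 1) (t + 1) x) =
      (-1 : k) ^ t • P.face n (n + 1) t (P.lam n x) := by
  rw [lam_apply, lam_apply, hP.tau_face_succ rfl ht, map_smul, smul_smul, smul_smul]
  congr 1
  ring

/-- With `b = diff` and `b'` the sum without the last face, this is `(1 - λ) b = b' (1 - λ)`: the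
operator `λ` lowers the index of each signed face by one and sends face `0` to the last face. -/
theorem lam_diff (n : ℕ) (x : O n) :
    P.diff n (n + 1) x - P.lam (n + 1) (P.diff n (n + 1) x) =
      P.faceSum n (n + 1) 0 (n + 1) (x - P.lam n x) := by
  have h : P.lam (n + 1) (P.diff n (n + 1) x) =
      P.faceSum n (n + 1) 0 (n + 1) (P.lam n x) + (-1 : k) ^ (n + 1) • P.face n (n + 1) (n + 1) x := by
    rw [show P.diff n (n + 1) x = P.faceSum n (n + 1) 0 (n + 2) x from rfl, P.faceSum_apply,
      P.faceSum_apply, ← Finset.range_eq_Ico, ← Finset.range_eq_Ico, Finset.sum_range_succ', map_add,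
      map_sum]
    congr 1
    · refine Finset.sum_congr rfl fun t ht => ?_
      rw [Finset.mem_range] at ht
      rw [map_smul, hP.lam_face_succ (by omega)]
    · rw [pow_zero, one_smul, lam_apply, P.tau_face_zero rfl]
  rw [h, map_sub, show P.diff n (n + 1) x = P.faceSum n (n + 1) 0 (n + 2) x from rfl,
    ← P.faceSum_add (b := n + 1) (by omega) (by omega), P.faceSum_succ]
  abel

/-- This is `N b' = b N`. Under `N` every signed face becomes face `0` of a rotation, so the left
side is `N` of face `0` of `N x`. As `N x` is `λ`-invariant, the powers of `λ` turn this face into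
all the signed faces. -/
theorem norm_faceSum (hc : P.IsCyclic) (n : ℕ) (x : O n) :
    P.norm (n + 1) (P.faceSum n (n + 1) 0 (n + 1) x) = P.diff n (n + 1) (P.norm n x) := by
  have h₁ : ∀ t ≤ n, ∀ x : O n, (-1 : k) ^ t • P.norm (n + 1) (P.face n (n + 1) t x) =
      P.norm (n + 1) (P.face n (n + 1) 0 ((P.lam n ^ t) x)) := by
    intro t ht
    induction t with
    | zero => intro x; simp
    | succ t ih =>
      intro x
      rw [← hc.norm_lam, ← map_smul, hP.lam_face_succ (by omega), map_smul, ih (by omega), pow_succ]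
      rfl
  have h₂ : ∀ y : O n, P.lam n y = y → ∀ j ≤ n,
      (P.lam (n + 1) ^ (j + 1)) (P.face n (n + 1) 0 y) =
        (-1 : k) ^ (n + 1 - j) • P.face n (n + 1) (n + 1 - j) y := by
    intro y hy j hj
    induction j with
    | zero => rw [zero_add, pow_one, lam_apply, P.tau_face_zero rfl, Nat.sub_zero]
    | succ j ih =>
      rw [pow_succ', Module.End.mul_apply, ih (by omega), map_smul,
        show n + 1 - j = n + 1 - (j + 1) + 1 by omega, hP.lam_face_succ (by omega), hy]
  have hy := hc.sub_norm n x
  rw [sub_eq_zero] at hy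
  have h₃ : ∑ t ∈ Finset.range (n + 1), (P.lam (n + 1) ^ (t + 1)) (P.face n (n + 1) 0 (P.norm n x)) =
      ∑ t ∈ Finset.range (n + 1), (-1 : k) ^ (t + 1) • P.face n (n + 1) (t + 1) (P.norm n x) := by
    rw [← Finset.sum_range_reflect]
    refine Finset.sum_congr rfl fun t ht => ?_
    rw [Finset.mem_range] at ht
    rw [h₂ _ hy.symm _ (by omega), show n + 1 - (n + 1 - 1 - t) = t + 1 by omega]
  rw [P.faceSum_apply, map_sum, ← Finset.range_eq_Ico,
    Finset.sum_congr rfl fun t ht => (map_smul _ _ _).trans (h₁ t (by rw [Finset.mem_range] at ht; omega) x),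
    ← map_sum, ← map_sum, ← norm_apply, norm_apply, Finset.sum_range_succ', h₃,
    show P.diff n (n + 1) (P.norm n x) = P.faceSum n (n + 1) 0 (n + 2) (P.norm n x) from rfl,
    P.faceSum_apply, ← Finset.range_eq_Ico,
    Finset.sum_range_succ' (fun t => (-1 : k) ^ t • P.face n (n + 1) t (P.norm n x))]
  simp

omit hP in
theorem extra_faceSum_zero (x : O 0) : P.extra 0 (P.faceSum 0 1 0 1 x) = x := by
  rw [P.faceSum_succ 0 1 0, pow_zero, one_smul, extra_apply, P.tau_face_zero rfl]
  exact P.comp_face_succ_unit rfl le_rfl x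

/-- The extra codegeneracy contracts `b'`: it is inverse to face `0`, and passes the other faces
with a shift of index. -/
theorem extra_faceSum (n : ℕ) (x : O (n + 1)) :
    P.extra (n + 1) (P.faceSum (n + 1) (n + 2) 0 (n + 2) x) =
      x - P.faceSum n (n + 1) 0 (n + 1) (P.extra n x) := by
  rw [P.faceSum_apply, map_sum, ← Finset.range_eq_Ico, Finset.sum_range_succ', P.faceSum_apply,
    ← Finset.range_eq_Ico, pow_zero, one_smul, extra_apply, P.tau_face_zero rfl,
    P.comp_face_succ_unit rfl le_rfl x, sub_eq_neg_add, ← Finset.sum_neg_distrib]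
  congr 1
  refine Finset.sum_congr rfl fun t ht => ?_
  rw [Finset.mem_range] at ht
  rw [map_smul, extra_apply, extra_apply, hP.tau_face_succ rfl (by omega),
    P.face_comp_of_lt (p' := n + 2) _ _ (by omega) rfl rfl le_rfl ht, pow_succ]
  module

/-- `b N s (1 - λ) = N b' s (1 - λ)`, while `N s (1 - λ) b = N s b' (1 - λ) = N (1 - b' s)(1 - λ)`,
and `N (1 - λ) = 0`. -/
theorem diff_connes (hc : P.IsCyclic) (n : ℕ) (x : O (n + 1)) :
    P.diff n (n + 1) (P.connes n x) = -P.connes (n + 1) (P.diff (n + 1) (n + 2) x) := by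
  rw [connes_apply, ← hP.norm_faceSum hc, connes_apply, hP.lam_diff, hP.extra_faceSum,
    map_sub (P.norm (n + 1)), hc.norm_sub, zero_sub, neg_neg]

theorem connes_diff_zero (hc : P.IsCyclic) (x : O 0) : P.connes 0 (P.diff 0 1 x) = 0 := by
  rw [connes_apply, hP.lam_diff, extra_faceSum_zero, hc.norm_sub]

theorem connes_mem_boundaries (hc : P.IsCyclic) (n : ℕ) {x : O (n + 1)}
    (hx : x ∈ P.boundaries (n + 1)) : P.connes n x ∈ P.boundaries n := by
  obtain ⟨y, rfl⟩ := hx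
  cases n with
  | zero => rw [hP.connes_diff_zero hc]; exact Submodule.zero_mem _
  | succ n =>
    rw [← neg_neg (P.connes _ _), ← hP.diff_connes hc, ← map_neg]
    exact P.diff_mem_boundaries rfl _

/-- Connes' operator on cochains annihilated by the last codegeneracy. -/
theorem connes_of_normalized (n : ℕ) {f : O (n + 1)} (hf : P.comp (n + 1) 0 n 1 f P.unit = 0) :
    (-1 : k) ^ n • P.connes n f = ∑ i ∈ Finset.range (n + 1), (-1 : k) ^ (n * i) •
      P.comp (n + 1) 0 n (i + 1) ((P.tau (n + 1))^[n + 1 - i] f) P.unit := by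
  -- `s λ f` is, up to sign, `σₙ τ² f = τ σ₀ f`, which vanishes; so only `N s f` remains of Connes'
  -- operator.
  have h₀ : P.extra n (P.lam (n + 1) f) = 0 := by
    rw [lam_apply, map_smul, extra_apply, ← hP.tau_comp_unit, hf, map_zero, smul_zero]
  have h₁ : ∀ j ≤ n, (P.tau n)^[j] (P.extra n f) =
      P.comp (n + 1) 0 n (n + 1 - j) ((P.tau (n + 1))^[j + 1] f) P.unit := by
    intro j hj
    induction j with
    | zero => rfl
    | succ j ih =>
      rw [Function.iterate_succ_apply', ih (by omega), Function.iterate_succ_apply' (n := j + 1),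
        P.tau_comp _ _ _ _ _ _ (by omega) (by omega) (by omega)]
      rfl
  rw [connes_apply, map_sub, h₀, sub_zero, norm_apply, Finset.smul_sum, ← Finset.sum_range_reflect]
  refine Finset.sum_congr rfl fun i hi => ?_
  rw [Finset.mem_range] at hi
  rw [lam_pow_apply, h₁ _ (by omega), smul_smul, ← pow_add,
    show n + 1 - (n + 1 - 1 - i) = i + 1 by omega, show n + 1 - 1 - i + 1 = n + 1 - i by omega]
  congr 1
  obtain ⟨m, rfl⟩ : ∃ m, n = i + m := ⟨n - i, by omega⟩
  have he := Nat.even_mul_succ_self (i + m)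
  rw [show i + m + 1 - 1 - i = m by omega]
  obtain ⟨c, hc⟩ := he
  exact sgn_congr c (by nlinarith)

end IsUnital

end ParaCyclicOperadWithMultiplication
end AbstractOperad

/-! ### Insertions into rotated cochains, and the homotopy behind the bracket formula. -/

section AbstractOperad

variable {k : Type u} [CommRing k] {O : ℕ → Type v} [∀ n, AddCommGroup (O n)] [∀ n, Module k (O n)]

namespace ParaCyclicOperadWithMultiplication

variable (P : ParaCyclicOperadWithMultiplication k O)

/-- The signed sum of all ways to insert `g` into the rotations of `f`. -/
def rot {p q : ℕ} (n : ℕ) (f : O p) (g : O q) : O n :=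
  ∑ i ∈ Finset.range p, (-1 : k) ^ ((q + 1) * i + p * (i + 1)) •
    P.comp p q n (i + 1) ((P.tau p)^[p - i] f) g

variable {P}

namespace IsUnital

variable (hP : P.IsUnital)
include hP

omit hP in
-- The first rotation exchanges the roles of the two factors and the later ones slide the inserted
-- cochain through the slots of `g`. After `q` rotations it sits in slot `1`, and the next rotation
-- exchanges the roles again; this is the case of `tau_pow_cup_of_gt`.
theorem tau_pow_cup_of_le {p q m j : ℕ} (f : O p) (g : O q) (hm : p + q = m) (hj : 1 ≤ j) (hjq : j ≤ q) :
    (P.tau m)^[j] (P.cup p q m f g) =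
      P.comp q (p + 1) m (q + 1 - j) ((P.tau q)^[j] g) (P.face p (p + 1) (p + 1) f) := by
  induction j, hj using Nat.le_induction with
  | base =>
    rw [Function.iterate_one, Function.iterate_one, P.cup_apply,
      P.tau_comp_one _ _ _ _ _ (by omega) (by omega) hjq, P.tau_face_zero rfl, Nat.add_sub_cancel]
  | succ j hj ih =>
    rw [Function.iterate_succ_apply', ih (by omega), Function.iterate_succ_apply',
      P.tau_comp _ _ _ _ _ _ (by omega) (by omega) (by omega)]
    rfl

theorem tau_pow_cup_of_gt {p q m j : ℕ} (f : O p) (g : O q) (hm : p + q = m)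
    (hg : (P.tau q)^[q + 1] g = g) (hj : 1 ≤ j) (hjp : j ≤ p) :
    (P.tau m)^[q + j] (P.cup p q m f g) =
      P.comp p (q + 1) m (p + 1 - j) ((P.tau p)^[j] f) (P.face q (q + 1) 0 g) := by
  induction j, hj using Nat.le_induction with
  | base =>
    rw [Function.iterate_succ_apply', Function.iterate_one, Nat.add_sub_cancel]
    rcases Nat.eq_zero_or_pos q with rfl | hq
    · rw [Function.iterate_zero, id_eq, P.cup_eq_comp_last hm,
        P.tau_comp_one _ _ _ _ _ (by omega) (by omega) hjp, hP.tau_face_succ rfl le_rfl]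
      rw [zero_add, Function.iterate_one] at hg
      rw [hg]
    · rw [tau_pow_cup_of_le f g hm hq le_rfl, Nat.add_sub_cancel_left,
        P.tau_comp_one _ _ _ _ _ (by omega) (by omega) (by omega), hP.tau_face_succ rfl le_rfl,
        ← Function.iterate_succ_apply' (P.tau q), hg,
        P.comp_face_zero _ _ rfl rfl (by omega) hjp le_rfl]
  | succ j hj ih =>
    rw [← Nat.add_assoc, Function.iterate_succ_apply', ih (by omega), Function.iterate_succ_apply',
      P.tau_comp _ _ _ _ _ _ (by omega) (by omega) (by omega)]
    rfl

/-- Each rotation of `f ⌣ g` is one factor, multiplied by a free argument, inserted into a rotation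
of the other. Setting this argument to the unit removes the multiplication. -/
theorem rot_cup (hc : P.IsCyclic) {p q m n : ℕ} (f : O p) (g : O q) (hm : p + q = m) (hn : m = n + 1) :
    P.rot n (P.cup p q m f g) P.unit =
      (-1 : k) ^ q • P.rot n f g - (-1 : k) ^ (p * q + p + 1) • P.rot n g f := by
  rw [rot, rot, rot, ← hm, Finset.sum_range_add, hm, Finset.smul_sum, Finset.smul_sum, sub_eq_add_neg,
    ← Finset.sum_neg_distrib]
  refine congrArg₂ (· + ·) (Finset.sum_congr rfl fun i hi => ?_) (Finset.sum_congr rfl fun i hi => ?_)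
  · rw [Finset.mem_range] at hi
    have h : P.comp (q + 1) 0 q 1 (P.face q (q + 1) 0 g) P.unit = g := P.cup_unit q g
    rw [show m - i = q + (p - i) by omega, hP.tau_pow_cup_of_gt f g hm (hc q g) (by omega) (by omega),
      show p + 1 - (p - i) = i + 1 by omega,
      P.comp_comp_middle (t := q) (l := 1) _ _ _, h, ← hm]
    match_scalars
    ring
  · rw [Finset.mem_range] at hi
    rw [show m - (p + i) = q - i by omega, tau_pow_cup_of_le f g hm (by omega) (by omega),
      show q + 1 - (q - i) = i + 1 by omega,
      P.comp_comp_middle (t := p) (l := p + 1) _ _ _, P.comp_face_succ_unit rfl le_rfl, ← hm]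
    match_scalars
    have hsq : (-1 : k) ^ (p ^ 2) = (-1) ^ p := by
      rw [sq, pow_mul]
      rcases neg_one_pow_eq_or k p with h | h <;> simp [h]
    ring_nf
    simp only [neg_one_pow_mul_two, hsq]
    ring

/-- The homotopy that relates insertions and rotated insertions into a cocycle. -/
theorem circ_rot_mem_boundaries (hc : P.IsCyclic) {p q n : ℕ} (f : O p) (g : O q)
    (hf : P.diff p (p + 1) f = 0) (hg : P.diff q (q + 1) g = 0) (hn : p + q = n + 1) :
    P.circ p q n f g - P.rot n f g + (-1 : k) ^ (q * p + q) • P.cup q (p - 1) n g (P.rot (p - 1) f P.unit)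
      ∈ P.boundaries n := by
  -- The homotopy is the sum over `j < i` of the insertions of `g` and of the unit into `τ^(p - j)
  -- f`. The first family has `τ^(p + 1 - j)` in place of `τ^(p - j)`, because its shift raises `j`
  -- by one. At a fixed position the three families cancel by `faceSum_tau_pow`.
  let E : ℕ → ℕ → O (p + 1) → O n := fun i j x =>
    P.comp (p + q) 0 n (j + 1) (P.comp (p + 1) q (p + q) (i + 1) x g) P.unit
  let F₁ : ℕ → ℕ → O n := fun i j => (-1 : k) ^ ((q + 1) * i + j + p * j) •
    E i j (P.faceSum p (p + 1) 0 (j + 1) ((P.tau p)^[p + 1 - j] f))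
  let F₂ : ℕ → ℕ → O n := fun i j => (-1 : k) ^ ((q + 1) * i + j + p * (j + 1)) •
    E i j (P.faceSum p (p + 1) (j + 1) (i + 1) ((P.tau p)^[p - j] f))
  let F₃ : ℕ → ℕ → O n := fun i j => (-1 : k) ^ ((q + 1) * i + j + p * (j + 1)) •
    E i j (P.faceSum p (p + 1) (i + 1) (p + 2) ((P.tau p)^[p - j] f))
  have key := sum_triangle_shift p F₁ F₂ F₃
  have hfull : ∑ i ∈ Finset.range (p + 1), ∑ j ∈ Finset.range i, (F₁ i j + F₂ i j + F₃ i j) = 0 := by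
    refine Finset.sum_eq_zero fun i hi => Finset.sum_eq_zero fun j hj => ?_
    rw [Finset.mem_range] at hi hj
    simp only [F₁, F₂, F₃, E]
    rw [add_assoc, ← smul_add, ← LinearMap.add_apply, ← map_add, ← LinearMap.add_apply, ← map_add,
      P.faceSum_add (by omega) (by omega), hP.faceSum_tau_pow (by omega) f hf]
    simp only [map_neg, map_smul, LinearMap.neg_apply, LinearMap.smul_apply]
    match_scalars
    ring_nf
    simp only [neg_one_pow_mul_two]
    ring
  have h₁ : ∑ i ∈ Finset.range p, F₁ (i + 1) 0 = (-1 : k) ^ (q + 1) • P.circ p q n f g := by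
    rw [P.circ_apply, Finset.smul_sum]
    refine Finset.sum_congr rfl fun i hi => ?_
    rw [Finset.mem_range] at hi
    have h : P.comp (p + q) 0 n 1 (P.face n (p + q) 0 (P.comp p q n (i + 1) f g)) P.unit =
        P.comp p q n (i + 1) f g := P.comp_face_unit hn (Nat.zero_le _) _
    rw [P.face_comp_of_lt f g (p' := p + 1) (by omega) rfl (by omega) (by omega) (by omega)] at h
    simp only [F₁, E, zero_add, Nat.sub_zero]
    -- On the edge `j = 0` the rotation is complete, so cyclicity returns `f` itself.
    rw [hc p f, P.faceSum_succ p (p + 1) 0, pow_zero, one_smul, h]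
    match_scalars
    ring
  have h₂ : ∑ i ∈ Finset.range p, F₂ (i + 1) i = (-1 : k) ^ q • P.rot n f g := by
    rw [rot, Finset.smul_sum]
    refine Finset.sum_congr rfl fun i hi => ?_
    rw [Finset.mem_range] at hi
    have h : P.comp (q + 1) 0 q 1 (P.face q (q + 1) 0 g) P.unit = g := P.cup_unit q g
    simp only [F₂, E, P.faceSum_succ, map_smul, LinearMap.smul_apply]
    rw [← P.comp_face_zero (q' := q + 1) _ _ rfl rfl (by omega) (by omega) (by omega),
      P.comp_comp_middle (t := q) (l := 1) _ _ _, h]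
    match_scalars
    ring_nf
    simp only [neg_one_pow_mul_three]
  have h₃ : ∑ j ∈ Finset.range p, F₃ p j =
      - (-1 : k) ^ (q * p) • P.cup q (p - 1) n g (P.rot (p - 1) f P.unit) := by
    rw [rot, map_sum, Finset.smul_sum]
    refine Finset.sum_congr rfl fun i hi => ?_
    rw [Finset.mem_range] at hi
    simp only [F₃, E, P.faceSum_succ, map_smul, LinearMap.smul_apply]
    rw [← P.cup_eq_comp_last (by omega), P.comp_cup_right (t := p - 1) g _ _ (by omega) (by omega)
      (by omega) (by omega) (by omega)]
    match_scalars
    ring_nf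
    simp only [neg_one_pow_mul_three]
  rw [hfull, h₁, h₂, h₃] at key
  have hmem : ∑ i ∈ Finset.range p, ∑ j ∈ Finset.range i, (F₁ (i + 1) (j + 1) + F₂ (i + 1) j + F₃ i j) ∈
        P.boundaries n := by
    refine Submodule.sum_mem _ fun i hi => Submodule.sum_mem _ fun j hj => ?_
    rw [Finset.mem_range] at hi hj
    obtain ⟨n, rfl⟩ : ∃ m, n = m + 1 := ⟨n - 1, by omega⟩
    convert Submodule.smul_mem _ ((-1 : k) ^ ((q + 1) * i + j + p * (j + 1) + q))
      (P.diff_mem_boundaries rfl (P.comp (p + q - 1) 0 n (j + 1)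
        (P.comp p q (p + q - 1) (i + 1) ((P.tau p)^[p - j] f) g) P.unit)) using 1
    rw [P.diff_comp_comp (m' := p + q) _ g P.unit (by omega) (by omega) rfl rfl rfl (by omega) rfl
      (by omega) (by omega) (by omega), hg, P.diff_unit]
    simp only [F₁, F₂, F₃, E, map_zero, LinearMap.zero_apply, smul_zero, add_zero, sub_zero,
      Nat.add_sub_add_right]
    match_scalars <;> ring_nf <;> simp only [neg_one_pow_mul_two] <;> ring
  rw [key] at hmem
  convert Submodule.smul_mem _ ((-1 : k) ^ q) hmem using 1
  match_scalars <;> ring_nf <;> simp only [neg_one_pow_mul_two]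

end IsUnital

end ParaCyclicOperadWithMultiplication
end AbstractOperad

/-! ### Normalized cocycles and compatibility of the operations with coboundaries. -/

section AbstractOperad

variable {k : Type u} [CommRing k] {O : ℕ → Type v} [∀ n, AddCommGroup (O n)] [∀ n, Module k (O n)]

namespace OperadWithMultiplication

variable (P : OperadWithMultiplication k O)

/-- `σ₀` is inverse to both face `0` and face `1`, whose signs are opposite; it commutes with the
other faces up to a shift of index, which reverses their signs. -/
theorem diff_comp_unit {n : ℕ} (x : O (n + 1)) :
    P.comp (n + 2) 0 (n + 1) 1 (P.diff (n + 1) (n + 2) x) P.unit =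
      P.face n (n + 1) 0 (P.comp (n + 1) 0 n 1 x P.unit) -
        P.diff n (n + 1) (P.comp (n + 1) 0 n 1 x P.unit) := by
  have h₁ := P.faceSum_comp (a := 1) (p' := n + 2) (q' := 1) (r' := n + 1) (j := 1) (r := n) x P.unit
    rfl rfl rfl rfl le_rfl (by omega) le_rfl
  have h₂ : P.comp (n + 2) 0 (n + 1) 2 (P.face (n + 1) (n + 2) 1 x) P.unit = x :=
    P.comp_face_unit rfl (by omega) x
  have h₃ : P.comp (n + 2) 0 (n + 1) 1 (P.face (n + 1) (n + 2) 0 x) P.unit = x :=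
    P.comp_face_unit rfl (by omega) x
  rw [P.faceSum_succ, P.diff_unit, pow_one, map_smul, LinearMap.smul_apply, h₂, map_zero, smul_zero,
    pow_zero, one_smul] at h₁
  rw [show P.diff (n + 1) (n + 2) x = P.faceSum (n + 1) (n + 2) 0 (n + 3) x from rfl,
    show P.diff n (n + 1) (P.comp (n + 1) 0 n 1 x P.unit) =
      P.faceSum n (n + 1) 0 (n + 2) (P.comp (n + 1) 0 n 1 x P.unit) from rfl,
    ← P.faceSum_add (b := 1) (c := n + 3) zero_le_one (by omega),
    ← P.faceSum_add (b := 1) (c := n + 2) zero_le_one (by omega), h₁, map_add, LinearMap.add_apply,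
    P.faceSum_succ _ _ 0, P.faceSum_succ _ _ 0, pow_zero, one_smul, one_smul, h₃]
  module

/-- Every cocycle is cohomologous to one that is annihilated by the first codegeneracy. -/
theorem exists_normalized {n : ℕ} (f : O n) (hf : P.diff n (n + 1) f = 0) :
    ∃ g : O n, P.diff n (n + 1) g = 0 ∧ f - g ∈ P.boundaries n ∧
      P.comp n 0 (n - 1) 1 g P.unit = 0 := by
  cases n with
  | zero => exact ⟨f, hf, by simp, P.comp_eq_zero_apply (by omega) _ _⟩
  | succ n =>
    have h := P.diff_comp_unit f
    rw [hf, map_zero, LinearMap.zero_apply] at h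
    refine ⟨f - P.diff n (n + 1) (P.comp (n + 1) 0 n 1 f P.unit), ?_, ?_, ?_⟩
    · rw [map_sub, hf, P.diff_diff _ rfl rfl, sub_zero]
    · rw [sub_sub_cancel]
      exact P.diff_mem_boundaries rfl _
    -- For a cocycle the previous lemma reads `diff (σ₀ f) = δ₀ σ₀ f`, and `σ₀ δ₀ = id`.
    · rw [← sub_eq_zero.1 h.symm, map_sub, LinearMap.sub_apply, Nat.add_sub_cancel,
        P.comp_face_unit rfl (Nat.zero_le _), sub_self]

theorem diff_cup_eq_zero {p q n : ℕ} {f : O p} {g : O q} (hf : P.diff p (p + 1) f = 0)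
    (hg : P.diff q (q + 1) g = 0) : P.diff n (n + 1) (P.cup p q n f g) = 0 := by
  by_cases hn : p + q = n
  · rw [P.diff_cup f g hn rfl rfl rfl, hf, hg]
    simp
  · rw [P.cup_eq_zero hn]
    simp

theorem cup_mem_boundaries_left {p q n : ℕ} {f : O p} {g : O q} (hf : f ∈ P.boundaries p)
    (hg : P.diff q (q + 1) g = 0) : P.cup p q n f g ∈ P.boundaries n := by
  by_cases hn : p + q = n
  · cases p with
    | zero => rw [(Submodule.mem_bot k).1 hf, map_zero]; exact Submodule.zero_mem _
    | succ p =>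
      obtain ⟨x, rfl⟩ := hf
      have h := P.diff_cup (n := p + q) x g rfl rfl rfl (n' := n) (by omega)
      rw [hg, map_zero, add_zero] at h
      have h' := Submodule.smul_mem _ ((-1 : k) ^ q) (P.diff_mem_boundaries
        (show n = p + q + 1 by omega) (P.cup p q (p + q) x g))
      rwa [h, smul_smul, ← pow_add, ← mul_two, neg_one_pow_mul_two, one_smul] at h'
  · rw [P.cup_eq_zero hn]
    exact Submodule.zero_mem _

theorem cup_mem_boundaries_right {p q n : ℕ} {f : O p} {g : O q} (hf : P.diff p (p + 1) f = 0)
    (hg : g ∈ P.boundaries q) : P.cup p q n f g ∈ P.boundaries n := by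
  have h := P.cup_comm_mem_boundaries (n := n) f g hf
    (P.diff_eq_zero_of_mem_boundaries rfl hg)
  exact (Submodule.sub_mem_iff_left _
    (Submodule.smul_mem _ _ (P.cup_mem_boundaries_left hg hf))).1 h

/-- The cup product terms of `diff_circ` for `(f, g)` and for `(g, f)` cancel in the bracket. -/
theorem diff_bracket {p q n p' q' n' : ℕ} (f : O p) (g : O q) (hn : p + q = n + 1) (hp' : p' = p + 1)
    (hq' : q' = q + 1) (hn' : n' = n + 1) :
    P.diff n n' (P.bracket p q n f g) =
      (-1 : k) ^ (q + 1) • P.bracket p' q n' (P.diff p p' f) g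
        + P.bracket p q' n' f (P.diff q q' g) := by
  simp only [P.bracket_apply, map_sub, map_smul]
  rw [P.diff_circ f g hn hp' hq' hn', P.diff_circ g f (by omega) hq' hp' hn']
  subst hp' hq'
  match_scalars <;> ring_nf <;> simp only [neg_one_pow_mul_two, neg_one_pow_mul_three] <;> ring

theorem diff_bracket_eq_zero {p q n : ℕ} {f : O p} {g : O q} (hf : P.diff p (p + 1) f = 0)
    (hg : P.diff q (q + 1) g = 0) : P.diff n (n + 1) (P.bracket p q n f g) = 0 := by
  by_cases hn : p + q = n + 1
  · rw [P.diff_bracket f g hn rfl rfl rfl, hf, hg]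
    simp
  · rw [P.bracket_eq_zero hn]
    simp

theorem circ_diff_zero (x f : O 0) :
    P.circ 1 0 0 (P.diff 0 1 x) f = P.cup 0 0 0 x f - P.cup 0 0 0 f x := by
  rw [P.circ_apply, show P.diff 0 1 x = P.faceSum 0 1 0 2 x from rfl, P.faceSum_apply,
    Nat.Ico_zero_eq_range, Finset.sum_range_one, Finset.sum_range_succ, Finset.sum_range_one,
    P.cup_eq_comp_last rfl f x, P.cup_apply]
  simp [sub_eq_add_neg]

theorem bracket_mem_boundaries_right {p q n : ℕ} {f : O p} {g : O q} (hf : P.diff p (p + 1) f = 0)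
    (hg : g ∈ P.boundaries q) : P.bracket p q n f g ∈ P.boundaries n := by
  by_cases hn : p + q = n + 1
  · cases q with
    | zero => rw [(Submodule.mem_bot k).1 hg, map_zero]; exact Submodule.zero_mem _
    | succ q =>
      obtain ⟨x, rfl⟩ := hg
      -- For `p = q = 0` the primitive `bracket f x` would have degree `-1`. The bracket is then a
      -- commutator in degree `0`, which vanishes because `f` is a cocycle.
      by_cases h0 : p + q = 0
      · obtain ⟨rfl, rfl⟩ : p = 0 ∧ q = 0 := by omega
        obtain rfl : n = 0 := by omega
        have h := P.circ_diff_zero f x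
        rw [zero_add] at hf
        rw [hf, map_zero, LinearMap.zero_apply] at h
        have h' : P.circ 1 0 0 (P.diff 0 1 x) f = 0 := by
          rw [P.circ_diff_zero, ← neg_sub, ← h, neg_zero]
        have h'' : P.bracket 0 1 0 f (P.diff 0 1 x) = 0 := by
          rw [P.bracket_apply, h', smul_zero, sub_zero, P.circ_apply, Finset.sum_range_zero]
        exact h'' ▸ Submodule.zero_mem _
      · have h := P.diff_bracket (n := p + q - 1) f x (by omega) rfl rfl (n' := n) (by omega)
        rw [hf, map_zero, LinearMap.zero_apply, smul_zero, zero_add] at h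
        rw [← h]
        exact P.diff_mem_boundaries (by omega) _
  · rw [P.bracket_eq_zero hn]
    exact Submodule.zero_mem _

theorem bracket_mem_boundaries_left {p q n : ℕ} {f : O p} {g : O q} (hf : f ∈ P.boundaries p)
    (hg : P.diff q (q + 1) g = 0) : P.bracket p q n f g ∈ P.boundaries n := by
  rw [P.bracket_antisymm]
  exact Submodule.neg_mem _ (Submodule.smul_mem _ _ (P.bracket_mem_boundaries_right hg hf))

/-- One half of the bracket is a derivation on the nose by `circ_cup_left`; the other half is one
only up to the brace homotopy. -/
theorem bracket_cup_mem_boundaries {p q r n : ℕ} (x : O p) (f : O q) (g : O r)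
    (hx : P.diff p (p + 1) x = 0) (hf : P.diff q (q + 1) f = 0) (hg : P.diff r (r + 1) g = 0)
    (hn : p + q + r = n + 1) :
    P.bracket p (q + r) n x (P.cup q r (q + r) f g) -
      (P.cup (p + q - 1) r n (P.bracket p q (p + q - 1) x f) g +
        (-1 : k) ^ ((p + 1) * q) • P.cup q (p + r - 1) n f (P.bracket p r (p + r - 1) x g)) ∈
      P.boundaries n := by
  convert P.circ_cup_mem_boundaries x f g hx hf hg hn rfl rfl rfl using 1
  simp only [P.bracket_apply, map_sub, LinearMap.sub_apply, map_smul, LinearMap.smul_apply]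
  rw [P.circ_cup_left (t := p + r - 1) (v := p + q - 1) f g x rfl (by omega) (by omega) (by omega)]
  match_scalars <;> ring_nf <;> simp only [neg_one_pow_mul_two, neg_one_pow_mul_three] <;> ring

end OperadWithMultiplication

namespace ParaCyclicOperadWithMultiplication

variable (P : ParaCyclicOperadWithMultiplication k O)

/-- Connes' operator; it is zero unless `p = n + 1`. -/
def connesB (p n : ℕ) : O p →ₗ[k] O n :=
  (-1 : k) ^ n • (P.norm n ∘ₗ ((P.comp p 0 n (n + 1)).flip P.unit ∘ₗ P.tau p) ∘ₗ
    (LinearMap.id - P.lam p))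

theorem connesB_succ (n : ℕ) (x : O (n + 1)) : P.connesB (n + 1) n x = (-1 : k) ^ n • P.connes n x := rfl

theorem connesB_eq_zero {p n : ℕ} (h : p ≠ n + 1) : P.connesB p n = 0 := by
  ext x
  simp [connesB, P.comp_eq_zero p 0 n (n + 1) (by omega)]

variable {P}

namespace IsUnital

variable (hP : P.IsUnital) (hc : P.IsCyclic)
include hP

theorem diff_connesB (hc : P.IsCyclic) {p n : ℕ} {f : O p} (hf : P.diff p (p + 1) f = 0) :
    P.diff n (n + 1) (P.connesB p n f) = 0 := by
  by_cases h : p = n + 1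
  · subst h
    rw [connesB_succ, map_smul, hP.diff_connes hc, hf]
    simp
  · simp [connesB_eq_zero P h]

theorem connesB_mem_boundaries (hc : P.IsCyclic) {p n : ℕ} {f : O p} (hf : f ∈ P.boundaries p) :
    P.connesB p n f ∈ P.boundaries n := by
  by_cases h : p = n + 1
  · subst h
    exact Submodule.smul_mem _ _ (hP.connes_mem_boundaries hc n hf)
  · rw [connesB_eq_zero P h]
    exact Submodule.zero_mem _

theorem connesB_of_normalized {p : ℕ} {f : O p} (hf : P.comp p 0 (p - 1) 1 f P.unit = 0) :
    P.connesB p (p - 1) f = (-1 : k) ^ p • P.rot (p - 1) f P.unit := by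
  cases p with
  | zero => rw [connesB_eq_zero P (by omega), rot, Finset.sum_range_zero]; simp
  | succ n =>
    rw [Nat.add_sub_cancel, connesB_succ, hP.connes_of_normalized n hf, rot, Finset.smul_sum]
    refine Finset.sum_congr rfl fun i _ => ?_
    match_scalars
    ring_nf
    simp only [neg_one_pow_mul_two, neg_one_pow_mul_three]
    ring

/-- On normalized cocycles, the bracket measures up to coboundaries the failure of Connes' operator
to be a derivation of the cup product. -/
theorem bracket_sub_mem_boundaries (hc : P.IsCyclic) {p q n : ℕ} (f : O p) (g : O q)
    (hf : P.diff p (p + 1) f = 0) (hg : P.diff q (q + 1) g = 0) (hn : p + q = n + 1)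
    (hf₁ : P.comp p 0 (p - 1) 1 f P.unit = 0) (hg₁ : P.comp q 0 (q - 1) 1 g P.unit = 0) :
    P.bracket p q n f g - (-1 : k) ^ p • (P.connesB (p + q) n (P.cup p q (p + q) f g)
      - P.cup (p - 1) q n (P.connesB p (p - 1) f) g
      - (-1 : k) ^ p • P.cup p (q - 1) n f (P.connesB q (q - 1) g)) ∈ P.boundaries n := by
  -- The last argument of `f ⌣ g` belongs to `g`, or to `f` if `q = 0`, so the product is normalized
  -- as well.
  have hfg : P.comp (p + q) 0 (p + q - 1) 1 (P.cup p q (p + q) f g) P.unit = 0 := by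
    rcases Nat.eq_zero_or_pos q with rfl | hq
    · have := P.comp_cup_left (s := p + 0) (n := p + 0 - 1) (t := p - 1) (j := 1) f g P.unit rfl
        (by omega) (by omega) le_rfl (by omega)
      exact this.trans (by rw [hf₁, map_zero, LinearMap.zero_apply])
    · rw [P.comp_cup_right (t := q - 1) f g P.unit rfl (by omega) (by omega) le_rfl hq, hg₁, map_zero]
  have hB := hP.connesB_of_normalized hfg
  rw [show p + q - 1 = n by omega, hP.rot_cup hc f g rfl hn] at hB
  have hBf := hP.diff_connesB (n := p - 1) hc hf
  have h₁ := hP.circ_rot_mem_boundaries hc f g hf hg hn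
  have h₂ := hP.circ_rot_mem_boundaries hc g f hg hf (n := n) (by omega)
  have h₃ := P.cup_comm_mem_boundaries (n := n) g _ hg hBf
  rw [hB, hP.connesB_of_normalized hg₁]
  rw [hP.connesB_of_normalized hf₁] at h₃ ⊢
  -- Antisymmetrizing the homotopy relation in `f` and `g` leaves `B f` to the right of `g`; graded
  -- commutativity, in the form `h₃`, moves it to the left.
  have h := Submodule.sub_mem _ (Submodule.sub_mem _ h₁ (Submodule.smul_mem _ ((-1 : k) ^ ((p + 1) * (q + 1))) h₂))
    (Submodule.smul_mem _ ((-1 : k) ^ (q * p + q + p)) h₃)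
  convert h using 1
  rw [P.bracket_apply]
  rcases Nat.eq_zero_or_pos p with rfl | hp
  · simp only [rot, Finset.sum_range_zero, smul_zero, map_zero, LinearMap.zero_apply, map_smul]
    match_scalars <;> ring_nf <;> simp only [neg_one_pow_mul_two, neg_one_pow_mul_three] <;> ring
  · obtain ⟨p, rfl⟩ : ∃ m, p = m + 1 := ⟨p - 1, by omega⟩
    simp only [map_smul, LinearMap.smul_apply, Nat.add_sub_cancel]
    match_scalars <;> ring_nf <;> simp only [neg_one_pow_mul_two, neg_one_pow_mul_three] <;> ring

end IsUnital

end ParaCyclicOperadWithMultiplication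

end AbstractOperad

/-! ### Descent of the operations to cohomology. -/

section AbstractOperad

variable {k : Type u} [CommRing k] {O : ℕ → Type v} [∀ n, AddCommGroup (O n)] [∀ n, Module k (O n)]
variable {H : ℕ → Type w} [∀ n, AddCommGroup (H n)] [∀ n, Module k (H n)]

namespace OperadWithMultiplication

variable (P : OperadWithMultiplication k O)

variable (H) in
/-- A realisation of the cohomology of an operad with multiplication. -/
structure CohomologyData where
  cl : ∀ n, LinearMap.ker (P.diff n (n + 1)) →ₗ[k] H n
  surjective : ∀ n, Function.Surjective (cl n)
  eq_zero_iff : ∀ n z, cl n z = 0 ↔ (z : O n) ∈ P.boundaries n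

namespace CohomologyData

variable {P}
variable (C : P.CohomologyData H)

/-- The cocycle `f` represents the class `x`. -/
def Rep {n : ℕ} (x : H n) (f : O n) : Prop :=
  ∃ h : f ∈ LinearMap.ker (P.diff n (n + 1)), C.cl n ⟨f, h⟩ = x

theorem exists_rep {n : ℕ} (x : H n) : ∃ f, C.Rep x f := by
  obtain ⟨z, rfl⟩ := C.surjective n x
  exact ⟨z, z.2, rfl⟩

variable {C}

theorem Rep.diff {n : ℕ} {x : H n} {f : O n} (h : C.Rep x f) : P.diff n (n + 1) f = 0 := h.1

theorem Rep.add {n : ℕ} {x y : H n} {f g : O n} (hx : C.Rep x f) (hy : C.Rep y g) :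
    C.Rep (x + y) (f + g) := by
  obtain ⟨h, rfl⟩ := hx
  obtain ⟨h', rfl⟩ := hy
  exact ⟨Submodule.add_mem _ h h', (C.cl n).map_add ⟨f, h⟩ ⟨g, h'⟩⟩

theorem Rep.smul {n : ℕ} {x : H n} {f : O n} (hx : C.Rep x f) (c : k) : C.Rep (c • x) (c • f) := by
  obtain ⟨h, rfl⟩ := hx
  exact ⟨Submodule.smul_mem _ c h, (C.cl n).map_smul c ⟨f, h⟩⟩

theorem Rep.neg {n : ℕ} {x : H n} {f : O n} (hx : C.Rep x f) : C.Rep (-x) (-f) := by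
  simpa using hx.smul (-1)

theorem Rep.sub {n : ℕ} {x y : H n} {f g : O n} (hx : C.Rep x f) (hy : C.Rep y g) :
    C.Rep (x - y) (f - g) := by
  rw [sub_eq_add_neg, sub_eq_add_neg]
  exact hx.add hy.neg

theorem Rep.zero_iff {n : ℕ} {x : H n} {f : O n} (hx : C.Rep x f) : x = 0 ↔ f ∈ P.boundaries n := by
  obtain ⟨h, rfl⟩ := hx
  exact C.eq_zero_iff n _

theorem Rep.eq_iff {n : ℕ} {x y : H n} {f g : O n} (hx : C.Rep x f) (hy : C.Rep y g) :
    x = y ↔ f - g ∈ P.boundaries n := by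
  rw [← (hx.sub hy).zero_iff, sub_eq_zero]

theorem Rep.unique {n : ℕ} {x y : H n} {f : O n} (hx : C.Rep x f) (hy : C.Rep y f) : x = y :=
  (hx.eq_iff hy).2 (by simp)

theorem Rep.congr {n : ℕ} {x : H n} {f g : O n} (hx : C.Rep x f) (h : f - g ∈ P.boundaries n) :
    C.Rep x g := by
  have hg : g ∈ LinearMap.ker (P.diff n (n + 1)) := by
    have := P.diff_eq_zero_of_mem_boundaries rfl h
    rw [map_sub, hx.diff, zero_sub, neg_eq_zero] at this
    exact this
  exact ⟨hg, ((hx.eq_iff ⟨hg, rfl⟩).2 h).symm⟩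

variable (C)

/-- The map is defined through chosen representatives. It has the asserted value on every
representative, and linearity follows because a cocycle represents only one class. -/
theorem exists_linearMap {p n : ℕ} (b : O p →ₗ[k] O n)
    (h₀ : ∀ f, P.diff p (p + 1) f = 0 → P.diff n (n + 1) (b f) = 0)
    (h₁ : ∀ f ∈ P.boundaries p, b f ∈ P.boundaries n) :
    ∃ β : H p →ₗ[k] H n, ∀ x f, C.Rep x f → C.Rep (β x) (b f) := by
  choose r hr using fun x : H p => C.exists_rep x
  have key : ∀ x f, C.Rep x f → C.Rep (C.cl n ⟨b (r x), h₀ _ (hr x).diff⟩) (b f) := by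
    intro x f hf
    refine Rep.congr ⟨_, rfl⟩ ?_
    rw [← map_sub]
    exact h₁ _ (((hr x).eq_iff hf).1 rfl)
  refine ⟨⟨⟨fun x => C.cl n ⟨b (r x), h₀ _ (hr x).diff⟩, fun x y => ?_⟩, fun c x => ?_⟩, key⟩
  · refine (key _ _ ((hr x).add (hr y))).unique ?_
    rw [map_add]
    exact Rep.add ⟨_, rfl⟩ ⟨_, rfl⟩
  · refine (key _ _ ((hr x).smul c)).unique ?_
    rw [map_smul]
    exact Rep.smul ⟨_, rfl⟩ c

theorem exists_bilinearMap {p q n : ℕ} (b : O p →ₗ[k] O q →ₗ[k] O n)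
    (h₀ : ∀ f g, P.diff p (p + 1) f = 0 → P.diff q (q + 1) g = 0 → P.diff n (n + 1) (b f g) = 0)
    (h₁ : ∀ f g, f ∈ P.boundaries p → P.diff q (q + 1) g = 0 → b f g ∈ P.boundaries n)
    (h₂ : ∀ f g, P.diff p (p + 1) f = 0 → g ∈ P.boundaries q → b f g ∈ P.boundaries n) :
    ∃ β : H p →ₗ[k] H q →ₗ[k] H n, ∀ x y f g, C.Rep x f → C.Rep y g → C.Rep (β x y) (b f g) := by
  choose r hr using fun x : H p => C.exists_rep x
  choose s hs using fun x : H q => C.exists_rep x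
  have key : ∀ x y f g, C.Rep x f → C.Rep y g →
      C.Rep (C.cl n ⟨b (r x) (s y), h₀ _ _ (hr x).diff (hs y).diff⟩) (b f g) := by
    intro x y f g hf hg
    refine Rep.congr ⟨_, rfl⟩ ?_
    have e₁ := h₁ _ _ (((hr x).eq_iff hf).1 rfl) hg.diff
    have e₂ := h₂ _ _ (hr x).diff (((hs y).eq_iff hg).1 rfl)
    convert Submodule.add_mem _ e₁ e₂ using 1
    rw [map_sub, map_sub, LinearMap.sub_apply]
    abel
  refine ⟨LinearMap.mk₂ k (fun x y => C.cl n ⟨b (r x) (s y), h₀ _ _ (hr x).diff (hs y).diff⟩)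
    (fun x x' y => ?_) (fun c x y => ?_) (fun x y y' => ?_) (fun c x y => ?_), key⟩
  · refine (key _ _ _ _ ((hr x).add (hr x')) (hs y)).unique ?_
    rw [map_add, LinearMap.add_apply]
    exact Rep.add ⟨_, rfl⟩ ⟨_, rfl⟩
  · refine (key _ _ _ _ ((hr x).smul c) (hs y)).unique ?_
    rw [map_smul, LinearMap.smul_apply]
    exact Rep.smul ⟨_, rfl⟩ c
  · refine (key _ _ _ _ (hr x) ((hs y).add (hs y'))).unique ?_
    rw [map_add]
    exact Rep.add ⟨_, rfl⟩ ⟨_, rfl⟩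
  · refine (key _ _ _ _ (hr x) ((hs y).smul c)).unique ?_
    rw [map_smul]
    exact Rep.smul ⟨_, rfl⟩ c

theorem exists_gerstenhaberAlgebra : ∃ S : GerstenhaberAlgebra k H, C.Rep S.one P.unit ∧
    (∀ p q n x y f g, C.Rep x f → C.Rep y g → C.Rep (S.cup p q n x y) (P.cup p q n f g)) ∧
    (∀ p q n x y f g, C.Rep x f → C.Rep y g → C.Rep (S.bracket p q n x y) (P.bracket p q n f g)) := by
  choose cup hcup using fun p q n => C.exists_bilinearMap (P.cup p q n)
    (fun f g hf hg => P.diff_cup_eq_zero hf hg) (fun f g hf hg => P.cup_mem_boundaries_left hf hg)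
    (fun f g hf hg => P.cup_mem_boundaries_right hf hg)
  choose br hbr using fun p q n => C.exists_bilinearMap (P.bracket p q n)
    (fun f g hf hg => P.diff_bracket_eq_zero hf hg)
    (fun f g hf hg => P.bracket_mem_boundaries_left hf hg)
    (fun f g hf hg => P.bracket_mem_boundaries_right hf hg)
  have hone : C.Rep (C.cl 0 ⟨P.unit, P.diff_unit⟩) P.unit := ⟨_, rfl⟩
  refine ⟨{
    cup := cup
    one := C.cl 0 ⟨P.unit, P.diff_unit⟩
    bracket := br
    cup_eq_zero := fun p q n h => ?_
    bracket_eq_zero := fun p q n h => ?_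
    cup_assoc := fun p q r n a b c h => ?_
    one_cup := fun p a => ?_
    cup_one := fun p a => ?_
    cup_comm := fun p q n a b => ?_
    bracket_antisymm := fun p q n a b => ?_
    jacobi := fun p q r n a b c h => ?_
    leibniz := fun p q r n c a b h => ?_ }, hone, hcup, hbr⟩
  · ext x y
    obtain ⟨f, hf⟩ := C.exists_rep x
    obtain ⟨g, hg⟩ := C.exists_rep y
    refine (hcup _ _ n _ _ _ _ hf hg).zero_iff.2 ?_
    rw [P.cup_eq_zero h]
    exact Submodule.zero_mem _
  · ext x y
    obtain ⟨f, hf⟩ := C.exists_rep x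
    obtain ⟨g, hg⟩ := C.exists_rep y
    refine (hbr _ _ n _ _ _ _ hf hg).zero_iff.2 ?_
    rw [P.bracket_eq_zero h]
    exact Submodule.zero_mem _
  · obtain ⟨f, hf⟩ := C.exists_rep a
    obtain ⟨g, hg⟩ := C.exists_rep b
    obtain ⟨e, he⟩ := C.exists_rep c
    refine (hcup _ _ _ _ _ _ _ (hcup _ _ _ _ _ _ _ hf hg) he).unique ?_
    rw [P.cup_assoc (t := q + r) f g e rfl rfl h]
    exact hcup _ _ _ _ _ _ _ hf (hcup _ _ _ _ _ _ _ hg he)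
  · obtain ⟨f, hf⟩ := C.exists_rep a
    have := hcup _ _ p _ _ _ _ hone hf
    rw [P.unit_cup] at this
    exact this.unique hf
  · obtain ⟨f, hf⟩ := C.exists_rep a
    have := hcup _ _ p _ _ _ _ hf hone
    rw [P.cup_unit] at this
    exact this.unique hf
  · obtain ⟨f, hf⟩ := C.exists_rep a
    obtain ⟨g, hg⟩ := C.exists_rep b
    exact ((hcup _ _ _ _ _ _ _ hf hg).eq_iff ((hcup _ _ _ _ _ _ _ hg hf).smul _)).2
      (P.cup_comm_mem_boundaries f g hf.diff hg.diff)
  · obtain ⟨f, hf⟩ := C.exists_rep a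
    obtain ⟨g, hg⟩ := C.exists_rep b
    refine (hbr _ _ _ _ _ _ _ hf hg).unique ?_
    rw [P.bracket_antisymm]
    exact ((hbr _ _ _ _ _ _ _ hg hf).smul _).neg
  · obtain ⟨f, hf⟩ := C.exists_rep a
    obtain ⟨g, hg⟩ := C.exists_rep b
    obtain ⟨e, he⟩ := C.exists_rep c
    refine (hbr _ _ _ _ _ _ _ hf (hbr _ _ _ _ _ _ _ hg he)).unique ?_
    rw [P.jacobi f g e h]
    exact (hbr _ _ _ _ _ _ _ (hbr _ _ _ _ _ _ _ hf hg) he).add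
      ((hbr _ _ _ _ _ _ _ hg (hbr _ _ _ _ _ _ _ hf he)).smul _)
  · obtain ⟨f, hf⟩ := C.exists_rep a
    obtain ⟨g, hg⟩ := C.exists_rep b
    obtain ⟨e, he⟩ := C.exists_rep c
    exact ((hbr _ _ _ _ _ _ _ he (hcup _ _ _ _ _ _ _ hf hg)).eq_iff
      ((hcup _ _ _ _ _ _ _ (hbr _ _ _ _ _ _ _ he hf) hg).add
        ((hcup _ _ _ _ _ _ _ hf (hbr _ _ _ _ _ _ _ he hg)).smul _))).2
      (P.bracket_cup_mem_boundaries e f g he.diff hf.diff hg.diff h)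

end CohomologyData

end OperadWithMultiplication

namespace ParaCyclicOperadWithMultiplication

variable {P : ParaCyclicOperadWithMultiplication k O}

theorem IsUnital.exists_batalinVilkoviskyAlgebra (hP : P.IsUnital) (hc : P.IsCyclic)
    (C : P.CohomologyData H) : ∃ S : BatalinVilkoviskyAlgebra k H, C.Rep S.one P.unit ∧
    (∀ p q n x y f g, C.Rep x f → C.Rep y g → C.Rep (S.cup p q n x y) (P.cup p q n f g)) ∧
    (∀ p q n x y f g, C.Rep x f → C.Rep y g →
      C.Rep (S.bracket p q n x y) (P.bracket p q n f g)) ∧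
    (∀ p n x f, C.Rep x f → C.Rep (S.B p n x) (P.connesB p n f)) := by
  obtain ⟨S, hone, hcup, hbr⟩ := C.exists_gerstenhaberAlgebra
  choose B hB using fun p n => C.exists_linearMap (P.connesB p n)
    (fun f hf => hP.diff_connesB hc hf) (fun f hf => hP.connesB_mem_boundaries hc hf)
  refine ⟨{ S with
    B := B
    B_eq_zero := fun p n h => ?_
    B_B := fun n a => ?_
    bracket_eq := fun p q n a b h => ?_ }, hone, hcup, hbr, hB⟩
  · ext x
    obtain ⟨f, hf⟩ := C.exists_rep x
    refine (hB _ _ _ _ hf).zero_iff.2 ?_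
    rw [P.connesB_eq_zero h]
    exact Submodule.zero_mem _
  · obtain ⟨f, hf⟩ := C.exists_rep a
    refine (hB _ _ _ _ (hB _ _ _ _ hf)).zero_iff.2 ?_
    rw [connesB_succ, connesB_succ, map_smul, hc.connes_connes, smul_zero, smul_zero]
    exact Submodule.zero_mem _
  -- The homotopy needs normalized cocycles, and a class may be represented by such a cocycle.
  · have hnorm : ∀ {m : ℕ} (x : H m), ∃ f, C.Rep x f ∧ P.comp m 0 (m - 1) 1 f P.unit = 0 := by
      intro m x
      obtain ⟨f, hf⟩ := C.exists_rep x
      obtain ⟨g, -, h₁, h₂⟩ := P.exists_normalized f hf.diff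
      exact ⟨g, hf.congr h₁, h₂⟩
    obtain ⟨f, hf, hf₁⟩ := hnorm a
    obtain ⟨g, hg, hg₁⟩ := hnorm b
    exact ((hbr _ _ _ _ _ _ _ hf hg).eq_iff ((((hB _ _ _ _ (hcup _ _ _ _ _ _ _ hf hg)).sub
      (hcup _ _ _ _ _ _ _ (hB _ _ _ _ hf) hg)).sub
      ((hcup _ _ _ _ _ _ _ hf (hB _ _ _ _ hg)).smul _)).smul _)).2
      (hP.bracket_sub_mem_boundaries hc f g hf.diff hg.diff h hf₁ hg₁)

end ParaCyclicOperadWithMultiplication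

end AbstractOperad

/-! ### The endomorphism operad of `A` and the cyclic operator of a contraaction. -/

section HochschildOperad

variable {k : Type u} {A : Type v} [CommRing k] [Ring A] [Algebra k A]

namespace HochschildCochain

/-- Separates the dependence on the inserted cochain: `g'` only fills an entry that is then
overwritten. Linearity of composition in `g` thus reduces to linearity of the outer cochain in one
argument. -/
theorem insertArg_eq_update {p q r : ℕ} (h : p + q = r + 1) (m : Fin p) (g g' : HochschildCochain k A q)
    (a : Fin r → A) : insertArg h m g a =
      Function.update (insertArg h m g' a) m (g (fun s => a ⟨m + s, by omega⟩)) := by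
  funext t
  simp only [insertArg, Function.update_apply, Fin.ext_iff]
  split_ifs <;> first | rfl | omega

theorem snoc_eq_dite {n : ℕ} (a : Fin n → A) (x : A) (t : Fin (n + 1)) :
    (Fin.snoc a x : Fin (n + 1) → A) t = if h : (t : ℕ) < n then a ⟨t, h⟩ else x := rfl

/-- The partial compositions as bilinear maps, zero outside of their range. -/
def compHom (p q r i : ℕ) :
    HochschildCochain k A p →ₗ[k] HochschildCochain k A q →ₗ[k] HochschildCochain k A r :=
  if h : p + q = r + 1 ∧ 1 ≤ i ∧ i ≤ p then
    LinearMap.mk₂ k (fun f g => comp h.1 ⟨i - 1, by omega⟩ f g)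
      (fun _ _ _ => rfl) (fun _ _ _ => rfl)
      (fun f g g' => by
        ext a
        rw [add_apply, comp_apply, comp_apply, comp_apply,
          insertArg_eq_update _ _ (g + g') g, insertArg_eq_update _ _ g' g, add_apply,
          f.map_update_add, ← insertArg_eq_update, ← insertArg_eq_update])
      (fun c f g => by
        ext a
        rw [smul_apply, comp_apply, comp_apply,
          insertArg_eq_update _ _ (c • g) g, smul_apply,
          f.map_update_smul, ← insertArg_eq_update])
  else 0

theorem compHom_eq {p q r : ℕ} (h : p + q = r + 1) (i : Fin p) (f : HochschildCochain k A p)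
    (g : HochschildCochain k A q) : compHom p q r (i + 1) f g = comp h i f g := by
  rw [compHom, dif_pos ⟨h, by omega, by omega⟩]
  rfl

theorem compHom_apply {p q r i : ℕ} (h : p + q = r + 1 ∧ 1 ≤ i ∧ i ≤ p) (f : HochschildCochain k A p)
    (g : HochschildCochain k A q) (a : Fin r → A) :
    compHom p q r i f g a = f (insertArg h.1 ⟨p - i, by omega⟩ g a) := by
  obtain ⟨i, rfl⟩ : ∃ m, i = m + 1 := ⟨i - 1, by omega⟩
  rw [compHom_eq h.1 ⟨i, by omega⟩, comp_apply]
  rfl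

theorem compHom_eq_zero {p q r i : ℕ} (h : ¬ (p + q = r + 1 ∧ 1 ≤ i ∧ i ≤ p)) :
    (compHom p q r i : HochschildCochain k A p →ₗ[k] _) = 0 := dif_neg h

theorem mul_apply (a : Fin 2 → A) : mul k A a = a 0 * a 1 := by
  rw [mul, cup_apply]
  rfl

theorem compHom_assoc_left {p q r n i j : ℕ} (φ : HochschildCochain k A p) (ψ : HochschildCochain k A q)
    (χ : HochschildCochain k A r) (h : p + q + r = n + 2) (h₁ : 1 ≤ i) (h₂ : i ≤ p) (h₃ : 1 ≤ j)
    (h₄ : j < i) : compHom (p + q - 1) r n j (compHom p q (p + q - 1) i φ ψ) χ =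
      compHom (p + r - 1) q n (i + r - 1) (compHom p r (p + r - 1) j φ χ) ψ := by
  ext a
  rw [compHom_apply (by omega), compHom_apply (by omega), compHom_apply (by omega),
    compHom_apply (by omega)]
  refine congrArg φ (funext fun t => ?_)
  simp only [insertArg, Fin.lt_def, Fin.ext_iff]
  split_ifs <;> first | rfl | omega | exact congrArg a (Fin.ext (by simp only; omega)) | skip
  · refine congrArg ψ (funext fun s => ?_)
    split_ifs <;> first | rfl | omega | exact congrArg a (Fin.ext (by simp only; omega))
  · refine congrArg χ (funext fun s => ?_)
    split_ifs <;> first | rfl | omega | exact congrArg a (Fin.ext (by simp only; omega))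

theorem compHom_assoc_middle {p q r n i j : ℕ} (φ : HochschildCochain k A p) (ψ : HochschildCochain k A q)
    (χ : HochschildCochain k A r) (h : p + q + r = n + 2) (h₁ : 1 ≤ i) (h₂ : i ≤ p) (h₃ : i ≤ j)
    (h₄ : j < q + i) : compHom (p + q - 1) r n j (compHom p q (p + q - 1) i φ ψ) χ =
      compHom p (q + r - 1) n i φ (compHom q r (q + r - 1) (j - i + 1) ψ χ) := by
  ext a
  rw [compHom_apply (by omega), compHom_apply (by omega), compHom_apply (by omega)]
  refine congrArg φ (funext fun t => ?_)
  simp only [insertArg, Fin.lt_def, Fin.ext_iff]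
  split_ifs <;> first | rfl | omega | exact congrArg a (Fin.ext (by simp only; omega)) | skip
  rw [compHom_apply (by omega)]
  refine congrArg ψ (funext fun s => ?_)
  simp only [insertArg, Fin.lt_def, Fin.ext_iff]
  split_ifs <;> first | rfl | omega | exact congrArg a (Fin.ext (by simp only; omega)) | skip
  refine congrArg χ (funext fun s => ?_)
  exact congrArg a (Fin.ext (by simp only; omega))

theorem one_compHom {p : ℕ} (φ : HochschildCochain k A p) : compHom 1 p p 1 (one k A) φ = φ := by
  ext a
  rw [compHom_apply (by omega), one_apply]
  simp only [insertArg, Fin.lt_def, Fin.ext_iff]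
  rw [dif_neg (by simp), dif_pos (by simp)]
  exact congrArg φ (funext fun t => congrArg a (Fin.ext (by simp)))

theorem compHom_one {p i : ℕ} (φ : HochschildCochain k A p) (h₁ : 1 ≤ i) (h₂ : i ≤ p) :
    compHom p 1 p i φ (one k A) = φ := by
  ext a
  rw [compHom_apply (by omega)]
  refine congrArg φ (funext fun t => ?_)
  simp only [insertArg, Fin.lt_def, Fin.ext_iff]
  split_ifs <;> first | rfl | omega | skip
  rw [one_apply]
  exact congrArg a (Fin.ext (by simp; omega))

variable (k A) in
/-- The endomorphism operad of `A` with the multiplication of `A`. -/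
noncomputable def operad : OperadWithMultiplication k (HochschildCochain k A) where
  comp := compHom
  one := one k A
  mul := mul k A
  unit := unit k A
  comp_eq_zero _ _ _ _ h := compHom_eq_zero h
  assoc_left _ _ _ _ _ _ φ ψ χ h h₁ h₂ h₃ h₄ := compHom_assoc_left φ ψ χ h h₁ h₂ h₃ h₄
  assoc_middle _ _ _ _ _ _ φ ψ χ h h₁ h₂ h₃ h₄ := compHom_assoc_middle φ ψ χ h h₁ h₂ h₃ h₄
  assoc_right p q r n i j φ ψ χ h h₁ h₂ h₃ h₄ := by
    -- Insertion into disjoint slots in the opposite order is `assoc_left` read backwards.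
    rw [compHom_assoc_left φ χ ψ (by omega) (by omega) (by omega) h₁ (by omega),
      show j - q + 1 + q - 1 = j by omega]
  comp_one _ _ φ h₁ h₂ := compHom_one φ h₁ h₂
  one_comp _ φ := one_compHom φ
  mul_assoc := by
    ext a
    rw [compHom_apply (by omega), compHom_apply (by omega), mul_apply, mul_apply]
    simp [insertArg, mul_apply, _root_.mul_assoc]
  mul_unit_left := by
    ext a
    rw [compHom_apply (by omega), mul_apply]
    simp [insertArg, one_apply, unit]
  mul_unit_right := by
    ext a
    rw [compHom_apply (by omega), mul_apply]
    simp [insertArg, one_apply, unit]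

end HochschildCochain

namespace Contraaction

open HochschildCochain

variable (γ : Contraaction k A)

theorem tau_eq {n : ℕ} (f : HochschildCochain k A n) (a : Fin n → A) :
    γ.tau f a = γ.toLinearMap ((cup (Nat.add_comm 1 n) (one k A) f).curryRight a) := rfl

theorem contraassoc_bilinear (β : A →ₗ[k] A →ₗ[k] A) :
    γ.toLinearMap (γ.toLinearMap ∘ₗ β) = γ.toLinearMap (β.flip 1) := by
  have h := γ.contraassoc (TensorProduct.lift β)
  rwa [show TensorProduct.curry (TensorProduct.lift β) = β by ext; rfl] at h

/-- The cyclic operator as a linear map. -/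
noncomputable def tauHom (n : ℕ) : HochschildCochain k A n →ₗ[k] HochschildCochain k A n where
  toFun f := γ.tau f
  map_add' f g := by
    ext a
    rw [add_apply, tau_eq, tau_eq, tau_eq, ← map_add]
    congr 1
    ext x
    simp [cup_apply, mul_add]
  map_smul' c f := by
    ext a
    rw [smul_apply, tau_eq, tau_eq, RingHom.id_apply, ← map_smul]
    congr 1
    ext x
    simp [cup_apply]

/-- With `Φ(y) = a₁ φ(a₂, …, a_p, y)` and `Ψ(x) = ψ(a_{p+1}, …, x)`, the left side is `γ(x ↦
Φ(Ψ(x)))`. By contraassociativity this is `γ(x ↦ γ(y ↦ Φ(Ψ(x) y)))`, and right linearity turns the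
inner value into `γ(Φ) Ψ(x)`, where `γ(Φ)` is a value of `τ φ`. -/
theorem tau_compHom_one {p q r : ℕ} (φ : HochschildCochain k A p) (ψ : HochschildCochain k A q)
    (h : p + q = r + 1) (hp : 1 ≤ p) (hq : 1 ≤ q) :
    γ.tau (compHom p q r 1 φ ψ) = compHom q p r q (γ.tau ψ) (γ.tau φ) := by
  obtain ⟨q, rfl⟩ : ∃ m, q = m + 1 := ⟨q - 1, by omega⟩
  ext a
  let Φ : A →ₗ[k] A := (cup (Nat.add_comm 1 p) (one k A) φ).curryRight fun s => a ⟨s, by omega⟩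
  let Ψ : A →ₗ[k] A := ψ.curryRight fun s => a ⟨p + s, by omega⟩
  have key := γ.contraassoc_bilinear (((LinearMap.mul k A) ∘ₗ Ψ).compr₂ Φ)
  rw [compHom_apply (by omega), tau_eq, tau_eq]
  have e₁ : (cup (Nat.add_comm 1 r) (one k A) (compHom p (q + 1) r 1 φ ψ)).curryRight a =
      (((LinearMap.mul k A) ∘ₗ Ψ).compr₂ Φ).flip 1 := by
    ext x
    simp only [Φ, Ψ, MultilinearMap.curryRight_apply, cup_apply, LinearMap.flip_apply,
      LinearMap.compr₂_apply, LinearMap.comp_apply, LinearMap.mul_apply', mul_one, one_apply,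
      snoc_eq_dite]
    rw [compHom_apply (by omega)]
    congr 1
    · rw [dif_pos (by simp; omega), dif_pos (by simp; omega)]
    · refine congrArg φ (funext fun t => ?_)
      simp only [insertArg, Fin.lt_def, Fin.ext_iff]
      split_ifs <;> first | rfl | omega | skip
      refine congrArg ψ (funext fun s => ?_)
      rw [snoc_eq_dite]
      split_ifs <;> first | rfl | omega | exact congrArg a (Fin.ext (by simp only; omega))
  rw [e₁, ← key]
  congr 1
  ext x
  simp only [LinearMap.comp_apply, MultilinearMap.curryRight_apply, cup_apply, one_apply]
  have e₂ : ((LinearMap.mul k A) ∘ₗ Ψ).compr₂ Φ x = Φ ∘ₗ LinearMap.mulLeft k (Ψ x) := rfl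
  rw [e₂, γ.map_comp_mulLeft]
  congr 1
  · rw [snoc_eq_dite, dif_pos (by simp)]
    simp only [insertArg, Fin.lt_def, Fin.ext_iff]
    rw [dif_neg (by simp), dif_pos (by simp), tau_eq]
    refine congrArg (fun b => γ.toLinearMap ((cup (Nat.add_comm 1 p) (one k A) φ).curryRight b))
      (funext fun s => ?_)
    exact congrArg a (Fin.ext (by simp))
  · refine congrArg ψ (funext fun t => ?_)
    rw [snoc_eq_dite, snoc_eq_dite]
    simp only [insertArg, Fin.lt_def, Fin.ext_iff]
    split_ifs <;> first | rfl | omega | exact congrArg a (Fin.ext (by simp only; omega))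

theorem tau_compHom {p q r i : ℕ} (φ : HochschildCochain k A p) (ψ : HochschildCochain k A q)
    (h : p + q = r + 1) (hi : 2 ≤ i) (hip : i ≤ p) :
    γ.tau (compHom p q r i φ ψ) = compHom p q r (i - 1) (γ.tau φ) ψ := by
  ext a
  rw [compHom_apply (by omega), tau_eq, tau_eq]
  congr 1
  ext x
  simp only [MultilinearMap.curryRight_apply, cup_apply, one_apply, snoc_eq_dite]
  rw [compHom_apply (by omega)]
  congr 1
  · rw [dif_pos (by simp; omega), dif_pos (by simp; omega)]
    simp only [insertArg, Fin.lt_def, Fin.ext_iff]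
    rw [dif_pos (by simp; omega)]
  · refine congrArg φ (funext fun t => ?_)
    simp only [insertArg, Fin.lt_def, Fin.ext_iff]
    split_ifs <;> first | rfl | omega | exact congrArg a (Fin.ext (by simp only; omega)) | skip
    refine congrArg ψ (funext fun s => ?_)
    split_ifs <;> first | rfl | omega | exact congrArg a (Fin.ext (by simp only; omega))

theorem tau_one : γ.tau (one k A) = one k A := by
  ext a
  refine Eq.trans ?_ (γ.counit (a 0))
  refine (tau_eq _ _ _).trans (congrArg γ.toLinearMap ?_)
  ext x
  simp only [MultilinearMap.curryRight_apply, cup_apply, one_apply, snoc_eq_dite]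
  rfl

theorem tau_mul : γ.tau (mul k A) = mul k A := by
  ext a
  refine Eq.trans ?_ ((γ.counit (a 0 * a 1)).trans (mul_apply a).symm)
  refine (tau_eq _ _ _).trans (congrArg γ.toLinearMap ?_)
  ext x
  simp only [MultilinearMap.curryRight_apply, cup_apply, one_apply, mul_apply, snoc_eq_dite]
  exact (mul_assoc _ _ _).symm

/-- The endomorphism operad of `A` with the cyclic operator of a contraaction. -/
noncomputable def paraCyclicOperad : ParaCyclicOperadWithMultiplication k (HochschildCochain k A) where
  toOperadWithMultiplication := operad k A
  tau := γ.tauHom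
  tau_comp_one _ _ _ φ ψ h hp hq := γ.tau_compHom_one φ ψ h hp hq
  tau_comp _ _ _ _ φ ψ h hi hip := γ.tau_compHom φ ψ h hi hip
  tau_one := γ.tau_one
  tau_mul := γ.tau_mul

/-- Contraassociativity for `β(x)(y) = a₁ f(a₂, …, a_n, x, y)`: its right side sets `y = 1`, and its
left side is `τ² f` with first argument `1`. -/
theorem tau_compHom_unit {n : ℕ} (f : HochschildCochain k A (n + 1)) :
    γ.tau (compHom (n + 1) 0 n 1 f (unit k A)) =
      compHom (n + 1) 0 n (n + 1) (γ.tau (γ.tau f)) (unit k A) := by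
  ext a
  let β : A →ₗ[k] A →ₗ[k] A := (cup (Nat.add_comm 1 _) (one k A) f).curryRight.curryRight a
  have key := γ.contraassoc_bilinear β
  rw [compHom_apply (by omega), tau_eq, tau_eq]
  have e₁ : (cup (Nat.add_comm 1 n) (one k A) (compHom (n + 1) 0 n 1 f (unit k A))).curryRight a =
      β.flip 1 := by
    ext x
    simp only [β, MultilinearMap.curryRight_apply, cup_apply, LinearMap.flip_apply, one_apply,
      snoc_eq_dite]
    rw [compHom_apply (by omega)]
    congr 1
    refine congrArg f (funext fun t => ?_)
    simp only [insertArg, Fin.lt_def, Fin.ext_iff]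
    split_ifs <;> first | rfl | omega
  rw [e₁, ← key]
  congr 1
  ext x
  simp only [LinearMap.comp_apply, MultilinearMap.curryRight_apply, cup_apply, one_apply]
  have h₁ : (Fin.snoc (insertArg (r := n) (by omega) ⟨n + 1 - (n + 1), by omega⟩ (unit k A) a) x :
      Fin (n + 2) → A) 0 = 1 := by
    rw [snoc_eq_dite, dif_pos (by simp)]
    simp only [insertArg, Fin.lt_def, Fin.ext_iff]
    rw [dif_neg (by simp), dif_pos (by simp)]
    rfl
  have h₂ : (fun i : Fin (n + 1) =>
      (Fin.snoc (insertArg (r := n) (by omega) ⟨n + 1 - (n + 1), by omega⟩ (unit k A) a) x :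
        Fin (n + 2) → A) ⟨1 + i, by omega⟩) = Fin.snoc a x := by
    funext t
    rw [snoc_eq_dite, snoc_eq_dite]
    simp only [insertArg, Fin.lt_def, Fin.ext_iff]
    split_ifs <;> first | rfl | omega | exact congrArg a (Fin.ext (by simp only; omega))
  exact (one_mul _).symm.trans (congrArg₂ (· * ·) h₁.symm (congrArg (γ.tau f) h₂.symm))

/-- This is right linearity of `γ` for right multiplication by the element `f`. -/
theorem tau_mul_compHom (f : HochschildCochain k A 0) :
    γ.tau (compHom 2 0 1 1 (mul k A) f) = compHom 2 0 1 2 (mul k A) (γ.tau f) := by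
  ext a
  have h := γ.map_comp_mulLeft (LinearMap.mulRight k (f default)) (a 0)
  rw [compHom_apply (by omega), mul_apply, tau_eq]
  refine Eq.trans (congrArg γ.toLinearMap ?_) (h.trans ?_)
  · ext x
    simp only [MultilinearMap.curryRight_apply, cup_apply, one_apply, snoc_eq_dite]
    rw [compHom_apply (by omega), mul_apply]
    simp [insertArg, mul_assoc]
    exact congrArg _ (congrArg _ (congrArg f (Subsingleton.elim _ _)))
  · rw [← tau_apply_zero γ f default]
    simp [insertArg]
    exact congrArg₂ _ (congrArg _ (Subsingleton.elim _ _)) rfl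

theorem paraCyclicOperad_isUnital : γ.paraCyclicOperad.IsUnital where
  tau_comp_unit _ f := γ.tau_compHom_unit f
  tau_mul_comp f := γ.tau_mul_compHom f

variable {γ}

theorem IsStable.tau_zero (hγ : γ.IsStable) (f : HochschildCochain k A 0) : γ.tau f = f := by
  ext a
  rw [tau_apply_zero, hγ]

theorem IsStable.isCyclic (hγ : γ.IsStable) : γ.paraCyclicOperad.IsCyclic := by
  intro n
  induction n with
  | zero => exact hγ.tau_zero
  | succ n ih =>
    intro f
    ext a
    -- Inserting the constant `a 0` into slot `n + 1` freezes the first argument. The resulting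
    -- `n`-cochain is fixed by `τ^(n + 1)` by induction, hence `τ^(n + 2) f` and `f` agree at `a`.
    have h := γ.paraCyclicOperad_isUnital.tau_pow_comp_zero hγ.tau_zero f
      (MultilinearMap.constOfIsEmpty k (fun _ : Fin 0 => A) (a 0))
    rw [ih] at h
    have h' := congrArg (fun g => g (Fin.tail a)) h
    have key : ∀ g : HochschildCochain k A (n + 1), γ.paraCyclicOperad.comp (n + 1) 0 n (n + 1) g
      (MultilinearMap.constOfIsEmpty k (fun _ : Fin 0 => A) (a 0)) (Fin.tail a) = g a := by
      intro g
      refine (compHom_apply (by omega) _ _ _).trans (congrArg g (funext fun t => ?_))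
      simp only [insertArg, Fin.lt_def, Fin.ext_iff]
      split_ifs <;> first | omega | skip
      · exact congrArg a (Fin.ext (by simp; omega))
      · exact congrArg a (Fin.ext (by simp; omega))
    exact ((key _).symm.trans h'.symm).trans (key f)

end Contraaction

end HochschildOperad

/-! ### Comparison of the abstract operations with the Hochschild ones. -/

section HochschildCohomology

variable {k : Type u} {A : Type v} [CommRing k] [Ring A] [Algebra k A]

namespace HochschildCochain

theorem compHom_mul_one {n : ℕ} (f : HochschildCochain k A n) :
    compHom 2 n (n + 1) 1 (mul k A) f = cup (Nat.add_comm 1 n) (one k A) f := by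
  ext a
  rw [compHom_apply (by omega), mul_apply, cup_apply]
  simp [insertArg, one_apply]

theorem compHom_mul_two {n : ℕ} (f : HochschildCochain k A n) :
    compHom 2 n (n + 1) 2 (mul k A) f = cup rfl f (one k A) := by
  ext a
  rw [compHom_apply (by omega), mul_apply, cup_apply]
  simp only [insertArg, Fin.lt_def, one_apply]
  exact congrArg₂ (· * ·) (congrArg f (funext fun t => congrArg a (Fin.ext (by simp))))
    (congrArg a (Fin.ext (by simp)))

theorem operad_cup {p q n : ℕ} (h : p + q = n) (f : HochschildCochain k A p)
    (g : HochschildCochain k A q) : (operad k A).cup p q n f g = cup h f g := by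
  rw [OperadWithMultiplication.cup_apply, OperadWithMultiplication.face_zero]
  change compHom _ _ _ _ (compHom _ _ _ _ (mul k A) f) g = _
  ext a
  rw [compHom_apply (by omega), compHom_mul_two, cup_apply, cup_apply, one_apply]
  congr 1
  · refine congrArg f (funext fun t => ?_)
    simp [insertArg, Fin.lt_def, Fin.ext_iff]
  · simp [insertArg, Fin.lt_def]

theorem operad_face {n : ℕ} (i : Fin (n + 2)) (f : HochschildCochain k A n) :
    (operad k A).face n (n + 1) i f = coface i f := by
  rw [coface]
  split_ifs with h₀ h₁
  · rw [h₀, OperadWithMultiplication.face_zero]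
    exact compHom_mul_two f
  · rw [OperadWithMultiplication.face_of_pos _ _ h₀ (by omega)]
    obtain ⟨m, hm⟩ : ∃ m, (i : ℕ) = m + 1 := ⟨i - 1, by omega⟩
    simp only [hm]
    exact compHom_eq (by omega) (⟨m, by omega⟩ : Fin n) f (mul k A)
  · rw [show (i : ℕ) = n + 1 by omega, OperadWithMultiplication.face_last]
    exact compHom_mul_one f

/-- The Hochschild coboundary counts its terms from the left and the faces are numbered from the
right, which accounts for the global sign. It affects neither cocycles nor coboundaries. -/
theorem operad_diff (n : ℕ) (f : HochschildCochain k A n) :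
    coboundary n f = (-1 : k) ^ (n + 1) • (operad k A).diff n (n + 1) f := by
  rw [show (operad k A).diff n (n + 1) f = (operad k A).faceSum n (n + 1) 0 (n + 2) f from rfl,
    OperadWithMultiplication.faceSum_apply, Nat.Ico_zero_eq_range, Finset.sum_range_succ,
    Finset.sum_range_succ', OperadWithMultiplication.face_zero, OperadWithMultiplication.face_last,
    smul_add, smul_add, Finset.smul_sum, smul_smul _ _ (((operad k A).comp 2 n (n + 1) 1) _ _),
    ← mul_pow, neg_one_mul, neg_neg, one_pow, one_smul, pow_zero, one_smul]
  have h₁ : ((operad k A).comp 2 n (n + 1) 1) (operad k A).mul f =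
    cup (Nat.add_comm 1 n) (one k A) f := compHom_mul_one f
  have h₂ : ((operad k A).comp 2 n (n + 1) 2) (operad k A).mul f =
    cup rfl f (one k A) := compHom_mul_two f
  have h₃ : ∑ i : Fin n, (-1 : k) ^ ((i : ℕ) + 1) • comp (r := n + 1) (by omega) i.rev f (mul k A) =
      ∑ i ∈ Finset.range n, (-1 : k) ^ (n + 1) • (-1 : k) ^ (i + 1) •
        (operad k A).face n (n + 1) (i + 1) f := by
    rw [← Finset.sum_range_reflect, Finset.sum_range]
    refine Finset.sum_congr rfl fun i _ => ?_
    have hi : n - 1 - (i : ℕ) + 1 = (i.rev : ℕ) + 1 := by simp; omega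
    rw [hi, OperadWithMultiplication.face_of_pos _ _ (by omega) (by omega), smul_smul, ← pow_add,
      sgn_congr (k := k) (a := n + 1 + ((i.rev : ℕ) + 1)) (b := i + 1) (n + 1) (by simp; omega)]
    congr 1
    exact (compHom_eq (by omega) i.rev f (mul k A)).symm
  rw [h₁, h₂, ← h₃, coboundary]
  simp only [LinearMap.coe_mk, AddHom.coe_mk]
  abel

theorem operad_circ {p q n : ℕ} (h : p + q = n + 1) (f : HochschildCochain k A p)
    (g : HochschildCochain k A q) : (operad k A).circ p q n f g = circ h f g := by
  rw [OperadWithMultiplication.circ_apply, circ, Finset.sum_range]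
  exact Finset.sum_congr rfl fun i _ => congrArg _ (compHom_eq h i f g)

theorem operad_bracket {p q n : ℕ} (h : p + q = n + 1) (f : HochschildCochain k A p)
    (g : HochschildCochain k A q) :
    (operad k A).bracket p q n f g = gerstenhaberBracket h f g := by
  rw [OperadWithMultiplication.bracket_apply, gerstenhaberBracket, operad_circ, operad_circ]

theorem operad_diff_eq_zero_iff {n : ℕ} (f : HochschildCochain k A n) :
    (operad k A).diff n (n + 1) f = 0 ↔ coboundary n f = 0 := by
  rw [operad_diff]
  refine ⟨fun h => by rw [h, smul_zero], fun h => ?_⟩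
  rw [← one_smul k ((operad k A).diff n (n + 1) f), ← neg_one_pow_mul_two (n + 1), pow_mul, sq,
    mul_smul, h, smul_zero]

theorem operad_boundaries (n : ℕ) : (operad k A).boundaries n = hochschildCoboundaries k A n := by
  cases n with
  | zero => rfl
  | succ n =>
    ext f
    constructor
    · rintro ⟨g, rfl⟩
      refine ⟨(-1 : k) ^ (n + 1) • g, ?_⟩
      rw [operad_diff, map_smul, smul_smul, ← pow_add, ← mul_two, neg_one_pow_mul_two, one_smul]
    · rintro ⟨g, rfl⟩
      refine ⟨(-1 : k) ^ (n + 1) • g, ?_⟩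
      rw [operad_diff, map_smul]

variable (k A) in
/-- Hochschild cohomology as the cohomology of the endomorphism operad. -/
noncomputable def cohomologyData :
    (operad k A).CohomologyData (fun n => HochschildCohomology k A n) where
  cl n :=
    { toFun := fun z => ⟨(hochschildCoboundaries k A n).mkQ z, z,
        (operad_diff_eq_zero_iff _).1 z.2, rfl⟩
      map_add' := fun _ _ => rfl
      map_smul' := fun _ _ => rfl }
  surjective n := by
    rintro ⟨_, f, hf, rfl⟩
    exact ⟨⟨f, (operad_diff_eq_zero_iff _).2 hf⟩, rfl⟩
  eq_zero_iff n z := by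
    rw [operad_boundaries, ← Submodule.Quotient.mk_eq_zero]
    exact Subtype.ext_iff

theorem cohomologyData_rep {n : ℕ} (x : HochschildCohomology k A n) (f : HochschildCochain k A n) :
    (cohomologyData k A).Rep x f ↔ IsRepresentedBy x f := by
  constructor
  · rintro ⟨h, rfl⟩
    exact ⟨(operad_diff_eq_zero_iff _).1 h, rfl⟩
  · rintro ⟨h, h'⟩
    exact ⟨(operad_diff_eq_zero_iff _).2 h, Subtype.ext h'⟩

end HochschildCochain

namespace Contraaction

open HochschildCochain

variable (γ : Contraaction k A)

theorem extra_eq {n : ℕ} (f : HochschildCochain k A (n + 1)) :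
    γ.paraCyclicOperad.extra n f = γ.extraDegeneracy f := by
  rw [ParaCyclicOperadWithMultiplication.extra_apply]
  change compHom (n + 1) 0 n (n + 1) (γ.tau f) (unit k A) = _
  ext a
  rw [compHom_apply (by omega), tau_eq, extraDegeneracy, LinearMap.compMultilinearMap_apply]
  congr 1
  ext x
  simp only [MultilinearMap.curryRight_apply, cup_apply, one_apply]
  refine Eq.trans (congrArg₂ (· * ·) ?_ (congrArg f (funext fun t => ?_))) (one_mul _)
  · rw [snoc_eq_dite, dif_pos (by simp)]
    simp only [insertArg, Fin.lt_def, Fin.ext_iff]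
    rw [dif_neg (by simp), dif_pos (by simp)]
    rfl
  · rw [snoc_eq_dite, snoc_eq_dite]
    simp only [insertArg, Fin.lt_def, Fin.ext_iff]
    split_ifs <;> first | rfl | omega | exact congrArg a (Fin.ext (by simp only; omega))

theorem connesB_eq {n : ℕ} (f : HochschildCochain k A (n + 1)) :
    γ.paraCyclicOperad.connesB (n + 1) n f = γ.connesB f := by
  rw [ParaCyclicOperadWithMultiplication.connesB_succ,
    ParaCyclicOperadWithMultiplication.connes_apply,
    ParaCyclicOperadWithMultiplication.norm_apply, extra_eq,
    ParaCyclicOperadWithMultiplication.lam_apply, connesB, Finset.smul_sum]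
  refine Finset.sum_congr rfl fun j _ => ?_
  rw [ParaCyclicOperadWithMultiplication.lam_pow_apply, smul_smul, ← pow_add,
    show n + n * j = n * (j + 1) by ring]
  rfl

variable {γ}

theorem IsStable.exists_batalinVilkoviskyAlgebra (hγ : γ.IsStable) :
    ∃ S : BatalinVilkoviskyAlgebra k (fun n => HochschildCohomology k A n),
      IsRepresentedBy S.one (unit k A) ∧
      (∀ (p q n : ℕ) (h : p + q = n) (x : HochschildCohomology k A p)
        (y : HochschildCohomology k A q)
        (f : HochschildCochain k A p) (g : HochschildCochain k A q),
        IsRepresentedBy x f → IsRepresentedBy y g →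
        IsRepresentedBy (S.cup p q n x y) (HochschildCochain.cup h f g)) ∧
      (∀ (p q n : ℕ) (h : p + q = n + 1) (x : HochschildCohomology k A p)
        (y : HochschildCohomology k A q)
        (f : HochschildCochain k A p) (g : HochschildCochain k A q),
        IsRepresentedBy x f → IsRepresentedBy y g →
        IsRepresentedBy (S.bracket p q n x y) (HochschildCochain.gerstenhaberBracket h f g)) ∧
      (∀ (n : ℕ) (x : HochschildCohomology k A (n + 1)) (f : HochschildCochain k A (n + 1)),
        IsRepresentedBy x f → IsRepresentedBy (S.B (n + 1) n x) (γ.connesB f)) := by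
  obtain ⟨S, h₁, h₂, h₃, h₄⟩ := γ.paraCyclicOperad_isUnital.exists_batalinVilkoviskyAlgebra
    hγ.isCyclic (cohomologyData k A)
  refine ⟨S, (cohomologyData_rep _ _).1 h₁, fun p q n h x y f g hx hy => ?_,
    fun p q n h x y f g hx hy => ?_, fun n x f hx => ?_⟩
  · rw [← cohomologyData_rep] at hx hy ⊢
    rw [← operad_cup h]
    exact h₂ _ _ _ _ _ _ _ hx hy
  · rw [← cohomologyData_rep] at hx hy ⊢
    rw [← operad_bracket h]
    exact h₃ _ _ _ _ _ _ _ hx hy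
  · rw [← cohomologyData_rep] at hx ⊢
    rw [← connesB_eq]
    exact h₄ _ _ _ _ hx

end Contraaction

end HochschildCohomology

/-! ### Bimodules and the bar resolution. -/

section Bimodule

variable (k : Type u) (A : Type v) [CommRing k] [Ring A] [Algebra k A]

/-- A bimodule over `A`, regarded as a module over the enveloping algebra. -/
structure EnvelopingBimodule where
  carrier : Type v
  [addCommGroup : AddCommGroup carrier]
  [baseModule : Module k carrier]
  [module : Module (A ⊗[k] Aᵐᵒᵖ) carrier]
  [isScalarTower : IsScalarTower k (A ⊗[k] Aᵐᵒᵖ) carrier]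

namespace EnvelopingBimodule

instance : CoeSort (EnvelopingBimodule k A) (Type v) := ⟨carrier⟩

attribute [instance] addCommGroup baseModule module isScalarTower

variable {k A}

section Basic

variable (M N : EnvelopingBimodule k A)

theorem env_induction {p : A ⊗[k] Aᵐᵒᵖ → Prop} (tmul : ∀ a b, p (a ⊗ₜ b))
    (add : ∀ r s, p r → p s → p (r + s)) (r : A ⊗[k] Aᵐᵒᵖ) : p r :=
  TensorProduct.induction_on r ((TensorProduct.zero_tmul (R := k) A (0 : Aᵐᵒᵖ)) ▸ tmul 0 0) tmul add

/-- The left action of `A` on `A ⊗ M`. -/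
noncomputable def indLeftAction : A →ₐ[k] Module.End k (A ⊗[k] M) :=
  (Module.End.rTensorAlgHom k A M).comp (Algebra.lmul k A)

/-- The right action of `A` on `A ⊗ M`. -/
noncomputable def indRightAction : Aᵐᵒᵖ →ₐ[k] Module.End k (A ⊗[k] M) :=
  (Module.End.lTensorAlgHom k M A).comp ((Algebra.lsmul k k M).comp
    (Algebra.TensorProduct.includeRight (R := k) (A := A) (B := Aᵐᵒᵖ)))

theorem indLeftAction_apply (a : A) (x : A) (m : M) :
    M.indLeftAction a (x ⊗ₜ m) = (a * x) ⊗ₜ[k] m := rfl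

theorem indRightAction_apply (b : Aᵐᵒᵖ) (x : A) (m : M) :
    M.indRightAction b (x ⊗ₜ m) = x ⊗ₜ[k] (((1 : A) ⊗ₜ[k] b) • m) := rfl

theorem commute_indAction (a : A) (b : Aᵐᵒᵖ) : Commute (M.indLeftAction a) (M.indRightAction b) :=
  TensorProduct.ext' fun _ _ => rfl

/-- The action of the enveloping algebra on `A ⊗ M` through the left action on `A` and the right
action on `M`. -/
noncomputable def indAction : A ⊗[k] Aᵐᵒᵖ →ₐ[k] Module.End k (A ⊗[k] M) :=
  Algebra.TensorProduct.lift M.indLeftAction M.indRightAction M.commute_indAction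

theorem indAction_apply (a : A) (b : Aᵐᵒᵖ) (x : A) (m : M) :
    M.indAction (a ⊗ₜ b) (x ⊗ₜ m) = (a * x) ⊗ₜ[k] (((1 : A) ⊗ₜ[k] b) • m) := by
  rw [indAction, Algebra.TensorProduct.lift_tmul, Module.End.mul_apply, indRightAction_apply,
    indLeftAction_apply]

/-- The bimodule `A ⊗ M`, with the left action on `A` and the right action on `M`. -/
noncomputable def ind : EnvelopingBimodule k A :=
  letI : Module (A ⊗[k] Aᵐᵒᵖ) (A ⊗[k] M) := Module.compHom _ M.indAction.toRingHom
  letI : IsScalarTower k (A ⊗[k] Aᵐᵒᵖ) (A ⊗[k] M) :=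
    ⟨fun c r x => LinearMap.congr_fun (map_smul M.indAction c r) x⟩
  { carrier := A ⊗[k] M }

variable {M}

/-- The elementary tensors in `A ⊗ M`. -/
noncomputable def tmul : A →ₗ[k] M →ₗ[k] M.ind := TensorProduct.mk k A M

theorem smul_tmul (a : A) (b : Aᵐᵒᵖ) (x : A) (m : M) :
    (a ⊗ₜ[k] b) • tmul x m = tmul (a * x) (((1 : A) ⊗ₜ[k] b) • m) :=
  M.indAction_apply a b x m

theorem ind_induction {p : M.ind → Prop} (tmul : ∀ a m, p (tmul a m))
    (add : ∀ x y, p x → p y → p (x + y)) (x : M.ind) : p x :=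
  TensorProduct.induction_on x ((TensorProduct.zero_tmul (R := k) A (0 : M)) ▸ tmul 0 0) tmul add

/-- A map out of `A ⊗ M` from a bilinear map. -/
noncomputable def indLift {N : Type*} [AddCommMonoid N] [Module k N] (f : A →ₗ[k] M →ₗ[k] N) :
    M.ind →ₗ[k] N := TensorProduct.lift f

theorem indLift_tmul {N : Type*} [AddCommMonoid N] [Module k N] (f : A →ₗ[k] M →ₗ[k] N) (a : A)
    (m : M) : indLift f (tmul a m) = f a m := rfl

theorem ind_ext {N : Type*} [AddCommMonoid N] [Module k N] {f g : M.ind →ₗ[k] N}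
    (h : ∀ a m, f (tmul a m) = g (tmul a m)) : f = g :=
  TensorProduct.ext' h

variable {N}

/-- A map of bimodules from a map that is compatible with elementary tensors. -/
def homOfTmul (f : M →ₗ[k] N) (h : ∀ (a : A) (b : Aᵐᵒᵖ) (m : M),
    f ((a ⊗ₜ[k] b) • m) = (a ⊗ₜ[k] b) • f m) : M →ₗ[A ⊗[k] Aᵐᵒᵖ] N where
  toFun := f
  map_add' := map_add f
  map_smul' r m := by
    induction r using env_induction with
    | tmul a b => exact h a b m
    | add r s hr hs => simp only [add_smul, map_add, hr, hs, RingHom.id_apply]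

/-- A map of bimodules out of `A ⊗ M`. -/
noncomputable def homOfInd (f : M.ind →ₗ[k] N) (h : ∀ (a : A) (b : Aᵐᵒᵖ) (x : A) (m : M),
    f (tmul (a * x) (((1 : A) ⊗ₜ[k] b) • m)) = (a ⊗ₜ[k] b) • f (tmul x m)) :
    M.ind →ₗ[A ⊗[k] Aᵐᵒᵖ] N :=
  homOfTmul f fun a b x => by
    induction x using ind_induction with
    | tmul x m => rw [smul_tmul, h]
    | add x y hx hy => simp only [smul_add, map_add, hx, hy]

/-- A `k`-linear map is right linear if it commutes with the right action of `A`. -/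
def IsRightLinear (f : M →ₗ[k] N) : Prop :=
  ∀ (b : Aᵐᵒᵖ) (m : M), f (((1 : A) ⊗ₜ[k] b) • m) = ((1 : A) ⊗ₜ[k] b) • f m

theorem IsRightLinear.of_linear (f : M →ₗ[A ⊗[k] Aᵐᵒᵖ] N) : IsRightLinear (f.restrictScalars k) :=
  fun b m => f.map_smul ((1 : A) ⊗ₜ[k] b) m

theorem IsRightLinear.comp {L : EnvelopingBimodule k A} {g : M →ₗ[k] N} {f : L →ₗ[k] M}
    (hg : IsRightLinear g) (hf : IsRightLinear f) : IsRightLinear (g ∘ₗ f) :=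
  fun b m => by rw [LinearMap.comp_apply, hf, hg, LinearMap.comp_apply]

/-- The map of bimodules `A ⊗ M → A ⊗ N` induced by a right linear map. -/
noncomputable def indMap {f : M →ₗ[k] N} (hf : IsRightLinear f) : M.ind →ₗ[A ⊗[k] Aᵐᵒᵖ] N.ind :=
  homOfInd (indLift (tmul.compl₂ f)) fun a b x m => by
    rw [indLift_tmul, indLift_tmul, LinearMap.compl₂_apply, LinearMap.compl₂_apply, smul_tmul, hf]

theorem indMap_tmul {f : M →ₗ[k] N} (hf : IsRightLinear f) (a : A) (m : M) :
    indMap hf (tmul a m) = tmul a (f m) := rfl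

variable (M) in
/-- The left action as a map `A ⊗ M → M` of bimodules. -/
noncomputable def act : M.ind →ₗ[A ⊗[k] Aᵐᵒᵖ] M :=
  homOfInd (indLift ((Algebra.lsmul k k M).comp
    (Algebra.TensorProduct.includeLeft (R := k) (S := k) (A := A) (B := Aᵐᵒᵖ))).toLinearMap)
    fun a b x m => by
      rw [indLift_tmul, indLift_tmul]
      change ((a * x) ⊗ₜ[k] (1 : Aᵐᵒᵖ)) • (((1 : A) ⊗ₜ[k] b) • m) =
        (a ⊗ₜ[k] b) • ((x ⊗ₜ[k] (1 : Aᵐᵒᵖ)) • m)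
      rw [smul_smul, smul_smul, Algebra.TensorProduct.tmul_mul_tmul,
        Algebra.TensorProduct.tmul_mul_tmul, mul_one, mul_one, one_mul]

theorem act_tmul (a : A) (m : M) : act M (tmul a m) = (a ⊗ₜ[k] (1 : Aᵐᵒᵖ)) • m := rfl

theorem ind_hom_ext {f g : M.ind →ₗ[A ⊗[k] Aᵐᵒᵖ] N} (h : ∀ a m, f (tmul a m) = g (tmul a m)) :
    f = g := by
  have := ind_ext (f := f.restrictScalars k) (g := g.restrictScalars k) h
  ext x
  exact LinearMap.congr_fun this x

theorem tmul_one_isRightLinear : IsRightLinear (tmul (M := M) 1) := fun b m => by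
  rw [smul_tmul, one_mul]

/-- Induction is left adjoint to forgetting the left action: a bimodule map on `A ⊗ M` is determined
by the right linear map `m ↦ h(1 ⊗ m)`. -/
theorem eq_act_comp_indMap (h : M.ind →ₗ[A ⊗[k] Aᵐᵒᵖ] N) :
    h = act N ∘ₗ indMap ((IsRightLinear.of_linear h).comp tmul_one_isRightLinear) := by
  refine ind_hom_ext fun a m => ?_
  rw [LinearMap.comp_apply, indMap_tmul, act_tmul]
  change h (tmul a m) = (a ⊗ₜ[k] (1 : Aᵐᵒᵖ)) • h (tmul 1 m)
  rw [← map_smul, smul_tmul, mul_one]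
  congr 2
  exact (one_smul (A ⊗[k] Aᵐᵒᵖ) m).symm

end Basic

variable (k A) in
/-- `A` as a bimodule over itself. -/
noncomputable def self : EnvelopingBimodule k A :=
  letI : Module (A ⊗[k] Aᵐᵒᵖ) A := TensorProduct.Algebra.module
  letI : IsScalarTower k (A ⊗[k] Aᵐᵒᵖ) A := ⟨fun c r x => by
    induction r using env_induction with
    | tmul a b =>
      rw [TensorProduct.smul_tmul', TensorProduct.Algebra.smul_def, TensorProduct.Algebra.smul_def,
        smul_assoc]
    | add r s hr hs => rw [smul_add, add_smul, add_smul, hr, hs, smul_add]⟩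
  { carrier := A }

variable (k A) in
/-- The identification of `A` with the underlying module of the bimodule `A`. -/
noncomputable def selfEquiv : A ≃ₗ[k] self k A := LinearEquiv.refl k A

theorem self_smul (a : A) (b : Aᵐᵒᵖ) (x : A) :
    (a ⊗ₜ[k] b) • selfEquiv k A x = selfEquiv k A (a * x * b.unop) := by
  let : Module (A ⊗[k] Aᵐᵒᵖ) A := TensorProduct.Algebra.module
  change (a ⊗ₜ[k] b) • x = a * x * b.unop
  rw [TensorProduct.Algebra.smul_def, MulOpposite.smul_eq_mul_unop, smul_eq_mul, mul_assoc]

variable (k A) in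
/-- The bar resolution: `A ⊗ ⋯ ⊗ A` with `n + 1` factors. -/
noncomputable abbrev bar : ℕ → EnvelopingBimodule k A
  | 0 => self k A
  | n + 1 => (bar n).ind

variable (k A) in
/-- The differential of the bar resolution. -/
noncomputable def barD : ∀ n, bar k A (n + 1) →ₗ[A ⊗[k] Aᵐᵒᵖ] bar k A n
  | 0 => act (bar k A 0)
  | n + 1 => act (bar k A (n + 1)) - indMap (IsRightLinear.of_linear (barD n))

theorem barD_tmul (n : ℕ) (a : A) (w : bar k A (n + 1)) :
    barD k A (n + 1) (tmul a w) = (a ⊗ₜ[k] (1 : Aᵐᵒᵖ)) • w - tmul a (barD k A n w) := rfl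

theorem barD_zero_tmul (a : A) (w : bar k A 0) :
    barD k A 0 (tmul a w) = (a ⊗ₜ[k] (1 : Aᵐᵒᵖ)) • w := rfl

theorem barD_succ_one_tmul (n : ℕ) (w : bar k A (n + 1)) :
    barD k A (n + 1) (tmul 1 w) = w - tmul 1 (barD k A n w) := by
  rw [barD_tmul]
  congr 1
  exact one_smul (A ⊗[k] Aᵐᵒᵖ) w

theorem barD_barD (n : ℕ) (w : bar k A (n + 2)) : barD k A n (barD k A (n + 1) w) = 0 := by
  suffices h : barD k A n ∘ₗ barD k A (n + 1) = 0 from LinearMap.congr_fun h w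
  clear w
  induction n with
  | zero =>
    refine ind_hom_ext fun a w => ?_
    rw [LinearMap.comp_apply, barD_tmul, map_sub, map_smul, LinearMap.zero_apply]
    exact sub_self _
  | succ n ih =>
    refine ind_hom_ext fun a w => ?_
    have h := LinearMap.congr_fun ih w
    rw [LinearMap.comp_apply, LinearMap.zero_apply] at h
    rw [LinearMap.comp_apply, barD_tmul, map_sub, map_smul, LinearMap.zero_apply, barD_tmul, h, map_zero,
      sub_zero, sub_self]

/-- `w ↦ 1 ⊗ w` is a contracting homotopy; it is right linear, but not a map of bimodules. -/
theorem barD_exact (n : ℕ) {w : bar k A (n + 1)} (hw : barD k A n w = 0) :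
    ∃ y, barD k A (n + 1) y = w :=
  ⟨tmul 1 w, by rw [barD_succ_one_tmul, hw, map_zero, sub_zero]⟩

theorem barD_zero_surjective : Function.Surjective (barD k A 0) := fun w =>
  ⟨tmul 1 w, one_smul (A ⊗[k] Aᵐᵒᵖ) w⟩

end EnvelopingBimodule

end Bimodule

/-! ### Projectivity of the bar modules. -/

section BarProjective

variable {k : Type u} {A : Type v} [CommRing k] [Ring A] [Algebra k A]

namespace EnvelopingBimodule

variable (k A) in
/-- `A ⊗ A` is the free bimodule of rank one. -/
noncomputable def indSelfEquiv : (self k A).ind ≃ₗ[A ⊗[k] Aᵐᵒᵖ] A ⊗[k] Aᵐᵒᵖ :=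
  letI e : (self k A).ind ≃ₗ[k] A ⊗[k] Aᵐᵒᵖ := TensorProduct.congr (LinearEquiv.refl k A)
    ((selfEquiv k A).symm.trans (MulOpposite.opLinearEquiv k))
  { e with
    map_smul' := fun r x => by
      change e (r • x) = r • e x
      induction r using env_induction with
      | tmul a b =>
        induction x using ind_induction with
        | tmul c d =>
          obtain ⟨d, rfl⟩ := (selfEquiv k A).surjective d
          rw [smul_tmul, self_smul]
          change (a * c) ⊗ₜ[k] MulOpposite.op (1 * d * b.unop) =
            (a ⊗ₜ[k] b) * (c ⊗ₜ[k] MulOpposite.op d)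
          rw [one_mul, Algebra.TensorProduct.tmul_mul_tmul, MulOpposite.op_mul, MulOpposite.op_unop]
        | add x y hx hy => simp only [map_add, smul_add, hx, hy]
      | add r s hr hs => simp only [add_smul, map_add, hr, hs] }

/-- `A ⊗ (A ⊗ M)` is a base change of `A ⊗ M`. -/
noncomputable def indIndEquiv (M : EnvelopingBimodule k A) :
    M.ind.ind ≃ₗ[A ⊗[k] Aᵐᵒᵖ] M.ind ⊗[k] A :=
  letI e : M.ind.ind ≃ₗ[k] M.ind ⊗[k] A :=
    (TensorProduct.leftComm k A A M).trans (TensorProduct.comm k A (A ⊗[k] M))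
  { e with
    map_smul' := fun r x => by
      change e (r • x) = r • e x
      induction r using env_induction with
      | tmul a b =>
        induction x using ind_induction with
        | tmul c x =>
          induction x using ind_induction with
          | tmul d m =>
            rw [smul_tmul, smul_tmul, one_mul]
            change tmul (a * c) (((1 : A) ⊗ₜ[k] b) • m) ⊗ₜ[k] d =
              (a ⊗ₜ[k] b) • (tmul c m ⊗ₜ[k] d : M.ind ⊗[k] A)
            rw [TensorProduct.smul_tmul', smul_tmul]
          | add x y hx hy => simp only [map_add, smul_add, hx, hy]
        | add x y hx hy => simp only [map_add, smul_add, hx, hy]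
      | add r s hr hs => simp only [add_smul, map_add, hr, hs] }

/-- The first term is free of rank one. Each later one is the previous one tensored over `k` with
`A`, on which the enveloping algebra does not act, so projectivity of `A` over `k` is all that is
needed. -/
theorem bar_projective [Module.Projective k A] (n : ℕ) :
    Module.Projective (A ⊗[k] Aᵐᵒᵖ) (bar k A (n + 1)) := by
  induction n with
  | zero => exact Module.Projective.of_equiv (indSelfEquiv k A).symm
  | succ n ih => exact Module.Projective.of_equiv (indIndEquiv (bar k A n)).symm

end EnvelopingBimodule
end BarProjective

/-! ### Dimension shifting along a spliced projective resolution. -/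

section SplicedResolution

open CategoryTheory CategoryTheory.Abelian

variable {C : Type u} [Category.{v} C] [Abelian C] [HasExt.{w} C]

/-- A projective resolution of `X`, decomposed into short exact sequences. -/
structure SplicedResolution (X : C) where
  Z : ℕ → C
  Q : ℕ → C
  i : ∀ n, Z (n + 1) ⟶ Q n
  p : ∀ n, Q n ⟶ Z n
  i_p : ∀ n, i n ≫ p n = 0
  shortExact : ∀ n, (ShortComplex.mk (i n) (p n) (i_p n)).ShortExact
  projective : ∀ n, Projective (Q n)
  iso : X ≅ Z 0

namespace SplicedResolution

variable {X : C} (S : SplicedResolution X) {Y : C}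

/-- The iterated extension class. -/
noncomputable def cls : ∀ n, Ext.{w} X (S.Z n) n
  | 0 => Ext.mk₀ S.iso.hom
  | n + 1 => (cls n).comp (S.shortExact n).extClass rfl

theorem cls_succ_comp {n m l : ℕ} (β : Ext.{w} (S.Z (n + 1)) Y m) (h : n + 1 + m = l) :
    (S.cls (n + 1)).comp β h =
      (S.cls n).comp ((S.shortExact n).extClass.comp β rfl) (by omega) := by
  rw [cls, Ext.comp_assoc _ _ _ _ _ (by omega)]

theorem cls_zero_comp_eq_zero {m : ℕ} (β : Ext.{w} (S.Z 0) Y m) {l : ℕ} (h : 0 + m = l)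
    (hβ : (S.cls 0).comp β h = 0) : β = 0 := by
  obtain rfl : m = l := by omega
  have h' := congrArg (fun α => (Ext.mk₀ S.iso.inv).comp α (zero_add m)) hβ
  simpa [cls] using h'

/-- Each connecting map is injective in positive degree, since its kernel comes from a positive
`Ext` group of a projective object. In degree `0` this fails, and `cls_comp_mk₀_eq_zero_iff`
describes the kernel. -/
theorem cls_comp_eq_zero {n m l : ℕ} (β : Ext.{w} (S.Z n) Y (m + 1)) (h : n + (m + 1) = l)
    (hβ : (S.cls n).comp β h = 0) : β = 0 := by
  induction n generalizing m l with
  | zero => exact S.cls_zero_comp_eq_zero β h hβ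
  | succ n ih =>
    rw [cls_succ_comp] at hβ
    have key : ∀ (d : ℕ) (hd : 1 + (m + 1) = d) (hl : n + d = l),
        (S.cls n).comp ((S.shortExact n).extClass.comp β hd) hl = 0 →
        (S.shortExact n).extClass.comp β hd = 0 := by
      intro d hd hl
      obtain rfl : d = m + 1 + 1 := by omega
      exact ih _ hl
    obtain ⟨γ, rfl⟩ := Ext.contravariant_sequence_exact₁ (S.shortExact n) Y β rfl (key _ rfl _ hβ)
    have := S.projective n
    rw [Ext.eq_zero_of_projective γ, Ext.comp_zero]

/-- A class of positive degree on `Z n` restricts to zero on the projective `Q n`, hence lies in the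
image of the connecting map. -/
theorem exists_cls_comp {n m l : ℕ} (h : n + m = l) (α : Ext.{w} X Y l) :
    ∃ β : Ext.{w} (S.Z n) Y m, (S.cls n).comp β h = α := by
  induction n generalizing m with
  | zero =>
    obtain rfl : m = l := by omega
    exact ⟨(Ext.mk₀ S.iso.inv).comp α (zero_add m), by simp [cls]⟩
  | succ n ih =>
    obtain ⟨β, hβ⟩ := ih (m := m + 1) (by omega)
    have := S.projective n
    obtain ⟨γ, rfl⟩ := Ext.contravariant_sequence_exact₃ (S.shortExact n) Y β
      (Ext.eq_zero_of_projective _) (add_comm 1 m)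
    refine ⟨γ, ?_⟩
    rw [← hβ, cls, Ext.comp_assoc _ _ _ _ _ (by omega)]

theorem exists_cls_comp_mk₀ {n : ℕ} (α : Ext.{w} X Y n) :
    ∃ φ : S.Z n ⟶ Y, (S.cls n).comp (Ext.mk₀ φ) (add_zero n) = α := by
  obtain ⟨β, rfl⟩ := S.exists_cls_comp (add_zero n) α
  obtain ⟨φ, rfl⟩ := (Ext.mk₀_bijective _ _).2 β
  exact ⟨φ, rfl⟩

theorem cls_comp_mk₀_eq_zero_iff {n : ℕ} (φ : S.Z (n + 1) ⟶ Y) :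
    (S.cls (n + 1)).comp (Ext.mk₀ φ) (add_zero (n + 1)) = 0 ↔ ∃ ψ : S.Q n ⟶ Y, S.i n ≫ ψ = φ := by
  constructor
  · intro h
    rw [cls_succ_comp] at h
    obtain ⟨ψ, hψ⟩ := Ext.contravariant_sequence_exact₁ (S.shortExact n) Y (Ext.mk₀ φ) rfl
      (S.cls_comp_eq_zero (m := 0) _ _ h)
    obtain ⟨ψ, rfl⟩ := (Ext.mk₀_bijective _ _).2 ψ
    rw [Ext.mk₀_comp_mk₀] at hψ
    exact ⟨ψ, (Ext.mk₀_bijective _ _).1 hψ⟩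
  · rintro ⟨ψ, rfl⟩
    rw [cls_succ_comp, ← Ext.mk₀_comp_mk₀]
    rw [show (S.shortExact n).extClass.comp ((Ext.mk₀ (S.i n)).comp (Ext.mk₀ ψ) (add_zero 0)) rfl = 0
      from (S.shortExact n).extClass_comp_assoc (Ext.mk₀ ψ) (h := rfl), Ext.comp_zero]

theorem cls_zero_comp_mk₀_eq_zero_iff (φ : S.Z 0 ⟶ Y) :
    (S.cls 0).comp (Ext.mk₀ φ) (add_zero 0) = 0 ↔ φ = 0 := by
  refine ⟨fun h => ?_, fun h => by rw [h, Ext.mk₀_zero, Ext.comp_zero]⟩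
  exact (Ext.mk₀_eq_zero_iff φ).1 (S.cls_zero_comp_eq_zero _ _ h)

/-- A chain map of degree `-p` lifting `φ : Z p ⟶ X` computes the products with `φ`. -/
theorem cls_comp_mk₀_comp_cls {p : ℕ} (φ : S.Z p ⟶ X) (l : ∀ q, S.Z (p + q) ⟶ S.Z q)
    (L : ∀ q, S.Q (p + q) ⟶ S.Q q) (h₀ : l 0 = φ ≫ S.iso.hom)
    (h₁ : ∀ q, S.i (p + q) ≫ L q = l (q + 1) ≫ S.i q)
    (h₂ : ∀ q, S.p (p + q) ≫ l q = L q ≫ S.p q) (q : ℕ) :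
    ((S.cls p).comp (Ext.mk₀ φ) (add_zero p)).comp (S.cls q) rfl =
      (S.cls (p + q)).comp (Ext.mk₀ (l q)) (add_zero (p + q)) := by
  induction q with
  | zero =>
    rw [h₀, ← Ext.mk₀_comp_mk₀, ← Ext.comp_assoc_of_third_deg_zero]
    rfl
  | succ q ih =>
    -- A chain map is a morphism between the spliced short exact sequences, so naturality of
    -- extension classes carries `l q` past one more step.
    let f : ShortComplex.mk (S.i (p + q)) (S.p (p + q)) (S.i_p (p + q)) ⟶
        ShortComplex.mk (S.i q) (S.p q) (S.i_p q) :=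
      { τ₁ := l (q + 1), τ₂ := L q, τ₃ := l q, comm₁₂ := (h₁ q).symm, comm₂₃ := (h₂ q).symm }
    have h := ShortComplex.ShortExact.extClass_naturality (S.shortExact (p + q)) (S.shortExact q) f
    change _ = ((S.cls (p + q)).comp _ rfl).comp _ _
    rw [Ext.comp_assoc_of_third_deg_zero, h, ← Ext.comp_assoc_of_second_deg_zero, ← ih]
    exact (Ext.comp_assoc ((S.cls p).comp (Ext.mk₀ φ) (add_zero p)) (S.cls q)
      (S.shortExact q).extClass rfl rfl (by omega)).symm

end SplicedResolution

end SplicedResolution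

/-! ### Cochains as right linear maps on the bar modules. -/

section BarCochains

open EnvelopingBimodule

variable {k : Type u} {A : Type v} [CommRing k] [Ring A] [Algebra k A]

namespace EnvelopingBimodule

theorem tmul_isRightLinear {M : EnvelopingBimodule k A} (a : A) :
    IsRightLinear (tmul (M := M) a) := fun b m => by
  rw [smul_tmul, one_mul]

variable (k A) in
/-- The generators `a₁ ⊗ ⋯ ⊗ a_n ⊗ 1` of the right module `bar k A n`. -/
noncomputable def word : ∀ n, MultilinearMap k (fun _ : Fin n => A) (bar k A n)
  | 0 => MultilinearMap.constOfIsEmpty k _ (selfEquiv k A 1)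
  | n + 1 => LinearMap.uncurryLeft
    { toFun a := (tmul a).compMultilinearMap (word n)
      map_add' a b := by
        ext x
        simp only [LinearMap.compMultilinearMap_apply, map_add, LinearMap.add_apply, add_apply]
      map_smul' c a := by
        ext x
        simp only [LinearMap.compMultilinearMap_apply, map_smul, LinearMap.smul_apply, smul_apply,
          RingHom.id_apply] }

theorem word_zero (a : Fin 0 → A) : word k A 0 a = selfEquiv k A 1 := rfl

theorem word_succ (n : ℕ) (a : Fin (n + 1) → A) :
    word k A (n + 1) a = tmul (a 0) (word k A n (Fin.tail a)) := rfl

theorem selfEquiv_eq_smul (x : A) :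
    selfEquiv k A x = ((1 : A) ⊗ₜ[k] MulOpposite.op x) • selfEquiv k A 1 := by
  rw [self_smul, mul_one, one_mul, MulOpposite.unop_op]

/-- The words generate `bar k A n` as a right module, so identities between right linear maps may be
checked on words. -/
theorem IsRightLinear.ext_word {M : EnvelopingBimodule k A} {n : ℕ} {f g : bar k A n →ₗ[k] M}
    (hf : IsRightLinear f) (hg : IsRightLinear g)
    (h : ∀ a, f (word k A n a) = g (word k A n a)) : f = g := by
  induction n with
  | zero =>
    ext x
    obtain ⟨x, rfl⟩ := (selfEquiv k A).surjective x
    rw [selfEquiv_eq_smul]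
    exact (hf _ _).trans ((congrArg _ (h 0)).trans (hg _ _).symm)
  | succ n ih =>
    refine ind_ext fun a w => ?_
    refine LinearMap.congr_fun (ih (f := f ∘ₗ tmul a) (g := g ∘ₗ tmul a)
      (hf.comp (tmul_isRightLinear a)) (hg.comp (tmul_isRightLinear a)) fun x => ?_) w
    exact h (Fin.cons a x)

theorem barD_word (n : ℕ) (a : Fin (n + 1) → A) :
    barD k A n (word k A (n + 1) a) =
      ∑ i : Fin n, (-1 : k) ^ (i : ℕ) • word k A n (Fin.contractNth i.castSucc (· * ·) a) +
        (-1 : k) ^ n • (((1 : A) ⊗ₜ[k] MulOpposite.op (a (Fin.last n))) •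
          word k A n (fun j => a j.castSucc)) := by
  induction n with
  | zero =>
    rw [word_succ, word_zero, barD_zero_tmul, self_smul, Fin.sum_univ_zero]
    refine Eq.trans ?_ (zero_add _).symm
    rw [pow_zero, one_smul, word_zero, self_smul]
    congr 1
    simp
  | succ n ih =>
    have h₀ : word k A (n + 1) (Fin.contractNth 0 (· * ·) a) =
        tmul (a 0 * a 1) (word k A n (Fin.tail (Fin.tail a))) := by
      rw [word_succ]
      rfl
    have h₁ (i : Fin n) : word k A (n + 1) (Fin.contractNth i.succ.castSucc (· * ·) a) =
        tmul (a 0) (word k A n (Fin.contractNth i.castSucc (· * ·) (Fin.tail a))) := by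
      rw [word_succ]
      congr 2
      funext j
      simp only [Fin.tail, Fin.contractNth, Fin.val_castSucc, Fin.val_succ, add_lt_add_iff_right,
        add_left_inj]
      split_ifs <;> rfl
    have h₂ : word k A (n + 1) (fun j => a j.castSucc) =
        tmul (a 0) (word k A n fun j => Fin.tail a j.castSucc) := by
      rw [word_succ]
      rfl
    rw [word_succ, barD_tmul, ih, word_succ, smul_tmul, Fin.sum_univ_succ, Fin.castSucc_zero, h₀, h₂]
    simp only [h₁, smul_tmul, map_add, map_sum, map_smul, Fin.val_zero, pow_zero, one_smul, one_mul,
      Fin.val_succ, pow_succ, mul_neg, mul_one, neg_smul, Finset.sum_neg_distrib]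
    rw [sub_eq_add_neg, neg_add]
    refine Eq.trans ?_ (add_assoc _ _ _).symm
    congr 2
    exact one_smul (A ⊗[k] Aᵐᵒᵖ) _

end EnvelopingBimodule

namespace HochschildCochain

/-- The right linear map on the bar module `bar k A n` determined by a cochain. -/
noncomputable def toBar : ∀ n, HochschildCochain k A n →ₗ[k] bar k A n →ₗ[k] self k A
  | 0 =>
    { toFun f := (selfEquiv k A).toLinearMap ∘ₗ LinearMap.mulLeft k (f 0) ∘ₗ
        (selfEquiv k A).symm.toLinearMap
      map_add' f g := by
        ext x
        simp [add_mul]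
      map_smul' c f := by
        ext x
        simp }
  | n + 1 =>
    { toFun f := indLift (toBar n ∘ₗ f.curryLeft)
      map_add' f g := ind_ext fun a w => by
        simp only [indLift_tmul, LinearMap.add_apply, LinearMap.comp_apply]
        rw [← LinearMap.add_apply, ← map_add]
        rfl
      map_smul' c f := ind_ext fun a w => by
        simp only [indLift_tmul, LinearMap.smul_apply, LinearMap.comp_apply, RingHom.id_apply]
        rw [← LinearMap.smul_apply, ← map_smul]
        rfl }

theorem toBar_zero_apply (f : HochschildCochain k A 0) (x : A) :
    toBar 0 f (selfEquiv k A x) = selfEquiv k A (f 0 * x) := rfl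

theorem toBar_succ_tmul (n : ℕ) (f : HochschildCochain k A (n + 1)) (a : A) (w : bar k A n) :
    toBar (n + 1) f (tmul a w) = toBar n (f.curryLeft a) w := rfl

theorem toBar_isRightLinear {n : ℕ} (f : HochschildCochain k A n) : IsRightLinear (toBar n f) := by
  induction n with
  | zero =>
    intro b x
    obtain ⟨x, rfl⟩ := (selfEquiv k A).surjective x
    rw [toBar_zero_apply, self_smul]
    refine (toBar_zero_apply _ _).trans ?_
    rw [self_smul, one_mul, one_mul, mul_assoc]
  | succ n ih =>
    intro b x
    induction x using ind_induction with
    | tmul a w =>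
      rw [smul_tmul, one_mul, toBar_succ_tmul, toBar_succ_tmul]
      exact ih _ _ _
    | add x y hx hy => simp only [smul_add, map_add, hx, hy]

theorem toBar_word {n : ℕ} (f : HochschildCochain k A n) (a : Fin n → A) :
    toBar n f (word k A n a) = selfEquiv k A (f a) := by
  induction n with
  | zero =>
    rw [word_zero, toBar_zero_apply, mul_one, Subsingleton.elim a 0]
  | succ n ih =>
    rw [word_succ, toBar_succ_tmul]
    refine (ih _ _).trans ?_
    rw [MultilinearMap.curryLeft_apply, Fin.cons_self_tail]

theorem toBar_injective (n : ℕ) : Function.Injective (toBar (k := k) (A := A) n) := fun f g h => by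
  ext a
  apply (selfEquiv k A).injective
  rw [← toBar_word, ← toBar_word, h]

theorem exists_toBar_eq {n : ℕ} {φ : bar k A n →ₗ[k] self k A} (hφ : IsRightLinear φ) :
    ∃ f : HochschildCochain k A n, toBar n f = φ := by
  refine ⟨((selfEquiv k A).symm.toLinearMap ∘ₗ φ).compMultilinearMap (word k A n),
    (toBar_isRightLinear _).ext_word hφ fun a => ?_⟩
  rw [toBar_word]
  exact (selfEquiv k A).apply_symm_apply _

/-- The first summand is the term `a₁ f(a₂, …)`; the second collects the inner multiplications and
the right multiplication, by `barD_word`. A cochain is thus a cocycle exactly when its right linear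
map composed with `barD` is the bimodule map that it induces on `A ⊗ bar k A n`. -/
theorem toBar_coboundary (n : ℕ) (f : HochschildCochain k A n) :
    toBar (n + 1) (coboundary n f) =
      (act (self k A) ∘ₗ indMap (toBar_isRightLinear f)).restrictScalars k -
        toBar n f ∘ₗ (barD k A n).restrictScalars k := by
  refine (toBar_isRightLinear _).ext_word (fun b m => ?_) fun a => ?_
  · rw [LinearMap.sub_apply, LinearMap.sub_apply, smul_sub, IsRightLinear.of_linear,
      ((toBar_isRightLinear f).comp (IsRightLinear.of_linear (barD k A n)))]
  · rw [toBar_word, coboundary_apply, LinearMap.sub_apply, LinearMap.comp_apply]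
    simp only [LinearMap.restrictScalars_apply]
    rw [barD_word, word_succ, LinearMap.comp_apply, indMap_tmul, toBar_word, act_tmul, self_smul]
    simp only [map_add, map_sum, map_smul, toBar_word]
    rw [toBar_isRightLinear, toBar_word, self_smul]
    simp only [pow_succ, mul_neg, mul_one, neg_smul, Finset.sum_neg_distrib, one_mul,
      MulOpposite.unop_one, MulOpposite.unop_op, sub_eq_add_neg, neg_add]
    rw [add_assoc]
    rfl

end HochschildCochain

end BarCochains

/-! ### Hochschild cohomology classes as extension classes. -/

section BarExt

open EnvelopingBimodule CategoryTheory CategoryTheory.Abelian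

variable {k : Type u} {A : Type v} [CommRing k] [Ring A] [Algebra k A]

namespace EnvelopingBimodule

theorem barD_one_tmul_barD (n : ℕ) (w : bar k A (n + 1)) :
    barD k A n (tmul 1 (barD k A n w)) = barD k A n w := by
  cases n with
  | zero => exact one_smul (A ⊗[k] Aᵐᵒᵖ) _
  | succ n => rw [barD_succ_one_tmul, barD_barD, map_zero, sub_zero]

variable (k A) in
/-- The bar resolution, decomposed into short exact sequences. -/
noncomputable def splicedBar [Module.Projective k A] :
    SplicedResolution (ModuleCat.of (A ⊗[k] Aᵐᵒᵖ) (self k A)) where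
  Z n := ModuleCat.of (A ⊗[k] Aᵐᵒᵖ) (LinearMap.range (barD k A n))
  Q n := ModuleCat.of (A ⊗[k] Aᵐᵒᵖ) (bar k A (n + 1))
  i n := ModuleCat.ofHom (LinearMap.range (barD k A (n + 1))).subtype
  p n := ModuleCat.ofHom (barD k A n).rangeRestrict
  i_p n := by
    ext ⟨_, w, rfl⟩
    exact barD_barD n w
  shortExact n := ModuleCat.shortComplex_shortExact _
    (fun x => ⟨fun h => ⟨⟨x, barD_exact n (congrArg Subtype.val h)⟩, rfl⟩, by
      rintro ⟨⟨_, w, rfl⟩, rfl⟩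
      exact Subtype.ext (barD_barD n w)⟩)
    Subtype.val_injective (LinearMap.surjective_rangeRestrict _)
  projective n := by
    have := bar_projective (k := k) (A := A) n
    exact (ModuleCat.of (A ⊗[k] Aᵐᵒᵖ) (bar k A (n + 1))).projective_of_categoryTheory_projective
  iso := ((LinearEquiv.ofTop _ (LinearMap.range_eq_top.2 barD_zero_surjective)).symm).toModuleIso

end EnvelopingBimodule

namespace HochschildCochain

theorem toBar_barD {n : ℕ} {f : HochschildCochain k A n} (hf : f ∈ hochschildCocycles k A n)
    (w : bar k A (n + 1)) :
    toBar n f (barD k A n w) = act (self k A) (indMap (toBar_isRightLinear f) w) := by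
  have h := toBar_coboundary n f
  rw [LinearMap.mem_ker.1 hf, map_zero] at h
  exact (sub_eq_zero.1 (LinearMap.congr_fun h w).symm).symm

/-- The map of bimodules on the boundaries of the bar resolution determined by a cocycle. -/
noncomputable def toBoundaries {n : ℕ} (f : hochschildCocycles k A n) :
    LinearMap.range (barD k A n) →ₗ[A ⊗[k] Aᵐᵒᵖ] self k A where
  toFun x := toBar n f x.1
  map_add' x y := map_add (toBar n (f : HochschildCochain k A n)) x.1 y.1
  map_smul' := by
    rintro r ⟨_, w, rfl⟩
    change toBar n f (r • barD k A n w) = r • toBar n f (barD k A n w)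
    -- Although `toBar n f` is only right linear, on boundaries it is given by a bimodule map
    -- applied to a preimage.
    rw [← map_smul, toBar_barD f.2, toBar_barD f.2, map_smul, map_smul]

variable [Module.Projective k A]

/-- The morphism on the boundaries of the bar resolution determined by a cocycle. -/
noncomputable def toHom {n : ℕ} (f : hochschildCocycles k A n) :
    (splicedBar k A).Z n ⟶ ModuleCat.of (A ⊗[k] Aᵐᵒᵖ) (self k A) :=
  ModuleCat.ofHom (toBoundaries f)

theorem toHom_add {n : ℕ} (f g : hochschildCocycles k A n) :
    toHom (f + g) = toHom f + toHom g := by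
  ext x
  exact LinearMap.congr_fun (map_add (toBar n) (f : HochschildCochain k A n) g) x.1

theorem mk₀_toHom_smul {n : ℕ} (c : k) (f : hochschildCocycles k A n) :
    letI := moduleCatLinear k (A ⊗[k] Aᵐᵒᵖ)
    Ext.mk₀ (toHom (c • f)) = c • Ext.mk₀ (toHom f) := by
  let := moduleCatLinear k (A ⊗[k] Aᵐᵒᵖ)
  refine Eq.trans (congrArg Ext.mk₀ ?_) (Ext.mk₀_smul c (toHom f))
  ext x
  refine (LinearMap.congr_fun (map_smul (toBar n) c (f : HochschildCochain k A n)) x.1).trans ?_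
  exact (algebraMap_smul (A ⊗[k] Aᵐᵒᵖ) c (toBar n f.1 x.1)).symm

variable (k A) in
/-- The extension class determined by a cocycle. -/
noncomputable def toExt (n : ℕ) : hochschildCocycles k A n →ₗ[k] EnvelopingExt k A n where
  toFun f := ((splicedBar k A).cls n).comp (Ext.mk₀ (toHom f)) (add_zero n)
  map_add' f g := by
    rw [toHom_add, Ext.mk₀_add, Ext.comp_add]
    rfl
  map_smul' c f := by
    let := moduleCatLinear k (A ⊗[k] Aᵐᵒᵖ)
    exact (congrArg (fun β => ((splicedBar k A).cls n).comp β (add_zero n))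
      (mk₀_toHom_smul c f)).trans
      (Ext.comp_smul _ _ _ c)

theorem toExt_apply {n : ℕ} (f : hochschildCocycles k A n) :
    toExt k A n f = ((splicedBar k A).cls n).comp (Ext.mk₀ (toHom f)) (add_zero n) := rfl

/-- A bimodule map `φ` on the boundaries extends to the right linear map `w ↦ φ(barD (1 ⊗ w))`. It
agrees with `φ` on boundaries by `barD_one_tmul_barD`, and the cochain that it defines is a cocycle.
-/
theorem toExt_surjective (n : ℕ) : Function.Surjective (toExt k A n) := fun α => by
  obtain ⟨φ, rfl⟩ := (splicedBar k A).exists_cls_comp_mk₀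
    (Y := ModuleCat.of (A ⊗[k] Aᵐᵒᵖ) (self k A)) α
  let φ' : LinearMap.range (barD k A n) →ₗ[A ⊗[k] Aᵐᵒᵖ] self k A := φ.hom
  let h : bar k A (n + 1) →ₗ[A ⊗[k] Aᵐᵒᵖ] self k A := φ' ∘ₗ (barD k A n).rangeRestrict
  have hφ (w : bar k A (n + 1)) : h (tmul 1 (barD k A n w)) = h w :=
    congrArg φ' (Subtype.ext (barD_one_tmul_barD n w))
  obtain ⟨f, hf⟩ := exists_toBar_eq ((IsRightLinear.of_linear h).comp tmul_one_isRightLinear)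
  have hf' (w : bar k A n) : toBar n f w = h (tmul 1 w) := LinearMap.congr_fun hf w
  have hfc : f ∈ hochschildCocycles k A n := by
    apply toBar_injective
    rw [toBar_coboundary, map_zero]
    ext w
    change act (self k A) (indMap (toBar_isRightLinear f) w) - toBar n f (barD k A n w) = 0
    rw [hf', hφ, sub_eq_zero]
    simp only [hf]
    exact (LinearMap.congr_fun (eq_act_comp_indMap h) w).symm
  refine ⟨⟨f, hfc⟩, ?_⟩
  rw [toExt_apply]
  congr 2
  ext ⟨_, w, rfl⟩
  exact (hf' _).trans (hφ w)

theorem toExt_eq_zero_iff {n : ℕ} (f : hochschildCocycles k A n) :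
    toExt k A n f = 0 ↔ (f : HochschildCochain k A n) ∈ hochschildCoboundaries k A n := by
  rw [toExt_apply]
  cases n with
  | zero =>
    refine ((splicedBar k A).cls_zero_comp_mk₀_eq_zero_iff _).trans ?_
    rw [hochschildCoboundaries, Submodule.mem_bot]
    constructor
    · intro h
      apply toBar_injective
      rw [map_zero]
      ext x
      obtain ⟨w, rfl⟩ := barD_zero_surjective x
      exact LinearMap.congr_fun (congrArg ModuleCat.Hom.hom h)
        (⟨_, w, rfl⟩ : LinearMap.range (barD k A 0))
    · intro h
      ext x
      change toBar 0 (f : HochschildCochain k A 0) x.1 = 0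
      rw [h, map_zero, LinearMap.zero_apply]
  | succ n =>
    refine ((splicedBar k A).cls_comp_mk₀_eq_zero_iff _).trans ?_
    constructor
    · rintro ⟨ψ, hψ⟩
      let h : bar k A (n + 1) →ₗ[A ⊗[k] Aᵐᵒᵖ] self k A := ψ.hom
      have hf (w : bar k A (n + 2)) : h (barD k A (n + 1) w) =
          toBar (n + 1) f (barD k A (n + 1) w) :=
        LinearMap.congr_fun (congrArg ModuleCat.Hom.hom hψ)
          (⟨_, w, rfl⟩ : LinearMap.range (barD k A (n + 1)))
      -- The primitive is `g = h(1 ⊗ -)`: evaluating the factorization at `barD (1 ⊗ w)` gives `h(w)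
      -- - h(1 ⊗ barD w)`, which is the coboundary of `g`.
      obtain ⟨g, hg⟩ := exists_toBar_eq ((IsRightLinear.of_linear h).comp tmul_one_isRightLinear)
      refine ⟨g, toBar_injective _ ?_⟩
      rw [toBar_coboundary]
      ext w
      change act (self k A) (indMap (toBar_isRightLinear g) w) - toBar n g (barD k A n w) = _
      simp only [hg]
      have h₁ := LinearMap.congr_fun (eq_act_comp_indMap h) w
      have h₂ := hf (tmul 1 w)
      rw [toBar_barD f.2, barD_succ_one_tmul, map_sub, indMap_tmul, act_tmul] at h₂
      refine Eq.trans ?_ (h₂.trans (one_smul (A ⊗[k] Aᵐᵒᵖ) _))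
      exact congrArg₂ (· - ·) h₁.symm rfl
    · rintro ⟨g, hg⟩
      refine ⟨ModuleCat.ofHom (act (self k A) ∘ₗ indMap (toBar_isRightLinear g)), ?_⟩
      ext ⟨_, w, rfl⟩
      change act (self k A) (indMap (toBar_isRightLinear g) (barD k A (n + 1) w)) =
        toBar (n + 1) (f : HochschildCochain k A (n + 1)) (barD k A (n + 1) w)
      rw [← hg, toBar_coboundary]
      change _ = _ - toBar n g (barD k A n (barD k A (n + 1) w))
      rw [barD_barD, map_zero, sub_zero]
      rfl

end HochschildCochain

end BarExt

/-! ### The Yoneda product of classes of cocycles. -/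

section YonedaProduct

open EnvelopingBimodule CategoryTheory CategoryTheory.Abelian

variable {k : Type u} {A : Type v} [CommRing k] [Ring A] [Algebra k A]

namespace HochschildCochain

/-- The chain map of the bar resolution that lifts a cocycle. -/
noncomputable def barLift {p : ℕ} (f : HochschildCochain k A p) :
    ∀ q, bar k A (p + q) →ₗ[k] bar k A q
  | 0 => toBar p f
  | q + 1 => indLift (tmul.compl₂ (barLift f q))

theorem barLift_tmul {p : ℕ} (f : HochschildCochain k A p) (q : ℕ) (a : A)
    (w : bar k A (p + q)) : barLift f (q + 1) (tmul a w) = tmul a (barLift f q w) := rfl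

theorem barLift_isRightLinear {p : ℕ} (f : HochschildCochain k A p) (q : ℕ) :
    IsRightLinear (barLift f q) := by
  induction q with
  | zero => exact toBar_isRightLinear f
  | succ q ih =>
    intro b x
    induction x using ind_induction with
    | tmul a w =>
      rw [smul_tmul, one_mul]
      refine (barLift_tmul f q _ _).trans ?_
      rw [ih]
      refine Eq.trans ?_ (congrArg _ (barLift_tmul f q a w).symm)
      rw [smul_tmul, one_mul]
    | add x y hx hy => rw [smul_add, map_add, hx, hy, map_add, smul_add]

theorem barLift_smul {p : ℕ} (f : HochschildCochain k A p) (q : ℕ) (r : A ⊗[k] Aᵐᵒᵖ)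
    (w : bar k A (p + q + 1)) : barLift f (q + 1) (r • w) = r • barLift f (q + 1) w :=
  (indMap (barLift_isRightLinear f q)).map_smul r w

/-- `barLift f q` applies `f` to the last `p + 1` tensor factors and leaves the first `q` alone. The
cocycle condition is needed only in degree `0`; the inductive structure of `barD` gives the rest
without signs. -/
theorem barD_barLift {p : ℕ} {f : HochschildCochain k A p} (hf : f ∈ hochschildCocycles k A p)
    (q : ℕ) (w : bar k A (p + q + 1)) :
    barD k A q (barLift f (q + 1) w) = barLift f q (barD k A (p + q) w) := by
  induction q with
  | zero =>
    refine Eq.trans ?_ (toBar_barD hf w).symm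
    rfl
  | succ q ih =>
    induction w using ind_induction with
    | tmul a w =>
      rw [barLift_tmul, barD_tmul, ih, ← barLift_smul, ← barLift_tmul, ← map_sub]
      rfl
    | add x y hx hy => simp only [map_add, hx, hy]

/-- The lift of a cocycle on the boundaries of the bar resolution. -/
noncomputable def boundaryLift {p : ℕ} (f : hochschildCocycles k A p) (q : ℕ) :
    LinearMap.range (barD k A (p + q)) →ₗ[A ⊗[k] Aᵐᵒᵖ] LinearMap.range (barD k A q) where
  toFun x := ⟨barLift f q x.1, by
    obtain ⟨_, w, rfl⟩ := x
    exact ⟨_, barD_barLift f.2 q w⟩⟩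
  map_add' x y := Subtype.ext (map_add (barLift (f : HochschildCochain k A p) q) x.1 y.1)
  map_smul' := by
    rintro r ⟨_, w, rfl⟩
    refine Subtype.ext ?_
    change barLift f.1 q (r • barD k A (p + q) w) = r • barLift f.1 q (barD k A (p + q) w)
    rw [← map_smul, ← barD_barLift f.2, ← barD_barLift f.2, barLift_smul, map_smul]

theorem barLift_word {p : ℕ} (f : HochschildCochain k A p) (q : ℕ) (a : Fin (p + q) → A) :
    barLift f q (word k A (p + q) a) =
      ((1 : A) ⊗ₜ[k] MulOpposite.op (f fun i => a ⟨q + i, by omega⟩)) •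
        word k A q (fun i => a ⟨i, by omega⟩) := by
  induction q with
  | zero =>
    rw [word_zero, ← selfEquiv_eq_smul]
    refine (toBar_word f a).trans (congrArg _ (congrArg f (funext fun i => congrArg a ?_)))
    exact Fin.ext (zero_add _).symm
  | succ q ih =>
    refine (congrArg (tmul (a 0)) (ih (Fin.tail a))).trans ?_
    rw [word_succ, smul_tmul, one_mul]
    refine congrArg (fun y => tmul (M := bar k A q) (a 0)
      (((1 : A) ⊗ₜ[k] MulOpposite.op (f y)) • word k A q fun i => a ⟨i + 1, by omega⟩)) ?_
    funext i
    exact congrArg a (Fin.ext (by simp only [Fin.val_succ]; omega))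

/-- In the composite `g` takes the first arguments and `f` the last ones, so composition of chain
maps gives the cup product in the opposite order. -/
theorem toBar_barLift {p q : ℕ} (f : HochschildCochain k A p) (g : HochschildCochain k A q)
    (w : bar k A (p + q)) :
    toBar q g (barLift f q w) = toBar (p + q) (cup (Nat.add_comm q p) g f) w := by
  refine LinearMap.congr_fun (IsRightLinear.ext_word (f := toBar q g ∘ₗ barLift f q)
    ((toBar_isRightLinear g).comp (barLift_isRightLinear f q)) (toBar_isRightLinear _)
    fun a => ?_) w
  rw [LinearMap.comp_apply, barLift_word, toBar_isRightLinear, toBar_word, toBar_word, self_smul,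
    cup_apply, one_mul, MulOpposite.unop_op]

variable [Module.Projective k A]

theorem toExt_comp_toExt {p q n : ℕ} (h : p + q = n) (f : hochschildCocycles k A p)
    (g : hochschildCocycles k A q)
    (hc : cup ((Nat.add_comm q p).trans h) g.1 f.1 ∈ hochschildCocycles k A n) :
    (toExt k A p f).comp (toExt k A q g) h = toExt k A n ⟨_, hc⟩ := by
  subst h
  have key := (splicedBar k A).cls_comp_mk₀_comp_cls (toHom f)
    (fun q => ModuleCat.ofHom (boundaryLift f q))
    (fun q => ModuleCat.ofHom (indMap (barLift_isRightLinear f.1 q)))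
    (by ext x; rfl) (fun q => by ext x; rfl)
    (fun q => by ext w; exact Subtype.ext (barD_barLift f.2 q w).symm) q
  rw [toExt_apply, toExt_apply, toExt_apply]
  refine (Ext.comp_assoc_of_third_deg_zero _ _ _ _).symm.trans ?_
  refine (congrArg (fun α => α.comp (Ext.mk₀ (toHom g)) (add_zero _)) key).trans ?_
  refine (Ext.comp_assoc_of_third_deg_zero _ _ _ _).trans ?_
  refine congrArg (fun β => ((splicedBar k A).cls (p + q)).comp β (add_zero _))
    ((Ext.mk₀_comp_mk₀ _ _).trans (congrArg Ext.mk₀ ?_))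
  ext x
  exact toBar_barLift f.1 g.1 x.1

end HochschildCochain

end YonedaProduct

/-! ### Transport of structure along linear equivalences. -/

section Transport

variable {k : Type u} [CommRing k] {V : ℕ → Type v} [∀ n, AddCommGroup (V n)]
  [∀ n, Module k (V n)] {W : ℕ → Type w} [∀ n, AddCommGroup (W n)] [∀ n, Module k (W n)]

/-- A bilinear map transported along linear equivalences. -/
def LinearEquiv.transportBilinear {V₁ V₂ V₃ : Type v} {W₁ W₂ W₃ : Type w} [AddCommGroup V₁]
    [AddCommGroup V₂] [AddCommGroup V₃] [AddCommGroup W₁] [AddCommGroup W₂] [AddCommGroup W₃]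
    [Module k V₁] [Module k V₂] [Module k V₃] [Module k W₁] [Module k W₂] [Module k W₃]
    (e₁ : V₁ ≃ₗ[k] W₁) (e₂ : V₂ ≃ₗ[k] W₂) (e₃ : V₃ ≃ₗ[k] W₃) (f : V₁ →ₗ[k] V₂ →ₗ[k] V₃) :
    W₁ →ₗ[k] W₂ →ₗ[k] W₃ :=
  (f.compl₁₂ e₁.symm.toLinearMap e₂.symm.toLinearMap).compr₂ e₃.toLinearMap

theorem LinearEquiv.transportBilinear_apply {V₁ V₂ V₃ : Type v} {W₁ W₂ W₃ : Type w}
    [AddCommGroup V₁] [AddCommGroup V₂] [AddCommGroup V₃] [AddCommGroup W₁] [AddCommGroup W₂]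
    [AddCommGroup W₃] [Module k V₁] [Module k V₂] [Module k V₃] [Module k W₁] [Module k W₂]
    [Module k W₃] (e₁ : V₁ ≃ₗ[k] W₁) (e₂ : V₂ ≃ₗ[k] W₂) (e₃ : V₃ ≃ₗ[k] W₃)
    (f : V₁ →ₗ[k] V₂ →ₗ[k] V₃) (x : W₁) (y : W₂) :
    transportBilinear e₁ e₂ e₃ f x y = e₃ (f (e₁.symm x) (e₂.symm y)) := rfl

/-- A Batalin-Vilkovisky algebra transported along linear equivalences. -/
def BatalinVilkoviskyAlgebra.transport (S : BatalinVilkoviskyAlgebra k V)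
    (e : ∀ n, V n ≃ₗ[k] W n) : BatalinVilkoviskyAlgebra k W where
  cup p q n := LinearEquiv.transportBilinear (e p) (e q) (e n) (S.cup p q n)
  one := e 0 S.one
  bracket p q n := LinearEquiv.transportBilinear (e p) (e q) (e n) (S.bracket p q n)
  B p n := (e n).toLinearMap ∘ₗ S.B p n ∘ₗ (e p).symm.toLinearMap
  cup_eq_zero p q n h := by
    ext x y
    simp [LinearEquiv.transportBilinear_apply, S.cup_eq_zero p q n h]
  bracket_eq_zero p q n h := by
    ext x y
    simp [LinearEquiv.transportBilinear_apply, S.bracket_eq_zero p q n h]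
  cup_assoc p q r n a b c h := by
    simp [LinearEquiv.transportBilinear_apply, S.cup_assoc p q r n _ _ _ h]
  one_cup p a := by
    simp [LinearEquiv.transportBilinear_apply, S.one_cup]
  cup_one p a := by
    simp [LinearEquiv.transportBilinear_apply, S.cup_one]
  cup_comm p q n a b := by
    rw [LinearEquiv.transportBilinear_apply, LinearEquiv.transportBilinear_apply, S.cup_comm, map_smul]
  bracket_antisymm p q n a b := by
    rw [LinearEquiv.transportBilinear_apply, LinearEquiv.transportBilinear_apply, S.bracket_antisymm, map_neg, map_smul]
  jacobi p q r n a b c h := by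
    simp only [LinearEquiv.transportBilinear_apply, LinearEquiv.symm_apply_apply]
    rw [S.jacobi p q r n _ _ _ h, map_add, map_smul]
  leibniz p q r n c a b h := by
    simp only [LinearEquiv.transportBilinear_apply, LinearEquiv.symm_apply_apply]
    rw [S.leibniz p q r n _ _ _ h, map_add, map_smul]
  B_eq_zero p n h := by
    rw [S.B_eq_zero p n h, LinearMap.zero_comp, LinearMap.comp_zero]
  B_B n a := by
    simp [S.B_B]
  bracket_eq p q n a b h := by
    simp only [LinearEquiv.transportBilinear_apply, LinearMap.comp_apply, LinearEquiv.coe_coe,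
      LinearEquiv.symm_apply_apply]
    rw [S.bracket_eq p q n _ _ h, map_smul, map_sub, map_sub, map_smul]

/-- Two surjections with the same kernel have isomorphic targets. -/
theorem LinearMap.exists_equiv_of_ker_eq {M N₁ N₂ : Type*} [AddCommGroup M] [AddCommGroup N₁]
    [AddCommGroup N₂] [Module k M] [Module k N₁] [Module k N₂] (f : M →ₗ[k] N₁) (g : M →ₗ[k] N₂)
    (hf : Function.Surjective f) (hg : Function.Surjective g) (h : ∀ x, f x = 0 ↔ g x = 0) :
    ∃ e : N₁ ≃ₗ[k] N₂, ∀ x, e (f x) = g x := by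
  refine ⟨(f.quotKerEquivOfSurjective hf).symm ≪≫ₗ
    Submodule.quotEquivOfEq (LinearMap.ker f) (LinearMap.ker g) (Submodule.ext h) ≪≫ₗ
    g.quotKerEquivOfSurjective hg, fun x => ?_⟩
  rw [LinearEquiv.trans_apply, LinearEquiv.trans_apply,
    LinearMap.quotKerEquivOfSurjective_symm_apply, Submodule.quotEquivOfEq_mk,
    LinearMap.quotKerEquivOfSurjective_apply_mk]

end Transport

/-! ### The multiplicative isomorphism between Hochschild cohomology and `Ext`. -/

section YonedaIso

open HochschildCochain CategoryTheory.Abelian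

variable {k : Type u} {A : Type v} [CommRing k] [Ring A] [Algebra k A]

/-- The sign `(-1)^(n choose 2)` has coboundary `(-1)^(p * q)`, so rescaling by it turns a graded
opposite product into the original one. -/
theorem neg_one_pow_add_choose_two (p q : ℕ) :
    (-1 : k) ^ (p + q).choose 2 = (-1) ^ (p * q) * ((-1) ^ p.choose 2 * (-1) ^ q.choose 2) := by
  induction q with
  | zero => simp
  | succ q ih =>
    rw [← add_assoc, Nat.choose_succ_succ' (p + q) 1, Nat.choose_succ_succ' q 1, Nat.choose_one_right,
      Nat.choose_one_right, pow_add, ih, mul_add_one, pow_add _ (p * q), pow_add _ p q,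
      pow_add _ q (q.choose 2)]
    ring

theorem exists_isRepresentedBy {n : ℕ} (x : HochschildCohomology k A n) :
    ∃ f, IsRepresentedBy x f := by
  obtain ⟨_, f, hf, rfl⟩ := x
  exact ⟨f, hf, rfl⟩

variable (k A) in
/-- The cohomology class of a cocycle. -/
noncomputable def cocycleClass (n : ℕ) :
    hochschildCocycles k A n →ₗ[k] HochschildCohomology k A n where
  toFun z := ⟨(hochschildCoboundaries k A n).mkQ z, z, z.2, rfl⟩
  map_add' _ _ := rfl
  map_smul' _ _ := rfl

theorem cocycleClass_surjective (n : ℕ) : Function.Surjective (cocycleClass k A n) := by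
  rintro ⟨_, f, hf, rfl⟩
  exact ⟨⟨f, hf⟩, rfl⟩

theorem cocycleClass_eq_zero_iff {n : ℕ} (z : hochschildCocycles k A n) :
    cocycleClass k A n z = 0 ↔ (z : HochschildCochain k A n) ∈ hochschildCoboundaries k A n := by
  rw [← Submodule.Quotient.mk_eq_zero]
  exact Subtype.ext_iff

variable [Module.Projective k A]

variable (k A) in
theorem exists_hochschildEquivExt (n : ℕ) :
    ∃ e : HochschildCohomology k A n ≃ₗ[k] EnvelopingExt k A n,
      ∀ z, e (cocycleClass k A n z) = toExt k A n z :=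
  LinearMap.exists_equiv_of_ker_eq (M := hochschildCocycles k A n)
    (N₁ := HochschildCohomology k A n) (N₂ := EnvelopingExt k A n) (cocycleClass k A n)
    (toExt k A n) (cocycleClass_surjective n) (toExt_surjective n)
    fun z => (cocycleClass_eq_zero_iff z).trans (toExt_eq_zero_iff z).symm

variable (k A) in
/-- Hochschild cohomology as the self-extensions of the bimodule `A`; the isomorphism reverses the
order of products. -/
noncomputable def hochschildEquivExt (n : ℕ) : HochschildCohomology k A n ≃ₗ[k] EnvelopingExt k A n :=
  (exists_hochschildEquivExt k A n).choose

theorem hochschildEquivExt_eq {n : ℕ} {x : HochschildCohomology k A n} {f : HochschildCochain k A n}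
    (h : IsRepresentedBy x f) : hochschildEquivExt k A n x = toExt k A n ⟨f, h.1⟩ :=
  (congrArg (hochschildEquivExt k A n) (Subtype.ext h.2.symm)).trans
    ((exists_hochschildEquivExt k A n).choose_spec ⟨f, h.1⟩)

variable (k A) in
/-- Hochschild cohomology as the self-extensions of the bimodule `A`, with signs that make the
isomorphism multiplicative. -/
noncomputable def hochschildEquivYoneda (n : ℕ) :
    HochschildCohomology k A n ≃ₗ[k] EnvelopingExt k A n :=
  hochschildEquivExt k A n ≪≫ₗ LinearEquiv.smulOfUnit ((-1) ^ n.choose 2)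

theorem hochschildEquivYoneda_apply (n : ℕ) (x : HochschildCohomology k A n) :
    hochschildEquivYoneda k A n x = (-1 : k) ^ n.choose 2 • hochschildEquivExt k A n x := by
  refine (Units.smul_def ((-1 : kˣ) ^ n.choose 2) _).trans ?_
  rw [Units.val_pow_eq_pow_val, Units.val_neg, Units.val_one]
  rfl

/-- The unscaled equivalence sends `y ⌣ x` to the Yoneda product of `x` and `y`. Graded
commutativity replaces `y ⌣ x` by `x ⌣ y` at the cost of `(-1)^(p * q)`, which the rescaling
absorbs. -/
theorem hochschildEquivYoneda_cup (S : GerstenhaberAlgebra k (fun n => HochschildCohomology k A n))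
    (hS : ∀ (p q n : ℕ) (h : p + q = n) (x : HochschildCohomology k A p)
      (y : HochschildCohomology k A q) (f : HochschildCochain k A p) (g : HochschildCochain k A q),
      IsRepresentedBy x f → IsRepresentedBy y g →
        IsRepresentedBy (S.cup p q n x y) (HochschildCochain.cup h f g))
    {p q n : ℕ} (h : p + q = n) (x : HochschildCohomology k A p) (y : HochschildCohomology k A q) :
    hochschildEquivYoneda k A n (S.cup p q n x y) =
      (hochschildEquivYoneda k A p x).comp (hochschildEquivYoneda k A q y) h := by
  obtain ⟨f, hf⟩ := exists_isRepresentedBy x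
  obtain ⟨g, hg⟩ := exists_isRepresentedBy y
  have key := toExt_comp_toExt h ⟨f, hf.1⟩ ⟨g, hg.1⟩ (hS q p n (by omega) y x g f hg hf).1
  rw [← hochschildEquivExt_eq hf, ← hochschildEquivExt_eq hg, ← hochschildEquivExt_eq
    (hS q p n (by omega) y x g f hg hf)] at key
  let := moduleCatLinear k (A ⊗[k] Aᵐᵒᵖ)
  rw [hochschildEquivYoneda_apply, hochschildEquivYoneda_apply, hochschildEquivYoneda_apply,
    S.cup_comm, map_smul, ← key, smul_smul]
  refine Eq.trans ?_ (Ext.comp_smul _ _ h _).symm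
  refine Eq.trans ?_ (congrArg _ (Ext.smul_comp _ _ h _).symm)
  rw [smul_smul]
  refine congrArg (fun c : k => c • _) ?_
  subst h
  rw [neg_one_pow_add_choose_two]
  linear_combination ((-1 : k) ^ p.choose 2 * (-1) ^ q.choose 2) *
    (Even.neg_one_pow (α := k) ⟨p * q, rfl⟩)

end YonedaIso

/-! ### Assembly of the four statements. -/

theorem corollary6p1 {k : Type u} {A : Type v} [CommRing k] [Ring A] [Algebra k A]
    (γ : Contraaction k A) :
    (∃ P : ParaCyclicOperadWithMultiplication k (HochschildCochain k A),
      (∀ (p q r : ℕ) (h : p + q = r + 1) (i : Fin p)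
        (f : HochschildCochain k A p) (g : HochschildCochain k A q),
        P.comp p q r (i + 1) f g = HochschildCochain.comp h i f g) ∧
      P.one = HochschildCochain.one k A ∧
      P.mul = HochschildCochain.mul k A ∧
      P.unit = HochschildCochain.unit k A ∧
      (∀ (n : ℕ) (f : HochschildCochain k A n), P.tau n f = γ.tau f) ∧
      (γ.IsStable → P.IsCyclic)) ∧
    (∃ P : ParaCocyclicModule k (HochschildCochain k A),
      (∀ (n : ℕ) (i : Fin (n + 2)) (f : HochschildCochain k A n),
        P.delta n i f = HochschildCochain.coface i f) ∧
      (∀ (n : ℕ) (j : Fin (n + 1)) (f : HochschildCochain k A (n + 1)),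
        P.sigma n j f = HochschildCochain.codegeneracy j f) ∧
      (∀ (n : ℕ) (f : HochschildCochain k A n), P.tau n f = γ.tau f) ∧
      (γ.IsStable → P.IsCocyclic)) ∧
    (γ.IsStable →
      ∃ S : BatalinVilkoviskyAlgebra k (fun n => HochschildCohomology k A n),
        IsRepresentedBy S.one (HochschildCochain.unit k A) ∧
        (∀ (p q n : ℕ) (h : p + q = n) (x : HochschildCohomology k A p)
          (y : HochschildCohomology k A q)
          (f : HochschildCochain k A p) (g : HochschildCochain k A q),
          IsRepresentedBy x f → IsRepresentedBy y g →
          IsRepresentedBy (S.cup p q n x y) (HochschildCochain.cup h f g)) ∧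
        (∀ (p q n : ℕ) (h : p + q = n + 1) (x : HochschildCohomology k A p)
          (y : HochschildCohomology k A q)
          (f : HochschildCochain k A p) (g : HochschildCochain k A q),
          IsRepresentedBy x f → IsRepresentedBy y g →
          IsRepresentedBy (S.bracket p q n x y) (HochschildCochain.gerstenhaberBracket h f g)) ∧
        (∀ (n : ℕ) (x : HochschildCohomology k A (n + 1)) (f : HochschildCochain k A (n + 1)),
          IsRepresentedBy x f → IsRepresentedBy (S.B (n + 1) n x) (γ.connesB f)) ∧
        (Module.Projective k A →
          ∃ (T : BatalinVilkoviskyAlgebra k (fun n => EnvelopingExt k A n))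
            (e : ∀ n : ℕ, HochschildCohomology k A n ≃ₗ[k] EnvelopingExt k A n),
            (∀ (p q n : ℕ) (h : p + q = n) (x : EnvelopingExt k A p) (y : EnvelopingExt k A q),
              T.cup p q n x y = x.comp y h) ∧
            e 0 S.one = T.one ∧
            (∀ p q n x y, e n (S.cup p q n x y) = T.cup p q n (e p x) (e q y)) ∧
            (∀ p q n x y, e n (S.bracket p q n x y) = T.bracket p q n (e p x) (e q y)) ∧
            (∀ p n x, e n (S.B p n x) = T.B p n (e p x)))) := by
  refine ⟨⟨γ.paraCyclicOperad, fun p q r h i f g => HochschildCochain.compHom_eq h i f g, rfl, rfl, rfl,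
    fun _ _ => rfl, fun hγ => hγ.isCyclic⟩,
    ⟨γ.paraCyclicOperad_isUnital.toParaCocyclicModule, fun n i f => HochschildCochain.operad_face i f,
      fun n j f => HochschildCochain.compHom_eq _ j f _, fun _ _ => rfl, fun hγ => hγ.isCyclic⟩,
    fun hγ => ?_⟩
  obtain ⟨S, h₁, h₂, h₃, h₄⟩ := hγ.exists_batalinVilkoviskyAlgebra
  refine ⟨S, h₁, h₂, h₃, h₄, fun _ => ⟨S.transport (hochschildEquivYoneda k A),
    hochschildEquivYoneda k A, fun p q n h x y => ?_, rfl, fun p q n x y => ?_, fun p q n x y => ?_,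
    fun p n x => ?_⟩⟩
  -- The transported cup product is the Yoneda product because the equivalence is multiplicative;
  -- the other compatibilities hold by construction of the transport.
  · refine (hochschildEquivYoneda_cup S.toGerstenhaberAlgebra h₂ h _ _).trans ?_
    exact congrArg₂ (fun (a : EnvelopingExt k A p) (b : EnvelopingExt k A q) => a.comp b h)
      (LinearEquiv.apply_symm_apply _ _) (LinearEquiv.apply_symm_apply _ _)
  · simp only [BatalinVilkoviskyAlgebra.transport, LinearEquiv.transportBilinear_apply,
      LinearEquiv.symm_apply_apply]
  · simp only [BatalinVilkoviskyAlgebra.transport, LinearEquiv.transportBilinear_apply,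
      LinearEquiv.symm_apply_apply]
  · simp only [BatalinVilkoviskyAlgebra.transport, LinearMap.comp_apply, LinearEquiv.coe_coe,
      LinearEquiv.symm_apply_apply]
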